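/- **Proposition 3.1.** Write $\langle v\rangle=(1+|v|^2)^{1/2}$, $\Pi(z)=\mathrm{Id}-\frac{z\otimes z}{|z|^2}$, and for $g:\mathbb R^3\to\mathbb R$ $$A[g]=\frac{\Pi(v)}{8\pi|v|}*g,\qquad a[g]=\frac{1}{4\pi|v|}*g .$$ Fix $p>\frac32$, $m>\frac92\,\frac{p-1}{p-3/2}$, $M>0$ and $N\in\mathbb R$. There are a time $T_0>0$ and a constant $C$, depending only on $p$, $m$, $M$ and $N$, such that the following holds for every $T>0$. Let $f:[0,T]\times\mathbb R^3\to[0,\infty)$ be a smooth, rapidly decaying solution of the homogeneous Landau–Coulomb equation $$\partial_t f=\nabla\cdot\bigl(A[f]\nabla f-f\,\nabla a[f]\bigr),$$ that is, $f$ is continuous on $[0,T]\times\mathbb R^3$, is $C^\infty$ on $(0,T)\times\mathbb R^3$, satisfies $\sup_{0<t<T,\,v\in\mathbb R^3}|v|^k|D_v^nf(t,v)|<\infty$ for all integers $k,n\ge0$, and satisfies the equation pointwise on $(0,T)\times\mathbb R^3$. Suppose that its initial datum $f_{in}=f(0,\cdot)$ satisfies $$\int_{\mathbb R^3} f_{in}\,dv=1,\qquad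 \int_{\mathbb R^3} v\,f_{in}\,dv=0,\qquad \int_{\mathbb R^3}|v|^2f_{in}\,dv=3,$$ $$\int_{\mathbb R^3}\langle v\rangle^m f_{in}\,dv+\int_{\mathbb R^3}f_{in}\,|\log f_{in}|\,dv\le M,\qquad \|f_{in}\|_{L^p}\le N .$$ Then $$\sup_{t\in(0,\min(T,T_0))}\|f(t)\|_{L^p}^p+\int_0^{\min(T,T_0)}\int_{\mathbb R^3}\langle v\rangle^{-3}\bigl|\nabla f^{p/2}\bigr|^2\,dv\,dt\le C .$$ -/

import Mathlib

open MeasureTheory Set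
open scoped ContDiff ENNReal

namespace Landau

noncomputable section

/-- Velocity space `ℝ³` with its Euclidean norm. -/
abbrev Vel : Type := EuclideanSpace ℝ (Fin 3)

/-- The Japanese bracket `⟨v⟩ = (1 + |v|²)^{1/2}`. -/
def bracket (v : Vel) : ℝ := Real.sqrt (1 + ‖v‖ ^ 2)

/-- The matrix `Π(z) = Id - z ⊗ z / |z|²`. -/
def proj (z : Vel) : Matrix (Fin 3) (Fin 3) ℝ :=
  Matrix.of fun i j => (if i = j then 1 else 0) - z i * z j / ‖z‖ ^ 2

/-- The diffusion matrix `A[g] = (Π(v) / (8π|v|)) * g` (convolution, entry by entry). -/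
def diffusion (g : Vel → ℝ) (v : Vel) : Matrix (Fin 3) (Fin 3) ℝ :=
  Matrix.of fun i j => ∫ w, proj (v - w) i j / (8 * Real.pi * ‖v - w‖) * g w

/-- The Coulomb potential `a[g] = (-Δ)⁻¹ g = (1 / (4π|v|)) * g`. -/
def potential (g : Vel → ℝ) (v : Vel) : ℝ :=
  ∫ w, 1 / (4 * Real.pi * ‖v - w‖) * g w

/-- The partial derivative `∂ᵢ g (v)`. -/
def partialDeriv (i : Fin 3) (g : Vel → ℝ) (v : Vel) : ℝ :=
  fderiv ℝ g v (EuclideanSpace.single i 1)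

/-- The `i`-th component of `A[g]∇g - g ∇a[g]`. -/
def flux (g : Vel → ℝ) (i : Fin 3) (v : Vel) : ℝ :=
  (∑ j, diffusion g v i j * partialDeriv j g v) - partialDeriv i (potential g) v * g v

/-- The collision operator `∇ · (A[g]∇g - g ∇a[g])`. -/
def collision (g : Vel → ℝ) (v : Vel) : ℝ :=
  ∑ i, partialDeriv i (flux g i) v

/-- `f : [0,T] × ℝ³ → [0,∞)` is a smooth, rapidly decaying solution of the Landau-Coulomb equation:
it is continuous up to the initial time and smooth in the interior, it belongs to the Schwartz class
in the velocity variable uniformly in time, and it solves the equation pointwise.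
Only the values `f t v` with `0 ≤ t ≤ T` matter. -/
structure IsSchwartzSolution (T : ℝ) (f : ℝ → Vel → ℝ) : Prop where
  nonneg : ∀ t ∈ Icc 0 T, ∀ v, 0 ≤ f t v
  continuousOn : ContinuousOn (fun x : ℝ × Vel => f x.1 x.2) (Icc 0 T ×ˢ univ)
  smooth : ContDiffOn ℝ ∞ (fun x : ℝ × Vel => f x.1 x.2) (Ioo 0 T ×ˢ univ)
  decay : ∀ k n : ℕ, ∃ C : ℝ, ∀ t ∈ Ioo 0 T, ∀ v,
    ‖v‖ ^ k * ‖iteratedFDeriv ℝ n (f t) v‖ ≤ C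
  equation : ∀ t ∈ Ioo 0 T, ∀ v, HasDerivAt (fun s => f s v) (collision (f t) v) t

/-- The normalization of mass, momentum and energy: `∫ g = 1`, `∫ v g = 0`, `∫ |v|² g = 3`. -/
def IsNormalized (g : Vel → ℝ) : Prop :=
  (∫ v, g v = 1) ∧ (∫ v, g v • v = 0) ∧ (∫ v, ‖v‖ ^ 2 * g v = 3)

end

end Landau

namespace Landau

open scoped SchwartzMap LineDeriv Topology

open Filter

noncomputable section

/-! The argument closes a pair of differential inequalities for Y(t) = ∫ f^p and E(t) = ∫ ⟨v⟩^m f,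
and runs them by continuity from the initial datum.

Testing the equation with p f^{p-1} gives a dissipation -(4(p-1)/p) ∫ A[f]∇f^{p/2}·∇f^{p/2} and a
drift (p-1) ∫ ∇f^p·∇a[f]. Bounds on the mass, the second moment and the L^p norm keep a fixed share
of the mass inside a ball and away from thin slabs, so A[f] ≥ c⟨v⟩^{-3} (`exists_coercivity`). Since
-Δa[f] = f, the drift is at most a multiple of ∫ f^{p+1} (`sum_integral_drift_le`). The Sobolev
inequality for ⟨v⟩^{-3/2} f^{p/2} controls ∫ ⟨v⟩^{-9} f^{3p} by the cube of dissipation plus Y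
(`exists_weighted_sobolev`). Hölder's inequality between this quantity, E and Y then bounds ∫
f^{p+1} by a power of the dissipation. That power is below one exactly under the assumed lower bound
on m, so the drift is absorbed (`exists_interpolation`).

The moment needs no dissipation. Symmetrising the weak form in the two velocities trades one factor
|v-w| for the 1/|v-w|² singularity, so |E'| ≤ C‖f * |·|^{-1}‖_∞ E
(`abs_integral_bracket_mul_collision_le`), and for p > 3/2 mass and L^p norm bound the potential
(`conv_inv_norm_le`). Thus, while Y and E stay within one unit of their initial bounds, both have
derivative at most C (`exists_apriori`). They therefore stay there up to a time depending only on C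
(`le_of_bootstrap`), and integrating the inequality for Y bounds the dissipation.

Two technical devices make this rigorous. As f may vanish, f^{p-1} and f^{p/2} are differentiated
through |∇f|² ≤ 4Lf, valid for nonnegative C^{1,1} functions and sufficient for all powers above
1/2; this covers p-1 because p > 3/2. Singular kernels are replaced by functions of
(|z|²+ε²)^{-1/2}, and only bounds uniform in ε are passed to the limit. -/

/-! ### Rapid decay and polynomial growth -/

/-- `g` decays faster than every power of `1 + ‖v‖`. -/
def Rapid (g : Vel → ℝ) : Prop :=
  ∀ k : ℕ, ∃ C, 0 ≤ C ∧ ∀ v, |g v| ≤ C * ((1 + ‖v‖) ^ k)⁻¹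

/-- `u` grows at most polynomially. -/
def Poly (u : Vel → ℝ) : Prop :=
  ∃ (n : ℕ) (C : ℝ), 0 ≤ C ∧ ∀ v, |u v| ≤ C * (1 + ‖v‖) ^ n

lemma one_add_norm_pos (v : Vel) : 0 < 1 + ‖v‖ := by positivity

lemma integrable_weight : Integrable (fun v : Vel => ((1 + ‖v‖) ^ 4)⁻¹) := by
  have h := integrable_one_add_norm (E := Vel) (μ := volume) (r := 4) (by simp; norm_num)
  refine h.congr (ae_of_all _ fun v => ?_)
  simp only
  rw [Real.rpow_neg (one_add_norm_pos v).le]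
  norm_cast

lemma Rapid.integrable {g : Vel → ℝ} (hg : Rapid g) (hm : AEStronglyMeasurable g volume) :
    Integrable g := by
  obtain ⟨C, -, h⟩ := hg 4
  exact (integrable_weight.const_mul C).mono' hm (ae_of_all _ fun v => h v)

lemma Rapid.mono {g h : Vel → ℝ} (hg : Rapid g) (hh : ∀ v, |h v| ≤ |g v|) : Rapid h := fun k =>
  let ⟨C, hC, H⟩ := hg k
  ⟨C, hC, fun v => (hh v).trans (H v)⟩

lemma Poly.mul_rapid {u g : Vel → ℝ} (hu : Poly u) (hg : Rapid g) :
    Rapid (fun v => u v * g v) := by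
  obtain ⟨n, C, hC, hu⟩ := hu
  intro k
  obtain ⟨D, hD, hg⟩ := hg (n + k)
  refine ⟨C * D, by positivity, fun v => ?_⟩
  have hp := one_add_norm_pos v
  calc |u v * g v| = |u v| * |g v| := abs_mul _ _
    _ ≤ (C * (1 + ‖v‖) ^ n) * (D * ((1 + ‖v‖) ^ (n + k))⁻¹) :=
        mul_le_mul (hu v) (hg v) (abs_nonneg _) (by positivity)
    _ = C * D * ((1 + ‖v‖) ^ k)⁻¹ := by rw [pow_add]; field_simp

lemma Rapid.mul_poly {u g : Vel → ℝ} (hg : Rapid g) (hu : Poly u) :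
    Rapid (fun v => g v * u v) := by
  simpa only [mul_comm] using hu.mul_rapid hg

lemma Poly.of_bound {u : Vel → ℝ} {C : ℝ} (h : ∀ v, |u v| ≤ C) : Poly u :=
  ⟨0, C, (abs_nonneg _).trans (h 0), by simpa using h⟩

lemma Rapid.bounded {g : Vel → ℝ} (hg : Rapid g) : ∃ C, 0 ≤ C ∧ ∀ v, |g v| ≤ C := by
  obtain ⟨C, hC, h⟩ := hg 0
  exact ⟨C, hC, by simpa using h⟩

lemma Rapid.poly {g : Vel → ℝ} (hg : Rapid g) : Poly g :=
  let ⟨_, _, h⟩ := hg.bounded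
  .of_bound h

lemma Rapid.mul {g h : Vel → ℝ} (hg : Rapid g) (hh : Rapid h) : Rapid (fun v => g v * h v) :=
  hg.mul_poly hh.poly

lemma Poly.mul {u w : Vel → ℝ} (hu : Poly u) (hw : Poly w) : Poly (fun v => u v * w v) := by
  obtain ⟨n, C, hC, hu⟩ := hu
  obtain ⟨k, D, hD, hw⟩ := hw
  refine ⟨n + k, C * D, by positivity, fun v => ?_⟩
  calc |u v * w v| = |u v| * |w v| := abs_mul _ _
    _ ≤ (C * (1 + ‖v‖) ^ n) * (D * (1 + ‖v‖) ^ k) :=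
        mul_le_mul (hu v) (hw v) (abs_nonneg _) (by positivity)
    _ = _ := by rw [pow_add]; ring

lemma Rapid.add {g h : Vel → ℝ} (hg : Rapid g) (hh : Rapid h) : Rapid (fun v => g v + h v) := by
  intro k
  obtain ⟨C, hC, hg⟩ := hg k
  obtain ⟨D, hD, hh⟩ := hh k
  refine ⟨C + D, by positivity, fun v => ?_⟩
  rw [add_mul]
  exact (abs_add_le _ _).trans (add_le_add (hg v) (hh v))

lemma Rapid.const_mul {g : Vel → ℝ} (hg : Rapid g) (c : ℝ) : Rapid (fun v => c * g v) :=
  (Poly.of_bound (C := |c|) fun _ => le_rfl).mul_rapid hg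

lemma Rapid.sum {ι : Type*} {s : Finset ι} {g : ι → Vel → ℝ} (hg : ∀ i ∈ s, Rapid (g i)) :
    Rapid (fun v => ∑ i ∈ s, g i v) := by
  classical
  induction s using Finset.induction_on with
  | empty => exact fun k => ⟨0, le_rfl, by simp⟩
  | insert a s ha ih =>
    simp only [Finset.sum_insert ha]
    exact (hg a (by simp)).add (ih fun i hi => hg i (by simp [hi]))

lemma Rapid.rpow {g : Vel → ℝ} (hg : Rapid g) (h0 : ∀ v, 0 ≤ g v) {q : ℝ} (hq : 0 < q) :
    Rapid (fun v => g v ^ q) := by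
  intro k
  obtain ⟨n, hn⟩ := exists_nat_ge ((k : ℝ) / q)
  obtain ⟨C, hC, h⟩ := hg n
  refine ⟨C ^ q, by positivity, fun v => ?_⟩
  have hp := one_add_norm_pos v
  have h1 : 1 ≤ 1 + ‖v‖ := by simp
  rw [abs_of_nonneg (Real.rpow_nonneg (h0 v) q)]
  have h2 := h v
  rw [abs_of_nonneg (h0 v)] at h2
  calc g v ^ q ≤ (C * ((1 + ‖v‖) ^ n)⁻¹) ^ q := Real.rpow_le_rpow (h0 v) h2 hq.le
    _ = C ^ q * ((1 + ‖v‖) ^ ((n : ℝ) * q))⁻¹ := by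
        rw [Real.mul_rpow hC (by positivity), Real.inv_rpow (by positivity),
          ← Real.rpow_natCast, ← Real.rpow_mul hp.le]
    _ ≤ C ^ q * ((1 + ‖v‖) ^ k)⁻¹ := by
        rw [← Real.rpow_natCast (1 + ‖v‖) k]
        gcongr
        rwa [div_le_iff₀ hq] at hn

/-! ### Partial derivatives of Schwartz functions and integration by parts -/

lemma schwartz_rapid (g : 𝓢(Vel, ℝ)) : Rapid g := by
  intro k
  refine ⟨2 ^ k * (Finset.Iic (k, 0)).sup (fun m => SchwartzMap.seminorm ℝ m.1 m.2) g,
    by positivity, fun v => ?_⟩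
  have h := SchwartzMap.one_add_le_sup_seminorm_apply (𝕜 := ℝ) (m := (k, 0)) le_rfl le_rfl g v
  have hp := one_add_norm_pos v
  rw [norm_iteratedFDeriv_zero, Real.norm_eq_abs] at h
  rw [← div_eq_mul_inv, le_div_iff₀ (by positivity), mul_comm]
  exact h

lemma schwartz_fderiv_bound (g : 𝓢(Vel, ℝ)) (k : ℕ) :
    ∃ C, 0 ≤ C ∧ ∀ v, ‖fderiv ℝ g v‖ ≤ C * ((1 + ‖v‖) ^ k)⁻¹ := by
  refine ⟨2 ^ k * (Finset.Iic (k, 1)).sup (fun m => SchwartzMap.seminorm ℝ m.1 m.2) g,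
    by positivity, fun v => ?_⟩
  have h := SchwartzMap.one_add_le_sup_seminorm_apply (𝕜 := ℝ) (m := (k, 1)) le_rfl le_rfl g v
  have hp := one_add_norm_pos v
  rw [norm_iteratedFDeriv_one] at h
  rw [← div_eq_mul_inv, le_div_iff₀ (by positivity), mul_comm]
  exact h

/-- The partial derivative of a Schwartz function, as a Schwartz function. -/
def pd (i : Fin 3) (g : 𝓢(Vel, ℝ)) : 𝓢(Vel, ℝ) := ∂_{(EuclideanSpace.single i (1 : ℝ) : Vel)} g

lemma pd_apply (i : Fin 3) (g : 𝓢(Vel, ℝ)) (v : Vel) : pd i g v = partialDeriv i g v := by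
  simp [pd, partialDeriv, SchwartzMap.lineDerivOp_apply_eq_fderiv]

lemma norm_single (i : Fin 3) : ‖(EuclideanSpace.single i (1 : ℝ) : Vel)‖ = 1 := by simp

lemma abs_partialDeriv_le (i : Fin 3) (g : Vel → ℝ) (v : Vel) :
    |partialDeriv i g v| ≤ ‖fderiv ℝ g v‖ := by
  have := (fderiv ℝ g v).le_opNorm (EuclideanSpace.single i 1)
  rwa [norm_single, mul_one] at this

lemma abs_coord_le (v : Vel) (i : Fin 3) : |v i| ≤ ‖v‖ := by
  simpa using PiLp.norm_apply_le v i

lemma partialDeriv_mul {u w : Vel → ℝ} {v : Vel} (i : Fin 3) (hu : DifferentiableAt ℝ u v)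
    (hw : DifferentiableAt ℝ w v) :
    partialDeriv i (fun x => u x * w x) v
      = u v * partialDeriv i w v + partialDeriv i u v * w v := by
  simp only [partialDeriv]
  rw [fderiv_fun_mul hu hw]
  simp [mul_comm]

/-- Integration by parts for partial derivatives. -/
lemma integral_mul_partialDeriv {u w : Vel → ℝ} (i : Fin 3) (hu : Differentiable ℝ u)
    (hw : Differentiable ℝ w) (h1 : Integrable fun v => partialDeriv i u v * w v)
    (h2 : Integrable fun v => u v * partialDeriv i w v) (h3 : Integrable fun v => u v * w v) :
    ∫ v, u v * partialDeriv i w v = -∫ v, partialDeriv i u v * w v :=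
  integral_mul_fderiv_eq_neg_fderiv_mul_of_integrable h1 h2 h3 (fun x _ => hu x) (fun x _ => hw x)

/-! ### Convolution with kernels dominated by 1/|z| -/

/-- `k * g` for a kernel `k`. -/
def conv (k g : Vel → ℝ) (v : Vel) : ℝ := ∫ w, k (v - w) * g w

/-- A measurable kernel dominated by `c / |z|`. -/
structure IsKernel (c : ℝ) (k : Vel → ℝ) : Prop where
  nonneg : 0 ≤ c
  meas : Measurable k
  bound : ∀ z, z ≠ 0 → |k z| ≤ c * ‖z‖⁻¹

lemma ae_ne (v : Vel) : ∀ᵐ w : Vel, w ≠ v := by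
  simp [ae_iff, measure_singleton]

/-- The singular part of `|z|^{-s}`. -/
def nearPow (s : ℝ) : Vel → ℝ := indicator (Metric.ball 0 1) fun z => ‖z‖ ^ (-s)

lemma nearPow_nonneg (s : ℝ) (z : Vel) : 0 ≤ nearPow s z :=
  indicator_nonneg (fun _ _ => by positivity) z

lemma integrable_nearPow {s : ℝ} (hs : s < 3) : Integrable (nearPow s) := by
  rw [nearPow, integrable_indicator_iff Metric.isOpen_ball.measurableSet]
  refine integrableOn_ball_of_norm_le_rpow (C := 1) (α := s) (by simp) (by simpa using hs) ?_ ?_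
  · refine ae_of_all _ fun x => ?_
    rw [Real.norm_of_nonneg (by positivity), one_mul]
  · exact (measurable_norm.pow_const _).aestronglyMeasurable

lemma norm_inv_le_nearPow (z : Vel) : ‖z‖⁻¹ ≤ nearPow 1 z + 1 := by
  by_cases h : z ∈ Metric.ball (0 : Vel) 1
  · simp [nearPow, h, Real.rpow_neg_one]
  · rw [nearPow, indicator_of_notMem h, zero_add]
    simp only [Metric.mem_ball, dist_zero_right, not_lt] at h
    exact inv_le_one_of_one_le₀ h

/-- A uniform bound for the Newtonian potential of `(1 + |w|)^{-4}`. -/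
def potBound : ℝ := (∫ z, nearPow 1 z) + ∫ w : Vel, ((1 + ‖w‖) ^ 4)⁻¹

lemma potBound_nonneg : 0 ≤ potBound :=
  add_nonneg (integral_nonneg (nearPow_nonneg 1)) (integral_nonneg fun _ => by positivity)

lemma inv_mul_weight_le (v w : Vel) : ‖v - w‖⁻¹ * ((1 + ‖w‖) ^ 4)⁻¹
    ≤ nearPow 1 (v - w) + ((1 + ‖w‖) ^ 4)⁻¹ := by
  have h1 : ((1 + ‖w‖) ^ 4)⁻¹ ≤ 1 := inv_le_one_of_one_le₀ (one_le_pow₀ (by simp))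
  have h0 : 0 ≤ ((1 + ‖w‖) ^ 4)⁻¹ := by positivity
  nlinarith [norm_inv_le_nearPow (v - w), nearPow_nonneg 1 (v - w)]

lemma integrable_inv_mul_weight (v : Vel) :
    Integrable fun w : Vel => ‖v - w‖⁻¹ * ((1 + ‖w‖) ^ 4)⁻¹ := by
  refine (((integrable_nearPow (s := 1) (by norm_num)).comp_sub_left v).add
    integrable_weight).mono' (Measurable.aestronglyMeasurable (by fun_prop))
    (ae_of_all _ fun w => ?_)
  rw [Real.norm_of_nonneg (by positivity)]
  exact inv_mul_weight_le v w

lemma integral_inv_mul_weight_le (v : Vel) :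
    ∫ w : Vel, ‖v - w‖⁻¹ * ((1 + ‖w‖) ^ 4)⁻¹ ≤ potBound := by
  have h1 := (integrable_nearPow (s := 1) (by norm_num)).comp_sub_left v
  refine (integral_mono (integrable_inv_mul_weight v) (h1.add integrable_weight)
    (inv_mul_weight_le v)).trans_eq ?_
  simp only [Pi.add_apply]
  rw [integral_add h1 integrable_weight, integral_sub_left_eq_self (nearPow 1) volume v, potBound]

lemma integrable_conv {c : ℝ} {k g : Vel → ℝ} (hk : IsKernel c k) (hg : Rapid g)
    (hm : Measurable g) (v : Vel) : Integrable fun w => k (v - w) * g w := by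
  obtain ⟨C, hC, h⟩ := hg 4
  refine ((integrable_inv_mul_weight v).const_mul (c * C)).mono'
    ((hk.meas.comp (measurable_const.sub measurable_id)).mul hm).aestronglyMeasurable ?_
  filter_upwards [ae_ne v] with w hw
  rw [Real.norm_eq_abs, abs_mul]
  calc |k (v - w)| * |g w| ≤ (c * ‖v - w‖⁻¹) * (C * ((1 + ‖w‖) ^ 4)⁻¹) :=
        mul_le_mul (hk.bound _ (sub_ne_zero.mpr hw.symm)) (h w) (abs_nonneg _)
          (mul_nonneg hk.nonneg (by positivity))
    _ = _ := by ring

lemma abs_conv_le {c C : ℝ} {k g : Vel → ℝ} (hk : IsKernel c k)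
    (hg : ∀ v, |g v| ≤ C * ((1 + ‖v‖) ^ 4)⁻¹) (v : Vel) : |conv k g v| ≤ c * C * potBound := by
  have hC : 0 ≤ C := by simpa using (abs_nonneg _).trans (hg 0)
  have hc := hk.nonneg
  calc |conv k g v| ≤ ∫ w, c * C * (‖v - w‖⁻¹ * ((1 + ‖w‖) ^ 4)⁻¹) := by
        rw [← Real.norm_eq_abs, conv]
        refine norm_integral_le_of_norm_le ((integrable_inv_mul_weight v).const_mul _) ?_
        filter_upwards [ae_ne v] with w hw
        rw [Real.norm_eq_abs, abs_mul]
        calc |k (v - w)| * |g w| ≤ (c * ‖v - w‖⁻¹) * (C * ((1 + ‖w‖) ^ 4)⁻¹) :=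
            mul_le_mul (hk.bound _ (sub_ne_zero.mpr hw.symm)) (hg w) (abs_nonneg _)
              (mul_nonneg hk.nonneg (by positivity))
          _ = _ := by ring
    _ ≤ _ := by
        rw [integral_const_mul]
        exact mul_le_mul_of_nonneg_left (integral_inv_mul_weight_le v) (by positivity)

lemma conv_eq (k g : Vel → ℝ) (v : Vel) : conv k g v = ∫ z, k z * g (v - z) := by
  rw [conv, ← integral_sub_left_eq_self _ volume v]
  simp

/-- In the form ∫ k(z) g(v-z) dz only the Schwartz factor is differentiated, so the singularity of k
stays integrable. For x in the unit ball around v one has 1+|v-z| ≤ 2(1+|x-z|); the factor 16 = 2^4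
makes the majorant independent of x. -/
lemma conv_hasFDerivAt {c : ℝ} {k : Vel → ℝ} (hk : IsKernel c k) (g : 𝓢(Vel, ℝ)) (v : Vel) :
    Integrable (fun z => k z • fderiv ℝ g (v - z)) ∧
    HasFDerivAt (conv k g) (∫ z, k z • fderiv ℝ g (v - z)) v := by
  obtain ⟨C, hC, h⟩ := schwartz_fderiv_bound g 4
  have hcont : Continuous (fderiv ℝ g) := (g.smooth 1).continuous_fderiv (by norm_num)
  have hc := hk.nonneg
  have hbi : Integrable fun z : Vel => c * (C * 16) * (‖z‖⁻¹ * ((1 + ‖v - z‖) ^ 4)⁻¹) := by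
    simpa using ((integrable_inv_mul_weight v).comp_sub_left v).const_mul (c * (C * 16))
  have hb : ∀ z, z ≠ 0 → ∀ x ∈ Metric.ball v 1, ‖k z • fderiv ℝ g (x - z)‖
      ≤ c * (C * 16) * (‖z‖⁻¹ * ((1 + ‖v - z‖) ^ 4)⁻¹) := by
    intro z hz x hx
    rw [norm_smul, Real.norm_eq_abs]
    have h1 : 1 + ‖v - z‖ ≤ 2 * (1 + ‖x - z‖) := by
      have : ‖v - z‖ ≤ ‖v - x‖ + ‖x - z‖ := by
        simpa using norm_add_le (v - x) (x - z)
      rw [Metric.mem_ball, dist_eq_norm, norm_sub_rev] at hx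
      nlinarith [norm_nonneg (x - z)]
    have h2 : ((1 + ‖x - z‖) ^ 4)⁻¹ ≤ 16 * ((1 + ‖v - z‖) ^ 4)⁻¹ := by
      rw [← div_eq_mul_inv, le_div_iff₀ (by positivity), inv_mul_le_iff₀ (by positivity)]
      calc (1 + ‖v - z‖) ^ 4 ≤ (2 * (1 + ‖x - z‖)) ^ 4 := by gcongr
        _ = _ := by ring
    calc |k z| * ‖fderiv ℝ g (x - z)‖ ≤ (c * ‖z‖⁻¹) * (C * (16 * ((1 + ‖v - z‖) ^ 4)⁻¹)) := by
          refine mul_le_mul (hk.bound _ hz) ((h _).trans ?_) (norm_nonneg _)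
            (mul_nonneg hk.nonneg (by positivity))
          gcongr
      _ = _ := by ring
  have hmeas : AEStronglyMeasurable (fun z => k z • fderiv ℝ g (v - z)) volume :=
    hk.meas.aestronglyMeasurable.smul (by fun_prop)
  refine ⟨hbi.mono' hmeas ((ae_ne 0).mono fun z hz => hb z hz v (by simp)), ?_⟩
  have := hasFDerivAt_integral_of_dominated_of_fderiv_le (μ := volume) (𝕜 := ℝ)
    (F := fun x z => k z * g (x - z)) (F' := fun x z => k z • fderiv ℝ g (x - z)) (x₀ := v)
    (Metric.ball_mem_nhds v one_pos)
    (Eventually.of_forall fun x => (hk.meas.mul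
      (g.continuous.measurable.comp (measurable_const.sub measurable_id))).aestronglyMeasurable)
    (by
      simpa using (integrable_conv hk (schwartz_rapid g)
        g.continuous.measurable v).comp_sub_left v)
    hmeas ((ae_ne 0).mono hb) hbi
    (ae_of_all _ fun z x _ => by
      have h1 : HasFDerivAt (fun x => g (x - z)) (fderiv ℝ g (x - z)) x := by
        simpa [Function.comp_def] using
          (g.hasFDerivAt (x - z)).comp x ((hasFDerivAt_id x).sub_const z)
      exact h1.const_mul (k z))
  refine this.congr_of_eventuallyEq (Eventually.of_forall fun x => conv_eq k g x)

lemma conv_differentiable {c : ℝ} {k : Vel → ℝ} (hk : IsKernel c k) (g : 𝓢(Vel, ℝ)) :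
    Differentiable ℝ (conv k g) := fun v => (conv_hasFDerivAt hk g v).2.differentiableAt

lemma partialDeriv_conv {c : ℝ} {k : Vel → ℝ} (hk : IsKernel c k) (g : 𝓢(Vel, ℝ)) (i : Fin 3) :
    partialDeriv i (conv k g) = conv k (pd i g) := by
  funext v
  obtain ⟨h1, h2⟩ := conv_hasFDerivAt hk g v
  rw [partialDeriv, h2.fderiv, ContinuousLinearMap.integral_apply h1, conv_eq]
  simp [pd_apply, partialDeriv]

lemma conv_bounded {c : ℝ} {k g : Vel → ℝ} (hk : IsKernel c k) (hg : Rapid g) :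
    ∃ C, ∀ v, |conv k g v| ≤ C :=
  let ⟨_, _, h⟩ := hg 4
  ⟨_, abs_conv_le hk h⟩

lemma conv_continuous {c : ℝ} {k : Vel → ℝ} (hk : IsKernel c k) (g : 𝓢(Vel, ℝ)) :
    Continuous (conv k g) := (conv_differentiable hk g).continuous

lemma conv_poly {c : ℝ} {k : Vel → ℝ} (hk : IsKernel c k) (g : 𝓢(Vel, ℝ)) : Poly (conv k g) :=
  let ⟨_, h⟩ := conv_bounded hk (schwartz_rapid g)
  .of_bound h

/-- Convergence of kernels, uniformly dominated by `c / |z|`, passes to weighted integrals of the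
convolutions. -/
lemma tendsto_integral_mul_conv {c : ℝ} {k : Vel → ℝ} {κ : ℕ → Vel → ℝ} (hk : IsKernel c k)
    (hκ : ∀ n, IsKernel c (κ n)) (hlim : ∀ z, z ≠ 0 → Tendsto (fun n => κ n z) atTop (𝓝 (k z)))
    (g : 𝓢(Vel, ℝ)) {u : Vel → ℝ} (hu : Integrable u) :
    Tendsto (fun n => ∫ v, u v * conv (κ n) g v) atTop (𝓝 (∫ v, u v * conv k g v)) := by
  obtain ⟨C, hC, hg⟩ := schwartz_rapid g 4
  have hpt : ∀ v, Tendsto (fun n => conv (κ n) g v) atTop (𝓝 (conv k g v)) := by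
    intro v
    refine tendsto_integral_of_dominated_convergence
      (fun w => c * C * (‖v - w‖⁻¹ * ((1 + ‖w‖) ^ 4)⁻¹))
      (fun n => (integrable_conv (hκ n) (schwartz_rapid g) g.continuous.measurable v).1)
      ((integrable_inv_mul_weight v).const_mul _) (fun n => ?_) ?_
    · filter_upwards [ae_ne v] with w hw
      rw [Real.norm_eq_abs, abs_mul]
      calc |κ n (v - w)| * |g w| ≤ (c * ‖v - w‖⁻¹) * (C * ((1 + ‖w‖) ^ 4)⁻¹) :=
          mul_le_mul ((hκ n).bound _ (sub_ne_zero.mpr hw.symm)) (hg w) (abs_nonneg _)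
            (mul_nonneg hk.nonneg (by positivity))
        _ = _ := by ring
    · filter_upwards [ae_ne v] with w hw
      exact (hlim _ (sub_ne_zero.mpr hw.symm)).mul_const _
  refine tendsto_integral_of_dominated_convergence (fun v => |u v| * (c * C * potBound))
    (fun n => hu.1.mul (conv_continuous (hκ n) g).aestronglyMeasurable)
    (hu.abs.mul_const _) (fun n => ae_of_all _ fun v => ?_)
    (ae_of_all _ fun v => (hpt v).const_mul _)
  rw [Real.norm_eq_abs, abs_mul]
  exact mul_le_mul_of_nonneg_left (abs_conv_le (hκ n) hg v) (abs_nonneg _)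

/-- For a kernel with bounded derivative, the derivative may be moved to the kernel. -/
lemma conv_pd_eq {k : Vel → ℝ} (hk : Differentiable ℝ k) {b b' : ℝ} (hb : ∀ z, |k z| ≤ b)
    (i : Fin 3)
    (hb' : ∀ z, |partialDeriv i k z| ≤ b') (g : 𝓢(Vel, ℝ)) (v : Vel) :
    conv k (pd i g) v = conv (partialDeriv i k) g v := by
  have hd : Differentiable ℝ fun w => k (v - w) := hk.comp (by fun_prop)
  have hpd : ∀ w, partialDeriv i (fun w => k (v - w)) w = -partialDeriv i k (v - w) := by
    intro w
    simp only [partialDeriv]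
    have := (hk (v - w)).hasFDerivAt.comp w ((hasFDerivAt_id w).const_sub v)
    have h2 : HasFDerivAt (fun w => k (v - w))
        ((fderiv ℝ k (v - w)).comp (-ContinuousLinearMap.id ℝ Vel)) w := this
    rw [h2.fderiv]
    simp
  have hg := (schwartz_rapid g).integrable g.continuous.aestronglyMeasurable
  have hg' := (schwartz_rapid (pd i g)).integrable (pd i g).continuous.aestronglyMeasurable
  have hmeas : Measurable (partialDeriv i k) := measurable_fderiv_apply_const ℝ k _
  have h := integral_mul_partialDeriv (u := fun w => k (v - w)) (w := g) i hd g.differentiable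
    (by
      simp only [hpd]
      refine hg.bdd_mul (c := b')
        (hmeas.comp (by fun_prop : Measurable fun w : Vel => v - w)).neg.aestronglyMeasurable
        (ae_of_all _ fun w => ?_)
      rw [norm_neg]
      exact hb' _)
    (by
      simp only [← pd_apply]
      exact hg'.bdd_mul (c := b) hd.continuous.aestronglyMeasurable (ae_of_all _ fun w => hb _))
    (hg.bdd_mul (c := b) hd.continuous.aestronglyMeasurable (ae_of_all _ fun w => hb _))
  simp only [conv, pd_apply, h, hpd, neg_mul, integral_neg, neg_neg]

/-! ### Powers of nonnegative C^{1,1} functions -/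

/-- A nonnegative differentiable function whose derivative is `L`-Lipschitz. -/
structure NonnegC11 (L : ℝ) (g : Vel → ℝ) : Prop where
  nonneg : ∀ v, 0 ≤ g v
  diff : Differentiable ℝ g
  lip : ∀ x y, ‖fderiv ℝ g x - fderiv ℝ g y‖ ≤ L * ‖x - y‖

namespace NonnegC11

variable {L : ℝ} {g : Vel → ℝ}

lemma const_nonneg (h : NonnegC11 L g) : 0 ≤ L := by
  have h1 := (norm_nonneg _).trans (h.lip (EuclideanSpace.single 0 1) 0)
  simpa using h1

lemma taylor (h : NonnegC11 L g) (x y : Vel) :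
    g y ≤ g x + fderiv ℝ g x (y - x) + L * ‖y - x‖ ^ 2 := by
  have hb := (convex_closedBall x ‖y - x‖).norm_image_sub_le_of_norm_hasFDerivWithin_le'
    (f := g) (f' := fderiv ℝ g) (φ := fderiv ℝ g x) (C := L * ‖y - x‖) (x := x) (y := y)
    (fun z _ => (h.diff z).hasFDerivAt.hasFDerivWithinAt)
    (fun z hz => (h.lip z x).trans (by
      rw [mem_closedBall_iff_norm] at hz
      exact mul_le_mul_of_nonneg_left hz h.const_nonneg))
    (by simp) (by simp [dist_eq_norm])
  have := (abs_le.mp hb).2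
  nlinarith

/-- Along each direction e the Taylor bound is a quadratic polynomial in t that dominates g(v+te) ≥
0, so its discriminant is nonpositive. -/
lemma norm_fderiv_le (h : NonnegC11 L g) (v : Vel) :
    ‖fderiv ℝ g v‖ ≤ 2 * √(L * g v) := by
  have hL := h.const_nonneg
  refine ContinuousLinearMap.opNorm_le_bound _ (by positivity) fun e => ?_
  have hq : ∀ t : ℝ, 0 ≤ (L * ‖e‖ ^ 2) * (t * t) + (fderiv ℝ g v e) * t + g v := by
    intro t
    have := (h.nonneg _).trans (h.taylor v (v + t • e))
    simp only [add_sub_cancel_left, map_smul, smul_eq_mul, norm_smul, Real.norm_eq_abs,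
      mul_pow, sq_abs] at this
    linarith
  have hd := discrim_le_zero hq
  rw [discrim] at hd
  rw [Real.norm_eq_abs]
  refine abs_le_of_sq_le_sq ?_ (by positivity)
  rw [mul_pow, mul_pow, Real.sq_sqrt (mul_nonneg hL (h.nonneg v))]
  nlinarith

lemma fderiv_eq_zero (h : NonnegC11 L g) {v : Vel} (hv : g v = 0) : fderiv ℝ g v = 0 := by
  have := h.norm_fderiv_le v
  rw [hv, mul_zero, Real.sqrt_zero, mul_zero] at this
  simpa using this

/-- Powers above `1/2` of a nonnegative `C^{1,1}` function are differentiable, also at its zeros. -/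
lemma hasFDerivAt_rpow (h : NonnegC11 L g) {q : ℝ} (hq : 1 / 2 < q) (v : Vel) :
    HasFDerivAt (fun x => g x ^ q) ((q * g v ^ (q - 1)) • fderiv ℝ g v) v := by
  rcases (h.nonneg v).eq_or_lt' with h0 | h0
  · have hD := h.fderiv_eq_zero h0
    rw [hD, smul_zero, hasFDerivAt_iff_isLittleO]
    have hq0 : q ≠ 0 := by linarith
    simp only [h0, Real.zero_rpow hq0, sub_zero, zero_apply]
    rw [Asymptotics.isLittleO_iff]
    intro ε hε
    have hL := h.const_nonneg
    -- Near a zero v, g(y) ≤ L|y-v|², hence g(y)^q ≤ L^q |y-v|^{2q}, which is o(|y-v|) precisely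
    -- because 2q > 1.
    have hlim : Tendsto (fun y : Vel => L ^ q * ‖y - v‖ ^ (2 * q - 1)) (𝓝 v) (𝓝 0) := by
      have hc : Continuous fun y : Vel => L ^ q * ‖y - v‖ ^ (2 * q - 1) :=
        continuous_const.mul ((by fun_prop : Continuous fun y : Vel => ‖y - v‖).rpow_const
          fun _ => Or.inr (by linarith))
      have := hc.tendsto v
      simpa [Real.zero_rpow (by linarith : 2 * q - 1 ≠ 0)] using this
    filter_upwards [hlim.eventually (gt_mem_nhds hε)] with y hy
    rw [Real.norm_of_nonneg (Real.rpow_nonneg (h.nonneg y) q)]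
    have ht := h.taylor v y
    rw [h0, hD, zero_apply, zero_add, zero_add] at ht
    calc g y ^ q ≤ (L * ‖y - v‖ ^ 2) ^ q := Real.rpow_le_rpow (h.nonneg y) ht (by linarith)
      _ = L ^ q * ‖y - v‖ ^ (2 * q - 1) * ‖y - v‖ := by
          rw [Real.mul_rpow hL (by positivity), mul_assoc]
          congr 1
          rw [← Real.rpow_natCast, ← Real.rpow_mul (norm_nonneg _)]
          rcases (norm_nonneg (y - v)).eq_or_lt' with h1 | h1
          · rw [h1, Real.zero_rpow (by push_cast; linarith), mul_zero]
          · rw [← Real.rpow_add_one h1.ne']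
            congr 1
            push_cast
            ring
      _ ≤ ε * ‖y - v‖ := by gcongr
  · exact (h.diff v).hasFDerivAt.rpow_const (Or.inl h0.ne')

lemma differentiable_rpow (h : NonnegC11 L g) {q : ℝ} (hq : 1 / 2 < q) :
    Differentiable ℝ fun x => g x ^ q := fun v => (h.hasFDerivAt_rpow hq v).differentiableAt

lemma fderiv_rpow (h : NonnegC11 L g) {q : ℝ} (hq : 1 / 2 < q) (v : Vel) :
    fderiv ℝ (fun x => g x ^ q) v = (q * g v ^ (q - 1)) • fderiv ℝ g v :=
  (h.hasFDerivAt_rpow hq v).fderiv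

lemma partialDeriv_rpow (h : NonnegC11 L g) {q : ℝ} (hq : 1 / 2 < q) (i : Fin 3) (v : Vel) :
    partialDeriv i (fun x => g x ^ q) v = q * g v ^ (q - 1) * partialDeriv i g v := by
  simp [partialDeriv, h.fderiv_rpow hq v]

/-- The square-root bound on ∇g turns g^{q-1} into g^{q-1/2}, whose exponent is positive. The
gradient of a power thus tends to zero at the zeros of g, and decays rapidly if g does. -/
lemma norm_fderiv_rpow_le (h : NonnegC11 L g) {q : ℝ} (hq : 1 / 2 < q) (v : Vel) :
    ‖fderiv ℝ (fun x => g x ^ q) v‖ ≤ 2 * q * √L * g v ^ (q - 1 / 2) := by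
  rw [h.fderiv_rpow hq v, norm_smul]
  have hq0 : 0 < q := by linarith
  have hL := h.const_nonneg
  rw [Real.norm_of_nonneg (mul_nonneg hq0.le (Real.rpow_nonneg (h.nonneg v) _))]
  rcases (h.nonneg v).eq_or_lt' with h0 | h0
  · rw [h.fderiv_eq_zero h0, norm_zero, mul_zero]
    have := Real.rpow_nonneg (h.nonneg v) (q - 1 / 2)
    positivity
  · calc q * g v ^ (q - 1) * ‖fderiv ℝ g v‖ ≤ q * g v ^ (q - 1) * (2 * √(L * g v)) := by
          gcongr
          exact h.norm_fderiv_le v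
      _ = 2 * q * √L * (g v ^ (q - 1) * g v ^ (1 / 2 : ℝ)) := by
          rw [Real.sqrt_mul hL, Real.sqrt_eq_rpow (g v)]
          ring
      _ = _ := by
          rw [← Real.rpow_add h0]
          ring_nf

lemma continuous_fderiv_rpow (h : NonnegC11 L g) {q : ℝ} (hq : 1 / 2 < q) :
    Continuous (fderiv ℝ fun x => g x ^ q) := by
  have hL := h.const_nonneg
  have hlip : LipschitzWith (Real.toNNReal L) (fderiv ℝ g) :=
    LipschitzWith.of_dist_le_mul fun x y => by
      rw [dist_eq_norm, dist_eq_norm, Real.coe_toNNReal _ hL]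
      exact h.lip x y
  rw [continuous_iff_continuousAt]
  intro v
  rcases (h.nonneg v).eq_or_lt' with h0 | h0
  · rw [ContinuousAt, h.fderiv_rpow hq v, h.fderiv_eq_zero h0, smul_zero]
    refine squeeze_zero_norm (h.norm_fderiv_rpow_le hq) ?_
    have hc : Continuous fun v => 2 * q * √L * g v ^ (q - 1 / 2) :=
      continuous_const.mul (h.diff.continuous.rpow_const fun _ => Or.inr (by linarith))
    have := hc.tendsto v
    rwa [h0, Real.zero_rpow (by linarith), mul_zero] at this
  · have : (fderiv ℝ fun x => g x ^ q) = fun v => (q * g v ^ (q - 1)) • fderiv ℝ g v :=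
      funext (h.fderiv_rpow hq)
    rw [this]
    exact (continuousAt_const.mul (h.diff.continuous.continuousAt.rpow_const
      (Or.inl h0.ne'))).smul hlip.continuous.continuousAt

lemma contDiff_rpow (h : NonnegC11 L g) {q : ℝ} (hq : 1 / 2 < q) :
    ContDiff ℝ 1 fun x => g x ^ q :=
  contDiff_one_iff_fderiv.mpr ⟨h.differentiable_rpow hq, h.continuous_fderiv_rpow hq⟩

end NonnegC11

lemma schwartz_nonnegC11 (g : 𝓢(Vel, ℝ)) (h0 : ∀ v, 0 ≤ g v) : ∃ L, NonnegC11 L g := by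
  obtain ⟨C, hC⟩ : ∃ C, ∀ v, ‖fderiv ℝ (fderiv ℝ g) v‖ ≤ C := by
    have h := SchwartzMap.one_add_le_sup_seminorm_apply (𝕜 := ℝ) (m := (0, 1)) le_rfl le_rfl
      (SchwartzMap.fderivCLM ℝ Vel ℝ g)
    refine ⟨_, fun v => le_trans (le_of_eq ?_) (h v)⟩
    rw [norm_iteratedFDeriv_one, pow_zero, one_mul]
    rfl
  refine ⟨C, h0, g.differentiable, fun x y => ?_⟩
  exact convex_univ.norm_image_sub_le_of_norm_fderiv_le
    (fun z _ => (SchwartzMap.fderivCLM ℝ Vel ℝ g).differentiable z) (fun z _ => hC z)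
    (mem_univ y) (mem_univ x)

/-! ### Regularised Coulomb and Landau kernels -/

/-- An even differentiable kernel with `|k| ≤ c / |z|` and `|∂ᵢ k| ≤ c / |z|²` which is moreover
bounded together with its derivatives. -/
structure RegKernel (c : ℝ) (k : Vel → ℝ) : Prop extends IsKernel c k where
  diff : Differentiable ℝ k
  odd : ∀ i z, partialDeriv i k (-z) = -partialDeriv i k z
  deriv_bound : ∀ i z, z ≠ 0 → |partialDeriv i k z| ≤ c * (‖z‖⁻¹) ^ 2
  bounded : ∃ b, ∀ z, |k z| ≤ b
  deriv_bounded : ∃ b, ∀ i z, |partialDeriv i k z| ≤ b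

/-- The regularisation `(|z|² + ε²)^{-1/2}` of `1 / |z|`. -/
def regInv (ε : ℝ) (z : Vel) : ℝ := (√(‖z‖ ^ 2 + ε ^ 2))⁻¹

section regInv

variable {ε : ℝ}

lemma regInv_pos (hε : 0 < ε) (z : Vel) : 0 < regInv ε z := by
  unfold regInv; positivity

lemma regInv_sq (hε : 0 < ε) (z : Vel) : regInv ε z ^ 2 * (‖z‖ ^ 2 + ε ^ 2) = 1 := by
  rw [regInv, inv_pow, Real.sq_sqrt (by positivity)]
  exact inv_mul_cancel₀ (by positivity)

lemma regInv_mul_norm_le (hε : 0 < ε) (z : Vel) : regInv ε z * ‖z‖ ≤ 1 := by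
  refine abs_le_one_iff_mul_self_le_one.mpr ?_ |> (abs_le.mp ·) |>.2
  nlinarith [regInv_sq hε z, mul_nonneg (sq_nonneg (regInv ε z)) (sq_nonneg ε)]

lemma regInv_le (hε : 0 < ε) (z : Vel) : regInv ε z ≤ ε⁻¹ := by
  rw [regInv]
  gcongr
  exact Real.le_sqrt_of_sq_le (by nlinarith [sq_nonneg ‖z‖])

lemma regInv_le_inv_norm (hε : 0 < ε) {z : Vel} (hz : z ≠ 0) : regInv ε z ≤ ‖z‖⁻¹ := by
  have h : 0 < ‖z‖ := norm_pos_iff.mpr hz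
  rw [← one_div, le_div_iff₀ h]
  exact regInv_mul_norm_le hε z

lemma regInv_neg (ε : ℝ) (z : Vel) : regInv ε (-z) = regInv ε z := by simp [regInv]

lemma regInv_hasFDerivAt (hε : 0 < ε) (z : Vel) :
    HasFDerivAt (regInv ε) ((-regInv ε z ^ 3) • innerSL ℝ z) z := by
  have hq : 0 < ‖z‖ ^ 2 + ε ^ 2 := by positivity
  have h1 : HasFDerivAt (fun z : Vel => ‖z‖ ^ 2 + ε ^ 2) ((2 : ℝ) • innerSL ℝ z) z := by
    have h := (hasStrictFDerivAt_norm_sq z).hasFDerivAt.add_const (ε ^ 2)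
    rwa [two_nsmul, ← two_smul ℝ] at h
  have h2 : HasDerivAt (fun q : ℝ => (√q)⁻¹) (-(1 / (2 * √(‖z‖ ^ 2 + ε ^ 2)))
      / √(‖z‖ ^ 2 + ε ^ 2) ^ 2) (‖z‖ ^ 2 + ε ^ 2) :=
    (Real.hasDerivAt_sqrt hq.ne').inv (by positivity)
  have h3 := h2.comp_hasFDerivAt z h1
  convert! h3 using 1
  rw [smul_smul]
  congr 1
  have : √(‖z‖ ^ 2 + ε ^ 2) ≠ 0 := by positivity
  rw [regInv]
  field_simp

lemma innerSL_single (z : Vel) (i : Fin 3) :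
    innerSL ℝ z (EuclideanSpace.single i 1) = z i := by
  simp [EuclideanSpace.inner_single_right]

lemma coord_hasFDerivAt (i : Fin 3) (z : Vel) :
    HasFDerivAt (fun z : Vel => z i) (EuclideanSpace.proj i : Vel →L[ℝ] ℝ) z :=
  (EuclideanSpace.proj i : Vel →L[ℝ] ℝ).hasFDerivAt

lemma measurable_regInv (ε : ℝ) : Measurable (regInv ε) := by
  unfold regInv; fun_prop

lemma tendsto_regInv {z : Vel} (hz : z ≠ 0) :
    Tendsto (fun n : ℕ => regInv (1 / ((n : ℝ) + 1)) z) atTop (𝓝 ‖z‖⁻¹) := by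
  have h0 : Tendsto (fun n : ℕ => ‖z‖ ^ 2 + (1 / ((n : ℝ) + 1)) ^ 2) atTop (𝓝 (‖z‖ ^ 2)) := by
    simpa using (tendsto_one_div_add_atTop_nhds_zero_nat (𝕜 := ℝ)).pow 2 |>.const_add (‖z‖ ^ 2)
  have h1 := (Real.continuous_sqrt.tendsto _).comp h0
  rw [Real.sqrt_sq (norm_nonneg z)] at h1
  exact h1.inv₀ (norm_ne_zero_iff.mpr hz)

end regInv

/-- The kernel of `a[g]`. -/
def coulombKernel (z : Vel) : ℝ := 1 / (4 * Real.pi * ‖z‖)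

/-- The kernels of the entries of `A[g]`. -/
def landauKernel (i j : Fin 3) (z : Vel) : ℝ := proj z i j / (8 * Real.pi * ‖z‖)

/-- Regularisation of `coulombKernel`. -/
def regCoulomb (ε : ℝ) (z : Vel) : ℝ := (4 * Real.pi)⁻¹ * regInv ε z

/-- Regularisation of `landauKernel`. -/
def regLandau (ε : ℝ) (i j : Fin 3) (z : Vel) : ℝ :=
  (8 * Real.pi)⁻¹ * ((if i = j then 1 else 0) * regInv ε z - z i * z j * regInv ε z ^ 3)

lemma diffusion_eq (g : Vel → ℝ) (v : Vel) (i j : Fin 3) :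
    diffusion g v i j = conv (landauKernel i j) g v := rfl

lemma potential_eq (g : Vel → ℝ) : potential g = conv coulombKernel g := rfl

lemma abs_delta_le (i j : Fin 3) : |(if i = j then 1 else 0 : ℝ)| ≤ 1 := by
  split_ifs <;> simp

lemma inv_four_pi_le : (4 * Real.pi)⁻¹ ≤ 1 :=
  inv_le_one_of_one_le₀ (by nlinarith [Real.pi_gt_three])

lemma inv_eight_pi_le : (8 * Real.pi)⁻¹ ≤ 1 / 6 := by
  rw [one_div]
  gcongr
  nlinarith [Real.pi_gt_three]

lemma coulombKernel_isKernel : IsKernel 1 coulombKernel where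
  nonneg := zero_le_one
  meas := by unfold coulombKernel; fun_prop
  bound z _ := by
    have hpi := Real.pi_pos
    rw [coulombKernel, abs_of_nonneg (by positivity), one_div, mul_inv]
    gcongr
    exact inv_four_pi_le

lemma landauKernel_isKernel (i j : Fin 3) : IsKernel 1 (landauKernel i j) where
  nonneg := zero_le_one
  meas := by
    unfold landauKernel proj
    simp only [Matrix.of_apply]
    fun_prop
  bound z hz := by
    have hpi := Real.pi_pos
    have hn : 0 < ‖z‖ := norm_pos_iff.mpr hz
    have h1 : |z i * z j / ‖z‖ ^ 2| ≤ 1 := by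
      rw [abs_div, abs_mul, abs_of_pos (by positivity : 0 < ‖z‖ ^ 2), div_le_one (by positivity)]
      nlinarith [abs_coord_le z i, abs_coord_le z j, abs_nonneg (z i), abs_nonneg (z j)]
    have h2 : |proj z i j| ≤ 2 := by
      simp only [proj, Matrix.of_apply]
      exact (abs_sub _ _).trans (by linarith [abs_delta_le i j])
    rw [landauKernel, abs_div, abs_of_pos (by positivity : 0 < 8 * Real.pi * ‖z‖), div_eq_mul_inv,
      mul_inv, ← mul_assoc]
    gcongr
    nlinarith [inv_eight_pi_le, abs_nonneg (proj z i j),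
      inv_pos.mpr (by positivity : 0 < 8 * Real.pi)]

lemma regCoulomb_partialDeriv {ε : ℝ} (hε : 0 < ε) (i : Fin 3) (z : Vel) :
    partialDeriv i (regCoulomb ε) z = (4 * Real.pi)⁻¹ * (-regInv ε z ^ 3 * z i) := by
  have h := (regInv_hasFDerivAt hε z).const_mul (4 * Real.pi)⁻¹
  rw [partialDeriv, show regCoulomb ε = fun z => (4 * Real.pi)⁻¹ * regInv ε z from rfl, h.fderiv]
  simp [EuclideanSpace.inner_single_right]

lemma regCoulomb_regKernel {ε : ℝ} (hε : 0 < ε) : RegKernel 1 (regCoulomb ε) := by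
  have hpi := Real.pi_pos
  have hr := regInv_pos hε
  have hb : ∀ i z, |partialDeriv i (regCoulomb ε) z| ≤ regInv ε z ^ 2 := by
    intro i z
    rw [regCoulomb_partialDeriv hε, abs_mul, abs_mul, abs_neg, abs_pow, abs_of_pos (hr z),
      abs_of_pos (by positivity)]
    have h1 : regInv ε z * |z i| ≤ 1 :=
      (mul_le_mul_of_nonneg_left (abs_coord_le z i) (hr z).le).trans (regInv_mul_norm_le hε z)
    calc (4 * Real.pi)⁻¹ * (regInv ε z ^ 3 * |z i|)
        = (4 * Real.pi)⁻¹ * (regInv ε z ^ 2 * (regInv ε z * |z i|)) := by ring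
      _ ≤ 1 * (regInv ε z ^ 2 * 1) := by
          have := hr z
          gcongr
          exact inv_four_pi_le
      _ = _ := by ring
  have hk : ∀ z, |regCoulomb ε z| ≤ regInv ε z := by
    intro z
    have := hr z
    rw [regCoulomb, abs_of_pos (by positivity)]
    exact mul_le_of_le_one_left this.le inv_four_pi_le
  exact
  { nonneg := zero_le_one
    meas := (measurable_regInv ε).const_mul _
    bound := fun z hz => by rw [one_mul]; exact (hk z).trans (regInv_le_inv_norm hε hz)
    diff := fun z => ((regInv_hasFDerivAt hε z).const_mul _).differentiableAt
    odd := fun i z => by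
      simp only [regCoulomb_partialDeriv hε, regInv_neg, PiLp.neg_apply]
      ring
    deriv_bound := fun i z hz => by
      rw [one_mul]
      exact (hb i z).trans (pow_le_pow_left₀ (hr z).le (regInv_le_inv_norm hε hz) 2)
    bounded := ⟨ε⁻¹, fun z => (hk z).trans (regInv_le hε z)⟩
    deriv_bounded := ⟨ε⁻¹ ^ 2, fun i z =>
      (hb i z).trans (pow_le_pow_left₀ (hr z).le (regInv_le hε z) 2)⟩ }

lemma regLandau_hasFDerivAt {ε : ℝ} (hε : 0 < ε) (i j : Fin 3) (z : Vel) :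
    DifferentiableAt ℝ (regLandau ε i j) z ∧ ∀ l, partialDeriv l (regLandau ε i j) z =
      (8 * Real.pi)⁻¹ * ((if i = j then 1 else 0) * (-regInv ε z ^ 3 * z l)
        - (z i * z j * (3 * regInv ε z ^ 2 * (-regInv ε z ^ 3 * z l))
          + (z i * (if j = l then 1 else 0) + z j * (if i = l then 1 else 0))
            * regInv ε z ^ 3)) := by
  have hr := regInv_hasFDerivAt hε z
  have h := (((hr.const_mul (if i = j then 1 else 0 : ℝ)).sub
    (((coord_hasFDerivAt i z).mul (coord_hasFDerivAt j z)).mul (hr.pow 3))).const_mul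
      (8 * Real.pi)⁻¹)
  refine ⟨h.differentiableAt, fun l => ?_⟩
  rw [partialDeriv, show regLandau ε i j = _ from rfl]
  erw [h.fderiv]
  split_ifs <;> simp_all [EuclideanSpace.inner_single_right] <;> ring

/-- Writing r for `regInv`, the kernel is r, and each derivative is r², times a polynomial in the
bounded numbers r·z_i. This yields the bounds by 1/|z| and 1/|z|² uniformly in ε, and the cruder
bounds by powers of 1/ε. -/
lemma regLandau_regKernel {ε : ℝ} (hε : 0 < ε) (i j : Fin 3) : RegKernel 1 (regLandau ε i j) := by
  have hpi := Real.pi_pos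
  have hr := regInv_pos hε
  have h8 : |(8 * Real.pi)⁻¹| ≤ 1 / 6 := by
    rw [abs_of_pos (by positivity)]; exact inv_eight_pi_le
  have hc : ∀ i z, |regInv ε z * z i| ≤ 1 := by
    intro i z
    rw [abs_mul, abs_of_pos (hr z)]
    exact (mul_le_mul_of_nonneg_left (abs_coord_le z i) (hr z).le).trans (regInv_mul_norm_le hε z)
  have hmul : ∀ {a b : ℝ}, |a| ≤ 1 → |b| ≤ 1 → |a * b| ≤ 1 := fun {a b} ha hb => by
    rw [abs_mul]; exact mul_le_one₀ ha (abs_nonneg _) hb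
  have hb : ∀ l z, |partialDeriv l (regLandau ε i j) z| ≤ regInv ε z ^ 2 := by
    intro l z
    have hrz := hr z
    rw [(regLandau_hasFDerivAt hε i j z).2 l]
    have e : ((if i = j then 1 else 0) * (-regInv ε z ^ 3 * z l)
        - (z i * z j * (3 * regInv ε z ^ 2 * (-regInv ε z ^ 3 * z l))
          + (z i * (if j = l then 1 else 0) + z j * (if i = l then 1 else 0))
            * regInv ε z ^ 3) : ℝ) = regInv ε z ^ 2 *
        (-((if i = j then 1 else 0) * (regInv ε z * z l))
          + 3 * ((regInv ε z * z i) * (regInv ε z * z j) * (regInv ε z * z l))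
          - (regInv ε z * z i) * (if j = l then 1 else 0)
          - (regInv ε z * z j) * (if i = l then 1 else 0)) := by ring
    have h1 := abs_le.mp (hmul (abs_delta_le i j) (hc l z))
    have h2 := abs_le.mp (hmul (hmul (hc i z) (hc j z)) (hc l z))
    have h3 := abs_le.mp (hmul (hc i z) (abs_delta_le j l))
    have h4 := abs_le.mp (hmul (hc j z) (abs_delta_le i l))
    rw [e, abs_mul, abs_mul, abs_of_pos (by positivity : 0 < regInv ε z ^ 2)]
    -- The four terms contribute 1 + 3 + 1 + 1 = 6, which the prefactor 1/(8π) ≤ 1/6 brings back to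
    -- the constant 1.
    have h6 : |(-((if i = j then 1 else 0) * (regInv ε z * z l))
          + 3 * ((regInv ε z * z i) * (regInv ε z * z j) * (regInv ε z * z l))
          - (regInv ε z * z i) * (if j = l then 1 else 0)
          - (regInv ε z * z j) * (if i = l then 1 else 0) : ℝ)| ≤ 6 :=
      abs_le.mpr ⟨by linarith [h1.1, h1.2, h2.1, h3.2, h4.2],
        by linarith [h1.1, h1.2, h2.2, h3.1, h4.1]⟩
    calc _ ≤ 1 / 6 * (regInv ε z ^ 2 * 6) := by gcongr
      _ = _ := by ring
  have hk : ∀ z, |regLandau ε i j z| ≤ regInv ε z := by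
    intro z
    have hrz := hr z
    have e : ((if i = j then 1 else 0) * regInv ε z - z i * z j * regInv ε z ^ 3 : ℝ)
      = regInv ε z * ((if i = j then 1 else 0) - (regInv ε z * z i) * (regInv ε z * z j)) := by
      ring
    rw [regLandau, e, abs_mul, abs_mul, abs_of_pos hrz]
    have h1 := abs_le.mp (abs_delta_le i j)
    have h2 := abs_le.mp (hmul (hc i z) (hc j z))
    have h3 : |((if i = j then 1 else 0) - (regInv ε z * z i) * (regInv ε z * z j) : ℝ)| ≤ 6 :=
      abs_le.mpr ⟨by linarith [h1.1, h2.2], by linarith [h1.2, h2.1]⟩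
    calc _ ≤ 1 / 6 * (regInv ε z * 6) := by gcongr
      _ = _ := by ring
  exact
  { nonneg := zero_le_one
    meas := by
      have := measurable_regInv ε
      unfold regLandau
      fun_prop
    bound := fun z hz => by rw [one_mul]; exact (hk z).trans (regInv_le_inv_norm hε hz)
    diff := fun z => (regLandau_hasFDerivAt hε i j z).1
    odd := fun l z => by
      simp only [(regLandau_hasFDerivAt hε i j _).2 l, regInv_neg, PiLp.neg_apply]
      ring
    deriv_bound := fun i z hz => by
      rw [one_mul]
      exact (hb i z).trans (pow_le_pow_left₀ (hr z).le (regInv_le_inv_norm hε hz) 2)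
    bounded := ⟨ε⁻¹, fun z => (hk z).trans (regInv_le hε z)⟩
    deriv_bounded := ⟨ε⁻¹ ^ 2, fun i z =>
      (hb i z).trans (pow_le_pow_left₀ (hr z).le (regInv_le hε z) 2)⟩ }

/-- `k` is a limit of regular kernels with uniform bounds. -/
def IsApproximable (k : Vel → ℝ) : Prop :=
  IsKernel 1 k ∧ ∃ κ : ℕ → Vel → ℝ, (∀ n, RegKernel 1 (κ n)) ∧
    ∀ z, z ≠ 0 → Tendsto (fun n => κ n z) atTop (𝓝 (k z))

lemma regCoulomb_tendsto {z : Vel} (hz : z ≠ 0) :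
    Tendsto (fun n : ℕ => regCoulomb (1 / ((n : ℝ) + 1)) z) atTop (𝓝 (coulombKernel z)) := by
  have := (tendsto_regInv hz).const_mul (4 * Real.pi)⁻¹
  simpa only [coulombKernel, ← mul_inv, one_div] using! this

lemma coulombKernel_isApproximable : IsApproximable coulombKernel :=
  ⟨coulombKernel_isKernel, fun n => regCoulomb (1 / ((n : ℝ) + 1)),
    fun n => regCoulomb_regKernel (by positivity), fun _ hz => regCoulomb_tendsto hz⟩

lemma landauKernel_isApproximable (i j : Fin 3) : IsApproximable (landauKernel i j) := by
  refine ⟨landauKernel_isKernel i j, fun n => regLandau (1 / ((n : ℝ) + 1)) i j,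
    fun n => regLandau_regKernel (by positivity) i j, fun z hz => ?_⟩
  have hr := tendsto_regInv hz
  have h := (((hr.const_mul (if i = j then 1 else 0 : ℝ)).sub
    ((hr.pow 3).const_mul (z i * z j))).const_mul (8 * Real.pi)⁻¹)
  convert! h using 2
  have hn : ‖z‖ ≠ 0 := norm_ne_zero_iff.mpr hz
  have hpi := Real.pi_ne_zero
  simp only [landauKernel, proj, Matrix.of_apply]
  field_simp

/-! ### The flux and the weak form of the collision operator -/

section weak

lemma coe_flux (g : 𝓢(Vel, ℝ)) (i : Fin 3) : flux g i = fun v =>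
    (∑ j, conv (landauKernel i j) g v * pd j g v) - conv coulombKernel (pd i g) v * g v := by
  funext v
  simp only [flux, diffusion_eq, potential_eq, partialDeriv_conv coulombKernel_isKernel, pd_apply]

lemma flux_differentiable (g : 𝓢(Vel, ℝ)) (i : Fin 3) : Differentiable ℝ (flux g i) := by
  rw [coe_flux]
  refine Differentiable.sub (Differentiable.fun_sum fun j _ => ?_) ?_
  · exact (conv_differentiable (landauKernel_isKernel i j) g).mul (pd j g).differentiable
  · exact (conv_differentiable coulombKernel_isKernel (pd i g)).mul g.differentiable

lemma flux_rapid (g : 𝓢(Vel, ℝ)) (i : Fin 3) : Rapid (flux g i) := by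
  rw [coe_flux]
  simp only [sub_eq_add_neg]
  refine Rapid.add (Rapid.sum fun j _ => ?_) ?_
  · exact (conv_poly (landauKernel_isKernel i j) g).mul_rapid (schwartz_rapid (pd j g))
  · refine ((conv_poly coulombKernel_isKernel (pd i g)).mul_rapid (schwartz_rapid g)).mono
      fun v => by rw [abs_neg]

/-- Every derivative lands on a Schwartz function, so each term is a bounded convolution times a
Schwartz function. Rapid decay and pointwise bounds follow with no estimate on derivatives of the
kernels. -/
lemma partialDeriv_flux (g : 𝓢(Vel, ℝ)) (i : Fin 3) : partialDeriv i (flux g i) = fun v =>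
    (∑ j, (conv (landauKernel i j) g v * pd i (pd j g) v
        + conv (landauKernel i j) (pd i g) v * pd j g v))
      - (conv coulombKernel (pd i g) v * pd i g v
        + conv coulombKernel (pd i (pd i g)) v * g v) := by
  funext v
  have hA : ∀ j, DifferentiableAt ℝ (fun v => conv (landauKernel i j) g v * pd j g v) v :=
    fun j => (conv_differentiable (landauKernel_isKernel i j) g v).mul
      (pd j g).differentiable.differentiableAt
  have ha : DifferentiableAt ℝ (fun v => conv coulombKernel (pd i g) v * g v) v :=
    (conv_differentiable coulombKernel_isKernel (pd i g) v).mul g.differentiable.differentiableAt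
  rw [coe_flux, partialDeriv, fderiv_fun_sub (DifferentiableAt.fun_sum fun j _ => hA j) ha,
    fderiv_fun_sum fun j _ => hA j]
  simp only [sub_apply, sum_apply]
  congr 1
  · refine Finset.sum_congr rfl fun j _ => ?_
    have := partialDeriv_mul i (conv_differentiable (landauKernel_isKernel i j) g v)
      (pd j g).differentiable.differentiableAt
    rw [partialDeriv_conv (landauKernel_isKernel i j), ← pd_apply i (pd j g)] at this
    exact this
  · have := partialDeriv_mul i (conv_differentiable coulombKernel_isKernel (pd i g) v)
      g.differentiable.differentiableAt
    rw [partialDeriv_conv coulombKernel_isKernel, ← pd_apply i g] at this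
    exact this

lemma partialDeriv_flux_rapid (g : 𝓢(Vel, ℝ)) (i : Fin 3) :
    Rapid (partialDeriv i (flux g i)) := by
  rw [partialDeriv_flux]
  simp only [sub_eq_add_neg]
  refine Rapid.add (Rapid.sum fun j _ => ?_) ?_
  · exact ((conv_poly (landauKernel_isKernel i j) g).mul_rapid (schwartz_rapid _)).add
      ((conv_poly (landauKernel_isKernel i j) (pd i g)).mul_rapid (schwartz_rapid _))
  · refine (((conv_poly coulombKernel_isKernel (pd i g)).mul_rapid (schwartz_rapid (pd i g))).add
      ((conv_poly coulombKernel_isKernel (pd i (pd i g))).mul_rapid (schwartz_rapid g))).mono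
      fun v => by rw [abs_neg]

lemma measurable_partialDeriv (i : Fin 3) (u : Vel → ℝ) : Measurable (partialDeriv i u) :=
  measurable_fderiv_apply_const ℝ u _

lemma measurable_collision (g : Vel → ℝ) : Measurable (collision g) :=
  Finset.measurable_fun_sum _ fun i _ => measurable_partialDeriv i _

/-- The weak formulation of the collision operator. -/
lemma integral_mul_collision (g : 𝓢(Vel, ℝ)) {u : Vel → ℝ} (hu : Differentiable ℝ u)
    (hp : Poly u) (hp' : ∀ i, Poly (partialDeriv i u)) :
    ∫ v, u v * collision g v = -∑ i, ∫ v, partialDeriv i u v * flux g i v := by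
  have h2 : ∀ i, Integrable fun v => u v * partialDeriv i (flux g i) v := fun i =>
    (hp.mul_rapid (partialDeriv_flux_rapid g i)).integrable
      (hu.continuous.measurable.mul (measurable_partialDeriv i _)).aestronglyMeasurable
  simp only [collision, Finset.mul_sum]
  rw [integral_finsetSum _ fun i _ => h2 i, ← Finset.sum_neg_distrib]
  refine Finset.sum_congr rfl fun i _ => ?_
  have hfm := (flux_differentiable g i).continuous.measurable
  exact integral_mul_partialDeriv i hu (flux_differentiable g i)
    (((hp' i).mul_rapid (flux_rapid g i)).integrable
      ((measurable_partialDeriv i u).mul hfm).aestronglyMeasurable) (h2 i)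
    ((hp.mul_rapid (flux_rapid g i)).integrable
      (hu.continuous.measurable.mul hfm).aestronglyMeasurable)

/-- A pointwise bound for the collision operator in terms of weighted bounds for the derivatives. -/
lemma abs_collision_le (g : 𝓢(Vel, ℝ)) {C : ℝ} {k : ℕ} (hk : 4 ≤ k)
    (h0 : ∀ v, |g v| ≤ C * ((1 + ‖v‖) ^ k)⁻¹)
    (h1 : ∀ i v, |pd i g v| ≤ C * ((1 + ‖v‖) ^ k)⁻¹)
    (h2 : ∀ i j v, |pd i (pd j g) v| ≤ C * ((1 + ‖v‖) ^ k)⁻¹) (v : Vel) :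
    |collision g v| ≤ 24 * C ^ 2 * potBound * ((1 + ‖v‖) ^ k)⁻¹ := by
  have hC : 0 ≤ C := by simpa using (abs_nonneg _).trans (h0 0)
  have h4 : ∀ {u : Vel → ℝ}, (∀ v, |u v| ≤ C * ((1 + ‖v‖) ^ k)⁻¹) →
      ∀ v, |u v| ≤ C * ((1 + ‖v‖) ^ 4)⁻¹ := fun {u} hu v => (hu v).trans (by gcongr; simp)
  have hB := potBound_nonneg
  set D := C ^ 2 * potBound * ((1 + ‖v‖) ^ k)⁻¹ with hD
  have key : ∀ {κ u w : Vel → ℝ}, IsKernel 1 κ → (∀ v, |u v| ≤ C * ((1 + ‖v‖) ^ k)⁻¹) →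
      (∀ v, |w v| ≤ C * ((1 + ‖v‖) ^ k)⁻¹) → |conv κ u v * w v| ≤ D := by
    intro κ u w hκ hu hw
    rw [abs_mul]
    calc |conv κ u v| * |w v| ≤ (1 * C * potBound) * (C * ((1 + ‖v‖) ^ k)⁻¹) :=
          mul_le_mul (abs_conv_le hκ (h4 hu) v) (hw v) (abs_nonneg _) (by positivity)
      _ = D := by rw [hD]; ring
  -- Three values of j with two diffusion terms each, plus two drift terms, make 8; summing over i
  -- gives the 24 of the statement.
  have hi : ∀ i, |partialDeriv i (flux g i) v| ≤ 8 * D := by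
    intro i
    rw [partialDeriv_flux]
    have hs : |∑ j, (conv (landauKernel i j) g v * pd i (pd j g) v
        + conv (landauKernel i j) (pd i g) v * pd j g v)| ≤ ∑ _j : Fin 3, (D + D) := by
      refine (Finset.abs_sum_le_sum_abs _ _).trans (Finset.sum_le_sum fun j _ => ?_)
      exact (abs_add_le _ _).trans (add_le_add (key (landauKernel_isKernel i j) h0 (h2 i j))
        (key (landauKernel_isKernel i j) (h1 i) (h1 j)))
    have hc : |conv coulombKernel (pd i g) v * pd i g v
        + conv coulombKernel (pd i (pd i g)) v * g v| ≤ D + D :=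
      (abs_add_le _ _).trans (add_le_add (key coulombKernel_isKernel (h1 i) (h1 i))
        (key coulombKernel_isKernel (h2 i i) h0))
    simp only [Finset.sum_const, Finset.card_univ, Fintype.card_fin, nsmul_eq_mul] at hs
    refine (abs_sub _ _).trans ?_
    push_cast at hs
    linarith
  calc |collision g v| ≤ ∑ _i : Fin 3, 8 * D :=
        (Finset.abs_sum_le_sum_abs _ _).trans (Finset.sum_le_sum fun i _ => hi i)
    _ = _ := by simp [hD]; ring

end weak

/-! ### Symmetrised estimates for the flux -/

section symmetrisation

lemma inv_norm_isKernel : IsKernel 1 (fun z : Vel => ‖z‖⁻¹) where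
  nonneg := zero_le_one
  meas := by fun_prop
  bound z _ := by rw [abs_of_nonneg (by positivity), one_mul]

lemma abs_conv_le_conv_inv {k : Vel → ℝ} (hk : IsKernel 1 k) (g : 𝓢(Vel, ℝ)) (h0 : ∀ v, 0 ≤ g v)
    (v : Vel) : |conv k g v| ≤ conv (fun z => ‖z‖⁻¹) g v := by
  rw [← Real.norm_eq_abs, conv, conv]
  refine norm_integral_le_of_norm_le
    (integrable_conv inv_norm_isKernel (schwartz_rapid g) g.continuous.measurable v) ?_
  filter_upwards [ae_ne v] with w hw
  rw [norm_mul, Real.norm_of_nonneg (h0 w)]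
  refine mul_le_mul_of_nonneg_right ?_ (h0 w)
  simpa using hk.bound _ (sub_ne_zero.mpr hw.symm)

/-- A test function whose derivatives are controlled by the weight `W`. -/
structure WeightedTest (Λ : ℝ) (W ψ : Vel → ℝ) : Prop where
  nonneg : 0 ≤ Λ
  weight_nonneg : ∀ v, 0 ≤ W v
  weight_cont : Continuous W
  weight_poly : Poly W
  diff : Differentiable ℝ ψ
  poly : Poly ψ
  deriv_le : ∀ i v, |partialDeriv i ψ v| ≤ Λ * W v
  sub_le : ∀ v w, |ψ v - ψ w| ≤ Λ * (W v + W w) * ‖v - w‖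

variable {Λ B : ℝ} {W ψ : Vel → ℝ} {g : 𝓢(Vel, ℝ)}

/-- This supplies the majorant for the symmetrised double integrals: integrating first in the second
velocity produces the Newtonian potential of g, bounded by B. -/
lemma integrable_weight_inv_norm (hψ : WeightedTest Λ W ψ) (h0 : ∀ v, 0 ≤ g v)
    (hB : ∀ v, conv (fun z => ‖z‖⁻¹) g v ≤ B) :
    Integrable (fun x : Vel × Vel => W x.1 * g x.1 * (‖x.1 - x.2‖⁻¹ * g x.2))
        (volume.prod volume) ∧
      ∫ x : Vel × Vel, W x.1 * g x.1 * (‖x.1 - x.2‖⁻¹ * g x.2) ∂(volume.prod volume)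
        ≤ B * ∫ v, W v * g v := by
  have hcW := hψ.weight_cont
  have hWg := hψ.weight_poly.mul_rapid (schwartz_rapid g)
  have hWgi := hWg.integrable (hcW.mul g.continuous).aestronglyMeasurable
  have hci : Integrable fun v => W v * g v * conv (fun z => ‖z‖⁻¹) g v :=
    (hWg.mul_poly (conv_poly inv_norm_isKernel g)).integrable
      ((hcW.mul g.continuous).mul (conv_continuous inv_norm_isKernel g)).aestronglyMeasurable
  have hInt : Integrable (fun x : Vel × Vel => W x.1 * g x.1 * (‖x.1 - x.2‖⁻¹ * g x.2))
        (volume.prod volume) := by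
    rw [integrable_prod_iff]
    · constructor
      · exact ae_of_all _ fun v => (integrable_conv inv_norm_isKernel (schwartz_rapid g)
          g.continuous.measurable v).const_mul (W v * g v)
      · refine hci.congr (ae_of_all _ fun v => ?_)
        simp only
        rw [conv, ← integral_const_mul]
        refine integral_congr_ae (ae_of_all _ fun w => ?_)
        simp only
        rw [Real.norm_of_nonneg]
        exact mul_nonneg (mul_nonneg (hψ.weight_nonneg v) (h0 v))
          (mul_nonneg (by positivity) (h0 w))
    · have hg := g.continuous
      exact Measurable.aestronglyMeasurable (by fun_prop)
  refine ⟨hInt, ?_⟩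
  rw [integral_prod _ hInt, ← integral_const_mul]
  refine integral_mono hInt.integral_prod_left (hWgi.const_mul B) fun v => ?_
  simp only
  rw [integral_const_mul, mul_comm B]
  exact mul_le_mul_of_nonneg_left (hB v) (mul_nonneg (hψ.weight_nonneg v) (h0 v))

/-- The derivative of k is odd, so exchanging v and w replaces ψ(v) by half of ψ(v) - ψ(w). This
difference is at most Λ(W(v)+W(w))|v-w|, which cancels one of the two powers in |∂k| ≤ 1/|z|².
Boundedness of ∂k is used only for integrability before the exchange and does not enter the final
bound. -/
lemma abs_integral_odd_le {k : Vel → ℝ} (hk : RegKernel 1 k) (hψ : WeightedTest Λ W ψ)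
    (h0 : ∀ v, 0 ≤ g v) (hB : ∀ v, conv (fun z => ‖z‖⁻¹) g v ≤ B) (j : Fin 3) :
    |∫ v, ψ v * conv (partialDeriv j k) g v * g v| ≤ Λ * B * ∫ v, W v * g v := by
  set β := partialDeriv j k with hβ
  obtain ⟨b, hb⟩ := hk.deriv_bounded
  have hβm : Measurable β := measurable_partialDeriv j k
  have hcψ := hψ.diff.continuous
  have hψg := (hψ.poly.mul_rapid (schwartz_rapid g)).integrable
    (hcψ.mul g.continuous).aestronglyMeasurable
  have hgi := (schwartz_rapid g).integrable g.continuous.aestronglyMeasurable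
  set F : Vel × Vel → ℝ := fun x => β (x.1 - x.2) * (ψ x.1 * g x.1 * g x.2) with hF
  have hFi : Integrable F (volume.prod volume) :=
    (hψg.mul_prod hgi).bdd_mul (c := b)
      (hβm.comp (by fun_prop : Measurable fun x : Vel × Vel => x.1 - x.2)).aestronglyMeasurable
      (ae_of_all _ fun x => hb j _)
  have hI : ∫ v, ψ v * conv β g v * g v = ∫ x, F x ∂(volume.prod volume) := by
    rw [integral_prod _ hFi]
    refine integral_congr_ae (ae_of_all _ fun v => ?_)
    simp only [hF, conv]
    rw [mul_right_comm, ← integral_const_mul]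
    refine integral_congr_ae (ae_of_all _ fun w => ?_)
    simp only
    ring
  have hsw : ∫ x, F x ∂(volume.prod volume) = ∫ x, F x.swap ∂(volume.prod volume) :=
    (integral_prod_swap F).symm
  have hFs : Integrable (fun x : Vel × Vel => F x.swap) (volume.prod volume) := hFi.swap
  obtain ⟨hHi, hHb⟩ := integrable_weight_inv_norm hψ h0 hB
  set H : Vel × Vel → ℝ := fun x => W x.1 * g x.1 * (‖x.1 - x.2‖⁻¹ * g x.2) with hH
  have hHs : Integrable (fun x : Vel × Vel => H x.swap) (volume.prod volume) := hHi.swap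
  have h2 : |2 * ∫ x, F x ∂(volume.prod volume)|
      ≤ Λ * (2 * ∫ x, H x ∂(volume.prod volume)) := by
    have e1 : 2 * ∫ x, F x ∂(volume.prod volume)
        = ∫ x, (F x + F x.swap) ∂(volume.prod volume) := by
      rw [integral_add hFi hFs, ← hsw]; ring
    have e2 : Λ * (2 * ∫ x, H x ∂(volume.prod volume))
        = ∫ x, Λ * (H x + H x.swap) ∂(volume.prod volume) := by
      rw [integral_const_mul, integral_add hHi hHs,
        (integral_prod_swap H : ∫ x, H x.swap ∂(volume.prod volume) = _)]
      ring
    rw [e1, e2, ← Real.norm_eq_abs]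
    refine norm_integral_le_of_norm_le ((hHi.add hHs).const_mul Λ) (ae_of_all _ fun x => ?_)
    obtain ⟨v, w⟩ := x
    have hodd : β (w - v) = -β (v - w) := by
      rw [← neg_sub v w]
      exact hk.odd j _
    have hFe : F (v, w) + F (v, w).swap = (ψ v - ψ w) * β (v - w) * (g v * g w) := by
      simp only [hF, Prod.swap_prod_mk, hodd]
      ring
    have hHe : Λ * (H (v, w) + H (v, w).swap)
        = Λ * (W v + W w) * ‖v - w‖⁻¹ * (g v * g w) := by
      simp only [hH, Prod.swap_prod_mk, norm_sub_rev w v]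
      ring
    rw [hFe, hHe, Real.norm_eq_abs, abs_mul, abs_mul,
      abs_of_nonneg (mul_nonneg (h0 v) (h0 w))]
    refine mul_le_mul_of_nonneg_right ?_ (mul_nonneg (h0 v) (h0 w))
    rcases eq_or_ne v w with rfl | hvw
    · simp
    · have hne := sub_ne_zero.mpr hvw
      have hn : 0 < ‖v - w‖ := norm_pos_iff.mpr hne
      calc |ψ v - ψ w| * |β (v - w)|
          ≤ (Λ * (W v + W w) * ‖v - w‖) * (1 * (‖v - w‖⁻¹) ^ 2) :=
            mul_le_mul (hψ.sub_le v w) (hk.deriv_bound j _ hne) (abs_nonneg _)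
              (mul_nonneg (mul_nonneg hψ.nonneg
                (add_nonneg (hψ.weight_nonneg v) (hψ.weight_nonneg w))) hn.le)
        _ = _ := by field_simp
  rw [hI]
  rw [abs_mul, abs_two] at h2
  have h3 := mul_le_mul_of_nonneg_left hHb hψ.nonneg
  linarith

/-- For each regular approximation the derivative moves from g to the kernel, where oddness applies.
The resulting bound is the same for all approximations and survives the limit. -/
lemma abs_integral_conv_pd_le {k : Vel → ℝ} (hk : IsApproximable k) (hψ : WeightedTest Λ W ψ)
    (h0 : ∀ v, 0 ≤ g v) (hB : ∀ v, conv (fun z => ‖z‖⁻¹) g v ≤ B) (j : Fin 3) :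
    |∫ v, ψ v * g v * conv k (pd j g) v| ≤ Λ * B * ∫ v, W v * g v := by
  obtain ⟨hk, κ, hκ, hlim⟩ := hk
  have hψg := (hψ.poly.mul_rapid (schwartz_rapid g)).integrable
    (hψ.diff.continuous.mul g.continuous).aestronglyMeasurable
  have ht := tendsto_integral_mul_conv hk (fun n => (hκ n).toIsKernel) hlim (pd j g) hψg
  refine le_of_tendsto ht.abs (Eventually.of_forall fun n => ?_)
  obtain ⟨b, hb⟩ := (hκ n).bounded
  obtain ⟨b', hb'⟩ := (hκ n).deriv_bounded
  have := abs_integral_odd_le (hκ n) hψ h0 hB j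
  simp only [conv_pd_eq (hκ n).diff hb j (hb' j)]
  simpa only [mul_right_comm] using this

/-- Integrating by parts removes the derivative from g. One term differentiates the convolution and
is handled by symmetrisation; the other differentiates ψ and is bounded directly by Λ W B g. Each
costs one unit, hence the factor 2. -/
lemma abs_integral_conv_mul_pd_le {k : Vel → ℝ} (hk : IsApproximable k)
    (hψ : WeightedTest Λ W ψ) (h0 : ∀ v, 0 ≤ g v)
    (hB : ∀ v, conv (fun z => ‖z‖⁻¹) g v ≤ B) (j : Fin 3) :
    |∫ v, ψ v * pd j g v * conv k g v| ≤ 2 * (Λ * B * ∫ v, W v * g v) := by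
  have hkk := hk
  obtain ⟨hk, -⟩ := hk
  have hcψ := hψ.diff.continuous
  have hcW := hψ.weight_cont
  have hkc := conv_continuous hk g
  have hkc' := conv_continuous hk (pd j g)
  have hWg := hψ.weight_poly.mul_rapid (schwartz_rapid g)
  have hWgi := hWg.integrable (hcW.mul g.continuous).aestronglyMeasurable
  have hψ' : Poly (partialDeriv j ψ) := by
    obtain ⟨n, C, hC, h⟩ := hψ.weight_poly
    refine ⟨n, Λ * C, mul_nonneg hψ.nonneg hC, fun v => (hψ.deriv_le j v).trans ?_⟩
    rw [mul_assoc]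
    exact mul_le_mul_of_nonneg_left ((le_abs_self _).trans (h v)) hψ.nonneg
  have hi1 : Integrable fun v => ψ v * g v * conv k (pd j g) v :=
    ((hψ.poly.mul_rapid (schwartz_rapid g)).mul_poly (conv_poly hk _)).integrable
      ((hcψ.mul g.continuous).mul hkc').aestronglyMeasurable
  have hi2 : Integrable fun v => partialDeriv j ψ v * conv k g v * g v :=
    ((hψ'.mul (conv_poly hk g)).mul_rapid (schwartz_rapid g)).integrable
      ((((measurable_partialDeriv j ψ).mul hkc.measurable).mul
        g.continuous.measurable).aestronglyMeasurable)
  have hprod : ∀ v, partialDeriv j (fun v => ψ v * conv k g v) v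
      = ψ v * conv k (pd j g) v + partialDeriv j ψ v * conv k g v := fun v => by
    rw [partialDeriv_mul j (hψ.diff v) (conv_differentiable hk g v), partialDeriv_conv hk]
  have hibp := integral_mul_partialDeriv (u := fun v => ψ v * conv k g v) (w := g) j
    (hψ.diff.mul (conv_differentiable hk g)) g.differentiable
    (by
      simp only [hprod]
      refine (hi1.add hi2).congr (ae_of_all _ fun v => ?_)
      simp only [Pi.add_apply]
      ring)
    (by
      simp only [← pd_apply]
      exact ((hψ.poly.mul (conv_poly hk g)).mul_rapid (schwartz_rapid (pd j g))).integrable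
        ((hcψ.mul hkc).mul (pd j g).continuous).aestronglyMeasurable)
    (((hψ.poly.mul (conv_poly hk g)).mul_rapid (schwartz_rapid g)).integrable
        ((hcψ.mul hkc).mul g.continuous).aestronglyMeasurable)
  have e : ∫ v, ψ v * pd j g v * conv k g v
      = -((∫ v, ψ v * g v * conv k (pd j g) v) + ∫ v, partialDeriv j ψ v * conv k g v * g v) := by
    rw [← integral_add hi1 hi2]
    refine Eq.trans ?_ (hibp.trans ?_)
    · refine integral_congr_ae (ae_of_all _ fun v => ?_)
      simp only [← pd_apply]
      ring
    · congr 1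
      refine integral_congr_ae (ae_of_all _ fun v => ?_)
      simp only [hprod]
      ring
  have h2 : |∫ v, partialDeriv j ψ v * conv k g v * g v| ≤ Λ * B * ∫ v, W v * g v := by
    rw [← integral_const_mul, ← Real.norm_eq_abs]
    refine norm_integral_le_of_norm_le (hWgi.const_mul _) (ae_of_all _ fun v => ?_)
    rw [Real.norm_eq_abs, abs_mul, abs_mul, abs_of_nonneg (h0 v)]
    calc |partialDeriv j ψ v| * |conv k g v| * g v ≤ (Λ * W v) * B * g v := by
          refine mul_le_mul_of_nonneg_right ?_ (h0 v)
          exact mul_le_mul (hψ.deriv_le j v) ((abs_conv_le_conv_inv hk g h0 v).trans (hB v))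
            (abs_nonneg _) (mul_nonneg hψ.nonneg (hψ.weight_nonneg v))
      _ = _ := by ring
  rw [e, abs_neg]
  refine (abs_add_le _ _).trans ?_
  linarith [abs_integral_conv_pd_le hkk hψ h0 hB j]

/-- The contribution of the flux tested against a gradient-like field. -/
lemma abs_sum_integral_flux_le {ψ : Fin 3 → Vel → ℝ} (hψ : ∀ i, WeightedTest Λ W (ψ i))
    (h0 : ∀ v, 0 ≤ g v) (hB : ∀ v, conv (fun z => ‖z‖⁻¹) g v ≤ B) :
    |∑ i, ∫ v, ψ i v * flux g i v| ≤ 21 * (Λ * B * ∫ v, W v * g v) := by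
  set S := Λ * B * ∫ v, W v * g v with hS
  -- Three diffusion terms cost 2S each and the drift term costs S; the sum over i then gives 21.
  have hi : ∀ i, |∫ v, ψ i v * flux g i v| ≤ 7 * S := by
    intro i
    have hiA : ∀ j, Integrable fun v => ψ i v * pd j g v * conv (landauKernel i j) g v := fun j =>
      (((hψ i).poly.mul_rapid (schwartz_rapid (pd j g))).mul_poly
        (conv_poly (landauKernel_isKernel i j) g)).integrable
        (((hψ i).diff.continuous.mul (pd j g).continuous).mul
          (conv_continuous (landauKernel_isKernel i j) g)).aestronglyMeasurable
    have hia : Integrable fun v => ψ i v * g v * conv coulombKernel (pd i g) v :=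
      (((hψ i).poly.mul_rapid (schwartz_rapid g)).mul_poly
        (conv_poly coulombKernel_isKernel (pd i g))).integrable
        (((hψ i).diff.continuous.mul g.continuous).mul
          (conv_continuous coulombKernel_isKernel (pd i g))).aestronglyMeasurable
    have e : ∫ v, ψ i v * flux g i v
        = (∑ j, ∫ v, ψ i v * pd j g v * conv (landauKernel i j) g v)
          - ∫ v, ψ i v * g v * conv coulombKernel (pd i g) v := by
      rw [← integral_finsetSum _ fun j _ => hiA j, ← integral_sub (integrable_finsetSum _
        fun j _ => hiA j) hia]
      refine integral_congr_ae (ae_of_all _ fun v => ?_)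
      simp only [coe_flux, mul_sub, Finset.mul_sum]
      congr 1
      · exact Finset.sum_congr rfl fun j _ => by ring
      · ring
    have h1 : |∑ j, ∫ v, ψ i v * pd j g v * conv (landauKernel i j) g v|
        ≤ ∑ _j : Fin 3, 2 * S :=
      (Finset.abs_sum_le_sum_abs _ _).trans (Finset.sum_le_sum fun j _ =>
        abs_integral_conv_mul_pd_le (landauKernel_isApproximable i j) (hψ i) h0 hB j)
    have h2 := abs_integral_conv_pd_le coulombKernel_isApproximable (hψ i) h0 hB i
    simp only [Finset.sum_const, Finset.card_univ, Fintype.card_fin, nsmul_eq_mul] at h1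
    push_cast at h1
    rw [e]
    refine (abs_sub _ _).trans ?_
    linarith
  calc |∑ i, ∫ v, ψ i v * flux g i v| ≤ ∑ _i : Fin 3, 7 * S :=
        (Finset.abs_sum_le_sum_abs _ _).trans (Finset.sum_le_sum fun i _ => hi i)
    _ = _ := by simp; ring

end symmetrisation

/-! ### The bracket weights -/

section bracket

lemma one_le_bracket (v : Vel) : 1 ≤ bracket v :=
  Real.one_le_sqrt.mpr (by nlinarith [sq_nonneg ‖v‖])

lemma bracket_pos (v : Vel) : 0 < bracket v := zero_lt_one.trans_le (one_le_bracket v)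

lemma bracket_sq (v : Vel) : bracket v ^ 2 = 1 + ‖v‖ ^ 2 := Real.sq_sqrt (by positivity)

lemma norm_le_bracket (v : Vel) : ‖v‖ ≤ bracket v :=
  Real.le_sqrt_of_sq_le (by linarith)

lemma bracket_le_one_add_norm (v : Vel) : bracket v ≤ 1 + ‖v‖ := by
  refine Real.sqrt_le_iff.mpr ⟨by positivity, ?_⟩
  nlinarith [norm_nonneg v]

lemma bracket_continuous : Continuous bracket := by
  unfold bracket; fun_prop

lemma bracket_rpow_continuous (s : ℝ) : Continuous fun v => bracket v ^ s :=
  bracket_continuous.rpow_const fun v => Or.inl (bracket_pos v).ne'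

lemma bracket_rpow_poly (s : ℝ) : Poly fun v => bracket v ^ s := by
  obtain ⟨n, hn⟩ := exists_nat_ge s
  refine ⟨n, 1, zero_le_one, fun v => ?_⟩
  have hb := bracket_pos v
  rw [abs_of_pos (Real.rpow_pos_of_pos hb s), one_mul]
  calc bracket v ^ s ≤ bracket v ^ (n : ℝ) :=
        Real.rpow_le_rpow_of_exponent_le (one_le_bracket v) hn
    _ = bracket v ^ n := Real.rpow_natCast _ _
    _ ≤ _ := pow_le_pow_left₀ hb.le (bracket_le_one_add_norm v) n

lemma bracket_rpow_hasFDerivAt (s : ℝ) (v : Vel) :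
    HasFDerivAt (fun v => bracket v ^ s) ((s * bracket v ^ (s - 2)) • innerSL ℝ v) v := by
  have h1 : HasFDerivAt (fun z : Vel => 1 + ‖z‖ ^ 2) ((2 : ℝ) • innerSL ℝ v) v := by
    have h := (hasStrictFDerivAt_norm_sq v).hasFDerivAt.const_add 1
    rwa [two_nsmul, ← two_smul ℝ] at h
  have hq : 0 < 1 + ‖v‖ ^ 2 := by positivity
  have hb := bracket_pos v
  have h2 := h1.rpow_const (p := s / 2) (Or.inl hq.ne')
  have e : (fun v => bracket v ^ s) = fun v => (1 + ‖v‖ ^ 2) ^ (s / 2) := by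
    funext v
    rw [← bracket_sq, ← Real.rpow_natCast, ← Real.rpow_mul (bracket_pos v).le]
    congr 1
    push_cast
    ring
  rw [e]
  convert! h2 using 1
  rw [smul_smul, ← bracket_sq, ← Real.rpow_natCast, ← Real.rpow_mul hb.le]
  congr 1
  rw [show ((2 : ℕ) : ℝ) * (s / 2 - 1) = s - 2 by push_cast; ring]
  ring

lemma bracket_rpow_partialDeriv (s : ℝ) (i : Fin 3) (v : Vel) :
    partialDeriv i (fun v => bracket v ^ s) v = s * bracket v ^ (s - 2) * v i := by
  rw [partialDeriv, (bracket_rpow_hasFDerivAt s v).fderiv, smul_apply, innerSL_single,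
    smul_eq_mul]

lemma bracket_rpow_mono {s : ℝ} (hs : 0 ≤ s) {v w : Vel} (h : ‖v‖ ≤ ‖w‖) :
    bracket v ^ s ≤ bracket w ^ s :=
  Real.rpow_le_rpow (bracket_pos v).le (Real.sqrt_le_sqrt (by gcongr)) hs

/-- The gradient of ⟨v⟩^m is admissible because second derivatives of ⟨v⟩^m are bounded by
m(m-1)⟨v⟩^{m-2}, hence by m²⟨v⟩^m. -/
lemma weightedTest_bracket {m : ℝ} (hm : 2 ≤ m) (i : Fin 3) :
    WeightedTest (m ^ 2) (fun v => bracket v ^ m) (partialDeriv i fun v => bracket v ^ m) := by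
  have hψ : (partialDeriv i fun v => bracket v ^ m) = fun v => m * bracket v ^ (m - 2) * v i :=
    funext (bracket_rpow_partialDeriv m i)
  rw [hψ]
  have hd : ∀ v, HasFDerivAt (fun v => m * bracket v ^ (m - 2) * v i)
      ((m * bracket v ^ (m - 2)) • (EuclideanSpace.proj i : Vel →L[ℝ] ℝ)
        + v i • (m • (((m - 2) * bracket v ^ (m - 2 - 2)) • innerSL ℝ v))) v := fun v =>
    ((bracket_rpow_hasFDerivAt (m - 2) v).const_mul m).mul (coord_hasFDerivAt i v)
  have hpos : ∀ (v : Vel) (s : ℝ), 0 < bracket v ^ s := fun v s =>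
    Real.rpow_pos_of_pos (bracket_pos v) s
  have hn : ∀ v, ‖fderiv ℝ (fun v => m * bracket v ^ (m - 2) * v i) v‖ ≤ m ^ 2 * bracket v ^ m := by
    intro v
    have hp1 := hpos v (m - 2)
    have hp2 := hpos v (m - 2 - 2)
    have hproj : ‖(EuclideanSpace.proj i : Vel →L[ℝ] ℝ)‖ ≤ 1 :=
      ContinuousLinearMap.opNorm_le_bound _ zero_le_one fun x => by
        simpa using abs_coord_le x i
    have e1 : bracket v ^ (m - 2 - 2) * bracket v ^ 2 = bracket v ^ (m - 2) := by
      rw [← Real.rpow_natCast, ← Real.rpow_add (bracket_pos v)]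
      congr 1
      push_cast; ring
    have e2 : bracket v ^ (m - 2) ≤ bracket v ^ m :=
      Real.rpow_le_rpow_of_exponent_le (one_le_bracket v) (by linarith)
    have hm2 : 0 ≤ m - 2 := by linarith
    have hm0 : 0 ≤ m := by linarith
    have hvb : ‖v‖ * ‖v‖ ≤ bracket v ^ 2 := by rw [bracket_sq]; nlinarith
    rw [(hd v).fderiv]
    refine (norm_add_le _ _).trans ?_
    simp only [norm_smul, innerSL_apply_norm, Real.norm_eq_abs, abs_mul, abs_of_pos hp1,
      abs_of_pos hp2, abs_of_nonneg hm2, abs_of_nonneg hm0]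
    calc m * bracket v ^ (m - 2) * ‖(EuclideanSpace.proj i : Vel →L[ℝ] ℝ)‖
          + |v i| * (m * ((m - 2) * bracket v ^ (m - 2 - 2) * ‖v‖))
        ≤ m * bracket v ^ (m - 2) * 1
          + ‖v‖ * (m * ((m - 2) * bracket v ^ (m - 2 - 2) * ‖v‖)) := by
          gcongr
          exact abs_coord_le v i
      _ = m * bracket v ^ (m - 2) + m * (m - 2) * (bracket v ^ (m - 2 - 2) * (‖v‖ * ‖v‖)) := by
          ring
      _ ≤ m * bracket v ^ (m - 2) + m * (m - 2) * (bracket v ^ (m - 2 - 2) * bracket v ^ 2) := by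
          gcongr
      _ ≤ m ^ 2 * bracket v ^ m := by
          rw [e1]
          nlinarith [mul_le_mul_of_nonneg_left e2 (sq_nonneg m), mul_nonneg hm0 hp1.le]
  exact
  { nonneg := by positivity
    weight_nonneg := fun v => (hpos v m).le
    weight_cont := bracket_rpow_continuous m
    weight_poly := bracket_rpow_poly m
    diff := fun v => (hd v).differentiableAt
    poly := ((Poly.of_bound (C := |m|) fun _ => le_rfl).mul (bracket_rpow_poly (m - 2))).mul
      ⟨1, 1, zero_le_one, fun v => by
        have := abs_coord_le v i
        rw [pow_one, one_mul]; linarith⟩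
    deriv_le := fun j v => (abs_partialDeriv_le j _ v).trans (hn v)
    sub_le := fun v w => by
      -- The mean value inequality is applied on the centred ball containing both points. The weight
      -- increases with |z|, so there it is at most the larger of its values at v and w.
      have hR : ∀ z ∈ Metric.closedBall (0 : Vel) (max ‖v‖ ‖w‖),
          ‖fderiv ℝ (fun v => m * bracket v ^ (m - 2) * v i) z‖
            ≤ m ^ 2 * (bracket v ^ m + bracket w ^ m) := by
        intro z hz
        rw [mem_closedBall_zero_iff] at hz
        refine (hn z).trans (mul_le_mul_of_nonneg_left ?_ (sq_nonneg m))
        rcases le_max_iff.mp hz with h | h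
        · linarith [bracket_rpow_mono (by linarith : 0 ≤ m) h, hpos w m]
        · linarith [bracket_rpow_mono (by linarith : 0 ≤ m) h, hpos v m]
      exact (convex_closedBall (0 : Vel) _).norm_image_sub_le_of_norm_fderiv_le
        (fun z _ => (hd z).differentiableAt) hR (by simp) (by simp) }

end bracket

/-! ### Mass conservation, moment growth and the potential bound -/

lemma integral_collision_eq_zero (g : 𝓢(Vel, ℝ)) : ∫ v, collision g v = 0 := by
  have h0 : ∀ i, partialDeriv i (fun _ : Vel => (1 : ℝ)) = 0 := fun i => by
    funext v; simp [partialDeriv]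
  have := integral_mul_collision g (u := fun _ => 1) (differentiable_const _)
    (.of_bound (C := 1) (by simp)) (fun i => .of_bound (C := 0) (by simp [h0]))
  simpa [h0] using this

/-- Growth of moments is controlled by the moment itself. -/
lemma abs_integral_bracket_mul_collision_le {m B : ℝ} (hm : 2 ≤ m) {g : 𝓢(Vel, ℝ)}
    (h0 : ∀ v, 0 ≤ g v) (hB : ∀ v, conv (fun z => ‖z‖⁻¹) g v ≤ B) :
    |∫ v, bracket v ^ m * collision g v|
      ≤ 21 * (m ^ 2 * B * ∫ v, bracket v ^ m * g v) := by
  have hψ := weightedTest_bracket hm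
  rw [integral_mul_collision g (fun v => (bracket_rpow_hasFDerivAt m v).differentiableAt)
    (bracket_rpow_poly m) (fun i => (hψ i).poly), abs_neg]
  exact abs_sum_integral_flux_le hψ h0 hB

/-- The Newtonian potential is bounded by the mass and the `Lᵖ` norm when `p > 3/2`. -/
lemma conv_inv_norm_le {p : ℝ} (hp : 3 / 2 < p) {g : 𝓢(Vel, ℝ)} (h0 : ∀ v, 0 ≤ g v) (v : Vel) :
    conv (fun z => ‖z‖⁻¹) g v
      ≤ (∫ w, g w) + (∫ w, g w ^ p) + ∫ z, nearPow (p / (p - 1)) z := by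
  -- This is where p > 3/2 enters: the conjugate exponent is below the dimension, so |z|^{-p'} is
  -- integrable near the origin.
  have hq : p / (p - 1) < 3 := by
    rw [div_lt_iff₀ (by linarith)]; linarith
  have hconj : p.HolderConjugate (p / (p - 1)) :=
    Real.HolderConjugate.conjExponent (by linarith)
  have hgi := (schwartz_rapid g).integrable g.continuous.aestronglyMeasurable
  have hgp : Integrable fun w => g w ^ p :=
    ((schwartz_rapid g).rpow h0 (by linarith)).integrable
      (g.continuous.rpow_const fun _ => Or.inr (by linarith)).aestronglyMeasurable
  have hnear := (integrable_nearPow hq).comp_sub_left v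
  have hpt : ∀ w, ‖v - w‖⁻¹ * g w ≤ g w + g w ^ p + nearPow (p / (p - 1)) (v - w) := by
    intro w
    have hgw := h0 w
    have hgw' := Real.rpow_nonneg hgw p
    by_cases h : v - w ∈ Metric.ball (0 : Vel) 1
    · have hy := Real.young_inequality_of_nonneg hgw (by positivity : 0 ≤ ‖v - w‖⁻¹) hconj
      have e : nearPow (p / (p - 1)) (v - w) = ‖v - w‖⁻¹ ^ (p / (p - 1)) := by
        rw [nearPow, indicator_of_mem h, Real.rpow_neg (norm_nonneg _),
          Real.inv_rpow (norm_nonneg _)]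
      rw [← e] at hy
      have h1 : g w ^ p / p ≤ g w ^ p := div_le_self hgw' (by linarith)
      have h2 := div_le_self (nearPow_nonneg (p / (p - 1)) (v - w)) hconj.symm.lt.le
      rw [mul_comm]
      linarith
    · have hn := nearPow_nonneg (p / (p - 1)) (v - w)
      simp only [Metric.mem_ball, dist_zero_right, not_lt] at h
      have := mul_le_mul_of_nonneg_right (inv_le_one_of_one_le₀ h) hgw
      linarith
  have hmono := integral_mono
    (integrable_conv inv_norm_isKernel (schwartz_rapid g) g.continuous.measurable v)
    ((hgi.add hgp).add hnear) hpt
  rw [conv]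
  refine hmono.trans_eq ?_
  rw [integral_add' (hgi.add hgp) hnear, integral_add' hgi hgp,
    integral_sub_left_eq_self (nearPow _) volume v]

/-! ### The drift term -/

section drift

/-- `-Δ` of the regularised Coulomb kernel. -/
def mollifier (ε : ℝ) (z : Vel) : ℝ := (4 * Real.pi)⁻¹ * (3 * ε ^ 2 * regInv ε z ^ 5)

lemma mollifier_nonneg {ε : ℝ} (hε : 0 < ε) (z : Vel) : 0 ≤ mollifier ε z := by
  have := regInv_pos hε z
  have := Real.pi_pos
  unfold mollifier; positivity

lemma measurable_mollifier (ε : ℝ) : Measurable (mollifier ε) := by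
  have := measurable_regInv ε
  unfold mollifier; fun_prop

lemma mollifier_le {ε : ℝ} (hε : 0 < ε) (z : Vel) :
    mollifier ε z ≤ (4 * Real.pi)⁻¹ * (3 * ε ^ 2 * ε⁻¹ ^ 5) := by
  have := regInv_pos hε z
  have := Real.pi_pos
  unfold mollifier
  gcongr
  exact regInv_le hε z

lemma integrable_mollifier_one : Integrable (mollifier 1) := by
  have h := integrable_rpow_neg_one_add_norm_sq (E := Vel) (μ := volume) (r := 5)
    (by simp; norm_num)
  refine (h.const_mul ((4 * Real.pi)⁻¹ * 3)).congr (ae_of_all _ fun z => ?_)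
  have hq : 0 < 1 + ‖z‖ ^ 2 := by positivity
  have e : regInv 1 z = (1 + ‖z‖ ^ 2) ^ (-(1 / 2) : ℝ) := by
    rw [regInv, Real.rpow_neg hq.le, ← Real.sqrt_eq_rpow, add_comm, one_pow]
  simp only [mollifier, e]
  rw [← Real.rpow_natCast (_ ^ _) 5, ← Real.rpow_mul hq.le]
  norm_num
  ring

/-- By scaling, the mass of the mollifier does not depend on ε, so estimates using only that mass
are uniform in ε. -/
lemma mollifier_eq {ε : ℝ} (hε : 0 < ε) (z : Vel) :
    mollifier ε z = (ε ^ 3)⁻¹ * mollifier 1 (ε⁻¹ • z) := by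
  have e : regInv ε z = ε⁻¹ * regInv 1 (ε⁻¹ • z) := by
    rw [regInv, regInv, ← mul_inv]
    congr 1
    rw [norm_smul, Real.norm_of_nonneg (by positivity)]
    have : ‖z‖ ^ 2 + ε ^ 2 = ε ^ 2 * ((ε⁻¹ * ‖z‖) ^ 2 + 1 ^ 2) := by field_simp
    rw [this, Real.sqrt_mul (by positivity), Real.sqrt_sq hε.le]
  simp only [mollifier, e]
  field_simp

lemma integrable_mollifier {ε : ℝ} (hε : 0 < ε) : Integrable (mollifier ε) := by
  simp only [funext (mollifier_eq hε)]
  exact ((integrable_comp_smul_iff volume _ (inv_ne_zero hε.ne')).mpr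
    integrable_mollifier_one).const_mul _

lemma integral_mollifier {ε : ℝ} (hε : 0 < ε) :
    ∫ z, mollifier ε z = ∫ z, mollifier 1 z := by
  simp only [mollifier_eq hε]
  rw [integral_const_mul, Measure.integral_comp_inv_smul_of_nonneg _ _ hε.le]
  simp only [finrank_euclideanSpace, Fintype.card_fin, smul_eq_mul]
  rw [← mul_assoc, inv_mul_cancel₀ (by positivity), one_mul]

lemma integrable_conv_mollifier_integrand {ε : ℝ} (hε : 0 < ε) {h : Vel → ℝ} (hi : Integrable h)
    (v : Vel) : Integrable fun w => mollifier ε (v - w) * h w :=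
  hi.bdd_mul (c := (4 * Real.pi)⁻¹ * (3 * ε ^ 2 * ε⁻¹ ^ 5))
    ((measurable_mollifier ε).comp
      (by fun_prop : Measurable fun w : Vel => v - w)).aestronglyMeasurable
    (ae_of_all _ fun w => by
      rw [Real.norm_of_nonneg (mollifier_nonneg hε _)]
      exact mollifier_le hε _)

lemma conv_eq_convolution (k h : Vel → ℝ) :
    conv k h = convolution h k (ContinuousLinearMap.mul ℝ ℝ) volume := by
  funext v
  simp only [conv, convolution, ContinuousLinearMap.mul_apply', mul_comm]

lemma integrable_conv_mollifier {ε : ℝ} (hε : 0 < ε) {h : Vel → ℝ} (hi : Integrable h) :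
    Integrable (conv (mollifier ε) h) := by
  rw [conv_eq_convolution]
  exact hi.integrable_convolution _ (integrable_mollifier hε)

lemma integral_conv_mollifier {ε : ℝ} (hε : 0 < ε) {h : Vel → ℝ} (hi : Integrable h) :
    ∫ v, conv (mollifier ε) h v = (∫ v, h v) * ∫ z, mollifier 1 z := by
  rw [conv_eq_convolution, integral_convolution _ hi (integrable_mollifier hε),
    integral_mollifier hε]
  rfl

lemma partialDeriv_partialDeriv_regCoulomb {ε : ℝ} (hε : 0 < ε) (i : Fin 3) (z : Vel) :
    DifferentiableAt ℝ (partialDeriv i (regCoulomb ε)) z ∧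
    partialDeriv i (partialDeriv i (regCoulomb ε)) z
      = (4 * Real.pi)⁻¹ * (3 * regInv ε z ^ 5 * z i ^ 2 - regInv ε z ^ 3) := by
  have e : partialDeriv i (regCoulomb ε)
      = fun z => (4 * Real.pi)⁻¹ * (-regInv ε z ^ 3 * z i) :=
    funext (regCoulomb_partialDeriv hε i)
  have hr := regInv_hasFDerivAt hε z
  have h := (((hr.pow 3).neg.mul (coord_hasFDerivAt i z)).const_mul (4 * Real.pi)⁻¹)
  rw [e]
  refine ⟨h.differentiableAt, ?_⟩
  rw [partialDeriv]
  erw [h.fderiv]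
  simp [EuclideanSpace.inner_single_right]
  ring

lemma sum_partialDeriv_regCoulomb {ε : ℝ} (hε : 0 < ε) (z : Vel) :
    ∑ i, partialDeriv i (partialDeriv i (regCoulomb ε)) z = -mollifier ε z := by
  simp only [(partialDeriv_partialDeriv_regCoulomb hε _ z).2]
  have hn : ‖z‖ ^ 2 = z 0 ^ 2 + z 1 ^ 2 + z 2 ^ 2 := by
    rw [EuclideanSpace.norm_sq_eq]
    simp [Fin.sum_univ_three]
  have hs := regInv_sq hε z
  rw [hn] at hs
  rw [Fin.sum_univ_three, mollifier]
  linear_combination (4 * Real.pi)⁻¹ * 3 * regInv ε z ^ 3 * hs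

lemma conv_regCoulomb_pd_pd {ε : ℝ} (hε : 0 < ε) (g : 𝓢(Vel, ℝ)) (i : Fin 3) (v : Vel) :
    Integrable (fun w => partialDeriv i (partialDeriv i (regCoulomb ε)) (v - w) * g w) ∧
    conv (regCoulomb ε) (pd i (pd i g)) v
      = conv (partialDeriv i (partialDeriv i (regCoulomb ε))) g v := by
  have hK := regCoulomb_regKernel hε
  obtain ⟨b, hb⟩ := hK.bounded
  obtain ⟨b', hb'⟩ := hK.deriv_bounded
  have hb2 : ∀ z, |partialDeriv i (partialDeriv i (regCoulomb ε)) z| ≤ 4 * ε⁻¹ ^ 3 := by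
    intro z
    have hr := regInv_pos hε z
    have hpi := Real.pi_pos
    rw [(partialDeriv_partialDeriv_regCoulomb hε i z).2, abs_mul,
      abs_of_pos (by positivity : 0 < (4 * Real.pi)⁻¹)]
    have h1 : (regInv ε z * z i) ^ 2 ≤ 1 := by
      rw [sq_le_one_iff_abs_le_one, abs_mul, abs_of_pos hr]
      exact (mul_le_mul_of_nonneg_left (abs_coord_le z i) hr.le).trans (regInv_mul_norm_le hε z)
    have h2 : |3 * regInv ε z ^ 5 * z i ^ 2 - regInv ε z ^ 3| ≤ 4 * regInv ε z ^ 3 := by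
      have h3 : 0 < regInv ε z ^ 3 := by positivity
      rw [show 3 * regInv ε z ^ 5 * z i ^ 2 - regInv ε z ^ 3
        = regInv ε z ^ 3 * (3 * (regInv ε z * z i) ^ 2 - 1) by ring, abs_mul, abs_of_pos h3,
        mul_comm]
      refine mul_le_mul_of_nonneg_right ?_ h3.le
      rw [abs_le]
      constructor <;> nlinarith [sq_nonneg (regInv ε z * z i)]
    calc _ ≤ 1 * (4 * regInv ε z ^ 3) := by
          gcongr
          exact inv_four_pi_le
      _ ≤ 4 * ε⁻¹ ^ 3 := by
          rw [one_mul]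
          gcongr
          exact regInv_le hε z
  constructor
  · have hgi := (schwartz_rapid g).integrable g.continuous.aestronglyMeasurable
    exact hgi.bdd_mul (c := 4 * ε⁻¹ ^ 3) ((measurable_partialDeriv i _).comp
      (by fun_prop : Measurable fun w : Vel => v - w)).aestronglyMeasurable
      (ae_of_all _ fun w => hb2 _)
  · rw [conv_pd_eq hK.diff hb i (hb' i), conv_pd_eq
      (fun z => (partialDeriv_partialDeriv_regCoulomb hε i z).1) (hb' i) i hb2]

variable {g : 𝓢(Vel, ℝ)}

lemma integrable_rpow (h0 : ∀ v, 0 ≤ g v) {q : ℝ} (hq : 0 < q) : Integrable fun v => g v ^ q :=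
  ((schwartz_rapid g).rpow h0 hq).integrable
    (g.continuous.rpow_const fun _ => Or.inr hq.le).aestronglyMeasurable

lemma partialDeriv_rpow_poly (h0 : ∀ v, 0 ≤ g v) {q : ℝ} (hq : 1 / 2 < q) (i : Fin 3) :
    Poly (partialDeriv i fun v => g v ^ q) := by
  obtain ⟨L, hL⟩ := schwartz_nonnegC11 g h0
  obtain ⟨C, hC, h⟩ := ((schwartz_rapid g).rpow h0 (by linarith : 0 < q - 1 / 2)).bounded
  refine .of_bound (C := 2 * q * √L * C) fun v => (abs_partialDeriv_le i _ v).trans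
    ((hL.norm_fderiv_rpow_le hq v).trans ?_)
  gcongr
  exact (le_abs_self _).trans (h v)

lemma partialDeriv_rpow_rapid (h0 : ∀ v, 0 ≤ g v) {q : ℝ} (hq : 1 / 2 < q) (i : Fin 3) :
    Rapid (partialDeriv i fun v => g v ^ q) := by
  obtain ⟨L, hL⟩ := schwartz_nonnegC11 g h0
  refine (((schwartz_rapid g).rpow h0 (by linarith : 0 < q - 1 / 2)).const_mul
    (2 * q * √L)).mono fun v => (abs_partialDeriv_le i _ v).trans
    ((hL.norm_fderiv_rpow_le hq v).trans (le_abs_self _))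

/-- Integration by parts puts a Laplacian on the regularised potential, and minus the Laplacian of
the kernel is the mollifier. -/
lemma sum_integral_regCoulomb {ε : ℝ} (hε : 0 < ε) (h0 : ∀ v, 0 ≤ g v) {p : ℝ} (hp : 3 / 2 < p) :
    ∑ i, ∫ v, partialDeriv i (fun w => g w ^ p) v * conv (regCoulomb ε) (pd i g) v
      = ∫ v, g v ^ p * conv (mollifier ε) g v := by
  obtain ⟨L, hL⟩ := schwartz_nonnegC11 g h0
  have hK := (regCoulomb_regKernel hε).toIsKernel
  have hgp := (schwartz_rapid g).rpow h0 (by linarith : 0 < p)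
  have hdp := hL.differentiable_rpow (by linarith : 1 / 2 < p)
  have hInt : ∀ i, Integrable fun v => g v ^ p * conv (regCoulomb ε) (pd i (pd i g)) v :=
    fun i => (hgp.mul_poly (conv_poly hK _)).integrable
      (hdp.continuous.mul (conv_continuous hK _)).aestronglyMeasurable
  have hi : ∀ i, ∫ v, partialDeriv i (fun w => g w ^ p) v * conv (regCoulomb ε) (pd i g) v
      = -∫ v, g v ^ p * conv (regCoulomb ε) (pd i (pd i g)) v := by
    intro i
    have := integral_mul_partialDeriv (u := fun v => g v ^ p) (w := conv (regCoulomb ε) (pd i g)) i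
      hdp (conv_differentiable hK _)
      (((partialDeriv_rpow_rapid h0 (by linarith) i).mul_poly (conv_poly hK _)).integrable
        ((measurable_partialDeriv i _).mul
          (conv_continuous hK _).measurable).aestronglyMeasurable)
      (by rw [partialDeriv_conv hK]; exact hInt i)
      ((hgp.mul_poly (conv_poly hK _)).integrable
        (hdp.continuous.mul (conv_continuous hK _)).aestronglyMeasurable)
    rw [partialDeriv_conv hK] at this
    rw [this, neg_neg]
  simp only [hi]
  rw [Finset.sum_neg_distrib, ← integral_finsetSum _ fun i _ => hInt i, ← integral_neg]
  refine integral_congr_ae (ae_of_all _ fun v => ?_)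
  simp only
  rw [← Finset.mul_sum, ← mul_neg]
  congr 1
  simp only [(conv_regCoulomb_pd_pd hε g _ v).2]
  unfold conv
  rw [← integral_finsetSum _ fun i _ => (conv_regCoulomb_pd_pd hε g i v).1, ← integral_neg]
  refine integral_congr_ae (ae_of_all _ fun w => ?_)
  simp only
  rw [← Finset.sum_mul, sum_partialDeriv_regCoulomb hε]
  ring

lemma rpow_mul_le_add {a b p : ℝ} (ha : 0 ≤ a) (hb : 0 ≤ b) (hp : 0 < p) :
    a ^ p * b ≤ a ^ (p + 1) + b ^ (p + 1) := by
  have h1 : ∀ {x : ℝ}, 0 ≤ x → x ^ (p + 1) = x ^ p * x := fun {x} hx => by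
    rw [Real.rpow_add_one' hx (by linarith)]
  rw [h1 ha, h1 hb]
  have hap := Real.rpow_nonneg ha p
  have hbp := Real.rpow_nonneg hb p
  rcases le_total a b with h | h
  · have := Real.rpow_le_rpow ha h hp.le
    nlinarith [mul_le_mul_of_nonneg_right this hb, mul_nonneg hap ha]
  · nlinarith [mul_le_mul_of_nonneg_left h hap, mul_nonneg hbp hb]

/-- The constant in the estimate of the drift term. -/
def driftConst : ℝ := 2 * ∫ z, mollifier 1 z

lemma driftConst_nonneg : 0 ≤ driftConst :=
  mul_nonneg zero_le_two (integral_nonneg (mollifier_nonneg one_pos))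

/-- Young's inequality g(v)^p g(w) ≤ g(v)^{p+1} + g(w)^{p+1} is integrated against the mollifier,
each term giving its total mass. An upper bound suffices, so neither the value of this mass nor
convergence to a Dirac mass is needed. -/
lemma integral_mul_conv_mollifier_le {ε : ℝ} (hε : 0 < ε) (h0 : ∀ v, 0 ≤ g v) {p : ℝ}
    (hp : 3 / 2 < p) :
    ∫ v, g v ^ p * conv (mollifier ε) g v ≤ driftConst * ∫ v, g v ^ (p + 1) := by
  have hgi := (schwartz_rapid g).integrable g.continuous.aestronglyMeasurable
  have hp1 := integrable_rpow h0 (by linarith : 0 < p + 1)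
  have hgp : Continuous fun v => g v ^ p := g.continuous.rpow_const fun _ => Or.inr (by linarith)
  obtain ⟨C, hC, hCb⟩ := ((schwartz_rapid g).rpow h0 (by linarith : 0 < p)).bounded
  have hl : Integrable fun v => g v ^ p * conv (mollifier ε) g v :=
    (integrable_conv_mollifier hε hgi).bdd_mul (c := C) hgp.aestronglyMeasurable
      (ae_of_all _ hCb)
  have hm1 : ∀ v, ∫ w, mollifier ε (v - w) = ∫ z, mollifier 1 z := fun v => by
    rw [integral_sub_left_eq_self (mollifier ε) volume v, integral_mollifier hε]
  have hpt : ∀ v, g v ^ p * conv (mollifier ε) g v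
      ≤ (∫ z, mollifier 1 z) * g v ^ (p + 1)
        + conv (mollifier ε) (fun w => g w ^ (p + 1)) v := by
    intro v
    have hmi := (integrable_mollifier hε).comp_sub_left v
    rw [← hm1 v, conv, conv, ← integral_const_mul, ← integral_mul_const,
      ← integral_add (hmi.mul_const _) (integrable_conv_mollifier_integrand hε hp1 v)]
    refine integral_mono ((integrable_conv_mollifier_integrand hε hgi v).const_mul _)
      ((hmi.mul_const _).add (integrable_conv_mollifier_integrand hε hp1 v)) fun w => ?_
    have := mul_le_mul_of_nonneg_left (rpow_mul_le_add (h0 v) (h0 w) (by linarith : 0 < p))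
      (mollifier_nonneg hε (v - w))
    simp only
    linarith
  refine (integral_mono hl ((hp1.const_mul _).add (integrable_conv_mollifier hε hp1))
    hpt).trans_eq ?_
  rw [integral_add' (hp1.const_mul _) (integrable_conv_mollifier hε hp1), integral_const_mul,
    integral_conv_mollifier hε hp1, driftConst]
  ring

/-- The drift term is controlled by `∫ g^{p+1}`. -/
lemma sum_integral_drift_le (h0 : ∀ v, 0 ≤ g v) {p : ℝ} (hp : 3 / 2 < p) :
    ∑ i, ∫ v, partialDeriv i (fun w => g w ^ p) v * conv coulombKernel (pd i g) v
      ≤ driftConst * ∫ v, g v ^ (p + 1) := by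
  have ht := tendsto_finsetSum (Finset.univ : Finset (Fin 3)) fun i _ =>
    tendsto_integral_mul_conv coulombKernel_isKernel
      (fun n : ℕ => (regCoulomb_regKernel (ε := 1 / ((n : ℝ) + 1)) (by positivity)).toIsKernel)
      (fun z hz => regCoulomb_tendsto hz) (pd i g)
      ((partialDeriv_rpow_rapid h0 (by linarith : 1 / 2 < p) i).integrable
        (measurable_partialDeriv i _).aestronglyMeasurable)
  refine le_of_tendsto ht (Eventually.of_forall fun n => ?_)
  rw [sum_integral_regCoulomb (by positivity) h0 hp]
  exact integral_mul_conv_mollifier_le (by positivity) h0 hp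

end drift

/-! ### The L^p energy inequality -/

section dissipation

lemma norm_gradient (h : Vel → ℝ) (v : Vel) : ‖gradient h v‖ = ‖fderiv ℝ h v‖ := by
  simp [gradient]

lemma norm_gradient_sq (h : Vel → ℝ) (v : Vel) :
    ‖gradient h v‖ ^ 2 = ∑ i, partialDeriv i h v ^ 2 := by
  rw [EuclideanSpace.norm_sq_eq]
  refine Finset.sum_congr rfl fun i _ => ?_
  have h1 : inner ℝ (gradient h v) (EuclideanSpace.single i (1 : ℝ)) = partialDeriv i h v := by
    rw [gradient, InnerProductSpace.toDual_symm_apply, partialDeriv]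
  rw [EuclideanSpace.inner_single_right] at h1
  simp only [one_mul, conj_trivial] at h1
  rw [h1, Real.norm_eq_abs, sq_abs]

/-- The weighted Fisher-type dissipation density `⟨v⟩⁻³ |∇ g^{p/2}|²`. -/
def dissipation (p : ℝ) (g : Vel → ℝ) (v : Vel) : ℝ :=
  bracket v ^ (-3 : ℝ) * ‖gradient (fun w => g w ^ (p / 2)) v‖ ^ 2

lemma dissipation_nonneg (p : ℝ) (g : Vel → ℝ) (v : Vel) : 0 ≤ dissipation p g v :=
  mul_nonneg (Real.rpow_nonneg (bracket_pos v).le _) (sq_nonneg _)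

variable {g : 𝓢(Vel, ℝ)}

lemma integrable_dissipation (h0 : ∀ v, 0 ≤ g v) {p : ℝ} (hp : 3 / 2 < p) :
    Integrable (dissipation p g) := by
  have e : dissipation p g = fun v => bracket v ^ (-3 : ℝ)
      * ∑ i, partialDeriv i (fun w => g w ^ (p / 2)) v
        * partialDeriv i (fun w => g w ^ (p / 2)) v := by
    funext v
    rw [dissipation, norm_gradient_sq]
    simp only [sq]
  rw [e]
  refine ((bracket_rpow_poly _).mul_rapid (Rapid.sum fun i _ => ?_)).integrable ?_
  · exact (partialDeriv_rpow_rapid h0 (by linarith) i).mul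
      (partialDeriv_rpow_rapid h0 (by linarith) i)
  · refine ((bracket_rpow_continuous _).measurable.mul (Finset.measurable_fun_sum _ fun i _ =>
      (measurable_partialDeriv i _).mul (measurable_partialDeriv i _))).aestronglyMeasurable

/-- The `Lᵖ` energy inequality. -/
lemma integral_rpow_mul_collision_le (h0 : ∀ v, 0 ≤ g v) {p c : ℝ} (hp : 3 / 2 < p)
    (hA : ∀ v (ξ : Fin 3 → ℝ), c * bracket v ^ (-3 : ℝ) * ∑ i, ξ i ^ 2
      ≤ ∑ i, ∑ j, conv (landauKernel i j) g v * (ξ i * ξ j)) :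
    ∫ v, p * g v ^ (p - 1) * collision g v
      ≤ -(4 * (p - 1) / p * c * ∫ v, dissipation p g v)
        + (p - 1) * (driftConst * ∫ v, g v ^ (p + 1)) := by
  obtain ⟨L, hL⟩ := schwartz_nonnegC11 g h0
  have hq : 1 / 2 < p - 1 := by linarith
  have hdiff := hL.differentiable_rpow hq
  have hpoly := ((schwartz_rapid g).rpow h0 (by linarith : 0 < p - 1)).poly
  have hweak := integral_mul_collision g hdiff hpoly (partialDeriv_rpow_poly h0 hq)
  have hfi : ∀ i, Integrable fun v => partialDeriv i (fun x => g x ^ (p - 1)) v * flux g i v :=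
    fun i => ((partialDeriv_rpow_poly h0 hq i).mul_rapid (flux_rapid g i)).integrable
      ((measurable_partialDeriv i _).mul
        (flux_differentiable g i).continuous.measurable).aestronglyMeasurable
  have hdi : ∀ i, Integrable fun v =>
      partialDeriv i (fun w => g w ^ p) v * conv coulombKernel (pd i g) v := fun i =>
    ((partialDeriv_rpow_rapid h0 (by linarith) i).mul_poly
      (conv_poly coulombKernel_isKernel _)).integrable ((measurable_partialDeriv i _).mul
        (conv_continuous coulombKernel_isKernel _).measurable).aestronglyMeasurable
  have hDi := integrable_dissipation h0 hp
  have hp0 : 0 < p := by linarith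
  -- The pointwise form rests on p(p-1) g^{p-2}|∇g|² = (4(p-1)/p) |∇g^{p/2}|² and on p g ∇g^{p-1} =
  -- (p-1)∇g^p.
  have hpt : ∀ v, 4 * (p - 1) / p * c * dissipation p g v
      - (p - 1) * ∑ i, partialDeriv i (fun w => g w ^ p) v * conv coulombKernel (pd i g) v
      ≤ p * ∑ i, partialDeriv i (fun x => g x ^ (p - 1)) v * flux g i v := by
    intro v
    have hgv := h0 v
    have h1 : dissipation p g v
        = bracket v ^ (-3 : ℝ) * (p ^ 2 / 4 * g v ^ (p - 2) * ∑ i, pd i g v ^ 2) := by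
      rw [dissipation, norm_gradient_sq]
      congr 1
      rw [Finset.mul_sum]
      refine Finset.sum_congr rfl fun i _ => ?_
      rw [hL.partialDeriv_rpow (by linarith), pd_apply, mul_pow, mul_pow]
      congr 1
      rw [← Real.rpow_natCast (g v ^ (p / 2 - 1)), ← Real.rpow_mul hgv]
      rw [show (p / 2 - 1) * ((2 : ℕ) : ℝ) = p - 2 by push_cast; ring]
      ring
    have h2 : ∀ i, partialDeriv i (fun x => g x ^ (p - 1)) v
        = (p - 1) * g v ^ (p - 2) * pd i g v := fun i => by
      rw [hL.partialDeriv_rpow hq, pd_apply, show p - 1 - 1 = p - 2 by ring]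
    have h3 : ∀ i, partialDeriv i (fun x => g x ^ p) v
        = p * (g v ^ (p - 2) * g v) * pd i g v := fun i => by
      rw [hL.partialDeriv_rpow (by linarith), pd_apply]
      -- At a zero of g the gradient vanishes too, so the value given there to g^{p-2} with a
      -- possibly negative exponent is harmless.
      rcases hgv.eq_or_lt' with h | h
      · have : partialDeriv i g v = 0 := by
          rw [partialDeriv, hL.fderiv_eq_zero h]; rfl
        rw [this, mul_zero, mul_zero]
      · rw [← Real.rpow_add_one h.ne', show p - 2 + 1 = p - 1 by ring]
    have h4 := mul_le_mul_of_nonneg_left (hA v fun i => pd i g v)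
      (mul_nonneg (mul_nonneg hp0.le (by linarith : 0 ≤ p - 1)) (Real.rpow_nonneg hgv (p - 2)))
    have h5 : p * ∑ i, partialDeriv i (fun x => g x ^ (p - 1)) v * flux g i v
        = p * (p - 1) * g v ^ (p - 2)
            * (∑ i, ∑ j, conv (landauKernel i j) g v * (pd i g v * pd j g v))
          - (p - 1) * ∑ i, partialDeriv i (fun w => g w ^ p) v
            * conv coulombKernel (pd i g) v := by
      simp only [h2, h3, coe_flux, Fin.sum_univ_three]
      ring
    rw [h5, h1]
    refine sub_le_sub_right (le_trans (le_of_eq ?_) h4) _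
    field_simp
  have hsd := integrable_finsetSum (Finset.univ : Finset (Fin 3)) fun i _ => hdi i
  have hsf := integrable_finsetSum (Finset.univ : Finset (Fin 3)) fun i _ => hfi i
  have hInt := integral_mono
    ((hDi.const_mul (4 * (p - 1) / p * c)).sub
      (hsd.const_mul (p - 1)))
    (hsf.const_mul p) hpt
  rw [integral_sub' (hDi.const_mul _)
    (hsd.const_mul (p - 1)),
    integral_const_mul, integral_const_mul, integral_const_mul,
    integral_finsetSum _ fun i _ => hdi i, integral_finsetSum _ fun i _ => hfi i] at hInt
  have hdrift := mul_le_mul_of_nonneg_left (sum_integral_drift_le h0 hp)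
    (by linarith : 0 ≤ p - 1)
  simp only [mul_assoc p]
  rw [integral_const_mul, hweak]
  linarith

end dissipation

/-! ### Lower bound for the diffusion matrix -/

section coercivity

/-- The part of a ball of radius `R` that lies in a slab of width `2δ` orthogonal to `e`. -/
def slab (e v : Vel) (R δ : ℝ) : Set Vel := {w | ‖w‖ ≤ R ∧ |inner ℝ e (v - w)| < δ}

lemma measurableSet_slab (e v : Vel) (R δ : ℝ) : MeasurableSet (slab e v R δ) := by
  have h : Continuous fun w : Vel => |inner ℝ e (v - w)| := by fun_prop
  exact (measurableSet_le measurable_norm measurable_const).inter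
    (measurableSet_lt h.measurable measurable_const)

/-- In the orthonormal coordinates of b the slab lies in a box with sides 2R, 2δ and 2R. The bound
depends neither on v nor on the direction. -/
lemma volume_slab_le (b : OrthonormalBasis (Fin 3) ℝ Vel) (v : Vel) {R δ : ℝ} (hR : 0 ≤ R)
    (hδ : 0 ≤ δ) : volume (slab (b 1) v R δ) ≤ ENNReal.ofReal (8 * δ * R ^ 2) := by
  set c := inner ℝ (b 1) v with hc
  set I : Fin 3 → Set ℝ := ![Icc (-R) R, Icc (c - δ) (c + δ), Icc (-R) R] with hI
  have hmeas : MeasurableSet (univ.pi I) := by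
    refine MeasurableSet.univ_pi fun i => ?_
    fin_cases i <;> exact measurableSet_Icc
  have hmp := (EuclideanSpace.volume_preserving_symm_measurableEquiv_toLp (Fin 3)).comp
    b.measurePreserving_repr
  have hsub : slab (b 1) v R δ ⊆
      (⇑(MeasurableEquiv.toLp 2 (Fin 3 → ℝ)).symm ∘ ⇑b.repr) ⁻¹' univ.pi I := by
    rintro w ⟨hw, hs⟩ i -
    have hcoord : ∀ j, |inner ℝ (b j) w| ≤ R := fun j =>
      (abs_real_inner_le_norm _ _).trans (by rw [b.orthonormal.1 j, one_mul]; exact hw)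
    have hval : (⇑(MeasurableEquiv.toLp 2 (Fin 3 → ℝ)).symm ∘ ⇑b.repr) w i
        = inner ℝ (b i) w := by
      simp [b.repr_apply_apply]
    rw [hval]
    rw [inner_sub_right, ← hc, abs_lt] at hs
    fin_cases i
    · exact abs_le.mp (hcoord 0)
    · exact ⟨by simp; linarith [hs.2], by simp; linarith [hs.1]⟩
    · exact abs_le.mp (hcoord 2)
  refine (measure_mono hsub).trans ?_
  rw [hmp.measure_preimage hmeas.nullMeasurableSet, volume_pi_pi, Fin.prod_univ_three]
  simp only [hI, Matrix.cons_val_zero, Matrix.cons_val_one, Matrix.cons_val, Real.volume_Icc]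
  rw [← ENNReal.ofReal_mul (by linarith), ← ENNReal.ofReal_mul (by nlinarith)]
  exact ENNReal.ofReal_le_ofReal (by nlinarith)

lemma quadratic_proj (z : Vel) (ξ : Fin 3 → ℝ) : ∑ i, ∑ j, landauKernel i j z * (ξ i * ξ j)
    = ((∑ i, ξ i ^ 2) - (inner ℝ z (WithLp.toLp 2 ξ : Vel)) ^ 2 / ‖z‖ ^ 2)
      / (8 * Real.pi * ‖z‖) := by
  simp only [landauKernel, proj, Matrix.of_apply, PiLp.inner_apply, Fin.sum_univ_three,
    RCLike.inner_apply, conj_trivial]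
  simp
  ring

lemma exists_orthonormalBasis_zero {e : Vel} (he : ‖e‖ = 1) :
    ∃ b : OrthonormalBasis (Fin 3) ℝ Vel, b 0 = e := by
  have ho : Orthonormal ℝ (({0} : Set (Fin 3)).domRestrict fun _ => e) := by
    rw [orthonormal_iff_ite]
    rintro ⟨i, hi⟩ ⟨j, hj⟩
    simp only [mem_singleton_iff] at hi hj
    subst hi hj
    simp [domRestrict, he]
  obtain ⟨b, hb⟩ := ho.exists_orthonormalBasis_extension_of_card_eq (by simp)
  exact ⟨b, hb 0 rfl⟩

/-- The quadratic form of `Π(z) / (8π|z|)` is bounded below in a direction orthogonal to `ξ`. -/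
lemma exists_le_quadratic (ξ : Fin 3 → ℝ) : ∃ b : OrthonormalBasis (Fin 3) ℝ Vel, ∀ z : Vel,
    (∑ i, ξ i ^ 2) * inner ℝ (b 1) z ^ 2 / (8 * Real.pi * ‖z‖ ^ 3)
      ≤ ∑ i, ∑ j, landauKernel i j z * (ξ i * ξ j) := by
  set x : Vel := WithLp.toLp 2 ξ with hx
  have hxs : ∑ i, ξ i ^ 2 = ‖x‖ ^ 2 := by
    rw [EuclideanSpace.norm_sq_eq]; simp [hx]
  -- With the first basis vector along ξ, |ξ|²|z|² - (ξ·z)² is |ξ|² times the sum of the squares of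
  -- the other two coordinates of z, of which one is kept.
  obtain ⟨b, hb⟩ : ∃ b : OrthonormalBasis (Fin 3) ℝ Vel, ‖x‖ • b 0 = x := by
    by_cases h : x = 0
    · obtain ⟨b, -⟩ := exists_orthonormalBasis_zero (norm_single 0)
      exact ⟨b, by simp [h]⟩
    · obtain ⟨b, hb⟩ := exists_orthonormalBasis_zero (e := ‖x‖⁻¹ • x)
        (by rw [norm_smul, norm_inv, norm_norm, inv_mul_cancel₀ (norm_ne_zero_iff.mpr h)])
      refine ⟨b, ?_⟩
      rw [hb, smul_smul, mul_inv_cancel₀ (norm_ne_zero_iff.mpr h), one_smul]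
  refine ⟨b, fun z => ?_⟩
  rw [quadratic_proj, hxs, ← hx]
  rcases eq_or_ne z 0 with rfl | hz
  · simp
  have hn : 0 < ‖z‖ := norm_pos_iff.mpr hz
  have hpi := Real.pi_pos
  have hz2 : ‖z‖ ^ 2 = inner ℝ (b 0) z ^ 2 + inner ℝ (b 1) z ^ 2 + inner ℝ (b 2) z ^ 2 := by
    rw [← b.sum_sq_norm_inner_right z, Fin.sum_univ_three]
    simp
  have hin : inner ℝ z x = ‖x‖ * inner ℝ (b 0) z := by
    rw [← hb, inner_smul_right, norm_smul, b.orthonormal.1 0, norm_norm, mul_one,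
      real_inner_comm]
  rw [hin]
  have e : (‖x‖ ^ 2 - (‖x‖ * inner ℝ (b 0) z) ^ 2 / ‖z‖ ^ 2) / (8 * Real.pi * ‖z‖)
      = ‖x‖ ^ 2 * (‖z‖ ^ 2 - inner ℝ (b 0) z ^ 2) / (8 * Real.pi * ‖z‖ ^ 3) := by
    field_simp
  rw [e]
  gcongr
  nlinarith [sq_nonneg (inner ℝ (b 2) z)]

/-- Splitting at the level lam shows that a function bounded in L^p cannot concentrate on a small
set: its mass there is at most lam times the volume plus lam^{1-p} ∫ g^p. -/
lemma le_add_rpow {x lam p : ℝ} (hx : 0 ≤ x) (hlam : 0 < lam) (hp : 1 < p) :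
    x ≤ lam + lam ^ (1 - p) * x ^ p := by
  have hnn : 0 ≤ lam ^ (1 - p) * x ^ p := by positivity
  rcases le_total x lam with h | h
  · linarith
  · have hx' : 0 < x := hlam.trans_le h
    have h1 : x ^ p = x ^ (p - 1) * x := by
      rw [← Real.rpow_add_one hx'.ne']; ring_nf
    have h2 : 1 ≤ lam ^ (1 - p) * x ^ (p - 1) := by
      rw [show (1 - p) = -(p - 1) by ring, Real.rpow_neg hlam.le, ← div_eq_inv_mul,
        one_le_div (by positivity)]
      exact Real.rpow_le_rpow hlam.le h (by linarith)
    rw [h1, ← mul_assoc]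
    nlinarith

/-- Uniform ellipticity of `A[g]` from bounds on mass, energy and `Lᵖ` norm. -/
lemma exists_coercivity {p : ℝ} (hp : 1 < p) (M K : ℝ) : ∃ c : ℝ, 0 < c ∧
    ∀ g : 𝓢(Vel, ℝ), (∀ v, 0 ≤ g v) → ∫ v, g v = 1 → ∫ v, ‖v‖ ^ 2 * g v ≤ M →
      ∫ v, g v ^ p ≤ K → ∀ v (ξ : Fin 3 → ℝ), c * bracket v ^ (-3 : ℝ) * ∑ i, ξ i ^ 2
        ≤ ∑ i, ∑ j, conv (landauKernel i j) g v * (ξ i * ξ j) := by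
  have hpi := Real.pi_pos
  -- Each parameter costs at most a quarter of the unit mass: R bounds the mass outside the ball by
  -- M/R², lam makes lam^{1-p} K ≤ 1/4, and δ makes lam·8δR² = 1/4. A quarter remains in the ball
  -- off the slab.
  set R : ℝ := 1 + 4 * |M| with hR
  have hR1 : 1 ≤ R := by rw [hR]; linarith [abs_nonneg M]
  set lam : ℝ := (4 * |K| + 1) ^ (1 / (p - 1)) with hlam
  have hlam0 : 0 < lam := by positivity
  have hlamp : lam ^ (1 - p) = (4 * |K| + 1)⁻¹ := by
    rw [hlam, ← Real.rpow_mul (by positivity), ← Real.rpow_neg_one]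
    congr 1
    have : p - 1 ≠ 0 := by linarith
    field_simp
    ring
  set δ : ℝ := 1 / (32 * lam * R ^ 2) with hδ
  have hδ0 : 0 < δ := by positivity
  refine ⟨δ ^ 2 / (8 * Real.pi * (2 * R) ^ 3) / 4, by positivity, ?_⟩
  intro g h0 hmass hen hLp v ξ
  obtain ⟨b, hb⟩ := exists_le_quadratic ξ
  set X := ∑ i, ξ i ^ 2 with hX
  have hX0 : 0 ≤ X := Finset.sum_nonneg fun i _ => sq_nonneg _
  set a := X * δ ^ 2 / (8 * Real.pi * (2 * R * bracket v) ^ 3) with ha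
  have hbv := bracket_pos v
  have ha0 : 0 ≤ a := by positivity
  set S := slab (b 1) v R δ with hS
  have hSm : MeasurableSet S := measurableSet_slab _ _ _ _
  have hSv := volume_slab_le b v (by linarith : 0 ≤ R) hδ0.le
  have hSr : volume.real S ≤ 8 * δ * R ^ 2 := ENNReal.toReal_le_of_le_ofReal (by positivity) hSv
  have hSf : volume S ≠ ⊤ := (hSv.trans_lt ENNReal.ofReal_lt_top).ne
  have hgi := (schwartz_rapid g).integrable g.continuous.aestronglyMeasurable
  have hgp := integrable_rpow h0 (by linarith : 0 < p)
  have hg2 : Integrable fun w => ‖w‖ ^ 2 * g w := by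
    refine (Poly.mul_rapid ⟨2, 1, zero_le_one, fun v => ?_⟩ (schwartz_rapid g)).integrable
      ((by fun_prop : Continuous fun w : Vel => ‖w‖ ^ 2).mul g.continuous).aestronglyMeasurable
    rw [abs_of_nonneg (by positivity), one_mul]
    gcongr
    simp
  have hSi : Integrable (S.indicator fun _ => lam) :=
    (integrable_indicator_iff hSm).mpr (integrableOn_const hSf)
  have hQi : Integrable fun w => (∑ i, ∑ j, landauKernel i j (v - w) * (ξ i * ξ j)) * g w := by
    have : ∀ i j, Integrable fun w => landauKernel i j (v - w) * (ξ i * ξ j) * g w := fun i j => by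
      simpa only [mul_right_comm] using (integrable_conv (landauKernel_isKernel i j)
        (schwartz_rapid g) g.continuous.measurable v).mul_const (ξ i * ξ j)
    simp only [Finset.sum_mul]
    exact integrable_finsetSum _ fun i _ => integrable_finsetSum _ fun j _ => this i j
  have hQ : ∑ i, ∑ j, conv (landauKernel i j) g v * (ξ i * ξ j)
      = ∫ w, (∑ i, ∑ j, landauKernel i j (v - w) * (ξ i * ξ j)) * g w := by
    have h1 : ∀ i j, Integrable fun w => landauKernel i j (v - w) * g w * (ξ i * ξ j) :=
      fun i j => (integrable_conv (landauKernel_isKernel i j)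
        (schwartz_rapid g) g.continuous.measurable v).mul_const (ξ i * ξ j)
    simp only [conv, ← integral_mul_const]
    simp_rw [fun i => (integral_finsetSum (Finset.univ : Finset (Fin 3)) fun j _ => h1 i j).symm]
    rw [← integral_finsetSum _ fun i _ => integrable_finsetSum _ fun j _ => h1 i j]
    refine integral_congr_ae (ae_of_all _ fun w => ?_)
    simp only [Finset.sum_mul]
    exact Finset.sum_congr rfl fun i _ => Finset.sum_congr rfl fun j _ => by ring
  -- This function lies below g and is nonpositive outside the ball and inside the slab. On the
  -- remaining set |v-w| ≤ 2R⟨v⟩ and the coordinate along `b 1` is at least δ, which gives the lower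
  -- bound a for the quadratic form.
  set low : Vel → ℝ := fun w =>
    g w - R⁻¹ ^ 2 * (‖w‖ ^ 2 * g w) - S.indicator (fun _ => lam) w - lam ^ (1 - p) * g w ^ p
    with hlow
  have hlowi : Integrable low := ((hgi.sub (hg2.const_mul _)).sub hSi).sub (hgp.const_mul _)
  have hpt : ∀ w, a * low w ≤ (∑ i, ∑ j, landauKernel i j (v - w) * (ξ i * ξ j)) * g w := by
    intro w
    have hgw := h0 w
    have hgpw : 0 ≤ lam ^ (1 - p) * g w ^ p := by positivity
    have hind : 0 ≤ S.indicator (fun _ => lam) w := indicator_nonneg (fun _ _ => hlam0.le) w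
    have hq := hb (v - w)
    have hq0 : 0 ≤ ∑ i, ∑ j, landauKernel i j (v - w) * (ξ i * ξ j) :=
      le_trans (by positivity) hq
    have h2g : 0 ≤ R⁻¹ ^ 2 * (‖w‖ ^ 2 * g w) := by positivity
    by_cases hwR : ‖w‖ ≤ R
    · by_cases hwS : |inner ℝ (b 1) (v - w)| < δ
      · refine (mul_nonpos_of_nonneg_of_nonpos ha0 ?_).trans (mul_nonneg hq0 hgw)
        have : S.indicator (fun _ => lam) w = lam :=
          indicator_of_mem (show w ∈ slab (b 1) v R δ from ⟨hwR, hwS⟩) _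
        simp only [hlow, this]
        linarith [le_add_rpow hgw hlam0 hp]
      · push Not at hwS
        have hlg : low w ≤ g w := by simp only [hlow]; linarith
        refine (mul_le_mul_of_nonneg_left hlg ha0).trans (mul_le_mul_of_nonneg_right ?_ hgw)
        refine le_trans ?_ hq
        have hz : 0 < ‖v - w‖ := by
          refine norm_pos_iff.mpr fun h => ?_
          rw [h, inner_zero_right, abs_zero] at hwS
          linarith
        have hzle : ‖v - w‖ ≤ 2 * R * bracket v := by
          have h1 := norm_sub_le v w
          have h2 := norm_le_bracket v
          have h3 := one_le_bracket v
          nlinarith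
        have hsq : δ ^ 2 ≤ inner ℝ (b 1) (v - w) ^ 2 := by
          rw [← sq_abs (inner ℝ (b 1) (v - w))]
          exact pow_le_pow_left₀ hδ0.le hwS 2
        rw [ha]
        gcongr
    · push Not at hwR
      refine (mul_nonpos_of_nonneg_of_nonpos ha0 ?_).trans (mul_nonneg hq0 hgw)
      have h1 : 1 ≤ R⁻¹ ^ 2 * ‖w‖ ^ 2 := by
        rw [← mul_pow, ← div_eq_inv_mul]
        exact one_le_pow₀ ((one_le_div (by linarith)).mpr hwR.le)
      have h2 : g w ≤ R⁻¹ ^ 2 * (‖w‖ ^ 2 * g w) := by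
        rw [← mul_assoc]; exact le_mul_of_one_le_left hgw h1
      simp only [hlow]
      linarith
  have hlowint : 1 / 4 ≤ ∫ w, low w := by
    have e : ∫ w, low w = 1 - R⁻¹ ^ 2 * (∫ w, ‖w‖ ^ 2 * g w) - volume.real S * lam
        - lam ^ (1 - p) * ∫ w, g w ^ p := by
      have h1 := hg2.const_mul (R⁻¹ ^ 2)
      have h2 := hgp.const_mul (lam ^ (1 - p))
      change ∫ w, (((⇑g - fun w => R⁻¹ ^ 2 * (‖w‖ ^ 2 * g w)) - S.indicator fun _ => lam)
        - fun w => lam ^ (1 - p) * g w ^ p) w = _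
      rw [integral_sub' ((hgi.sub h1).sub hSi) h2, integral_sub' (hgi.sub h1) hSi,
        integral_sub' hgi h1, hmass, integral_const_mul, integral_const_mul,
        integral_indicator_const _ hSm, smul_eq_mul]
    have h1 : R⁻¹ ^ 2 * (∫ w, ‖w‖ ^ 2 * g w) ≤ 1 / 4 := by
      have hM : ∫ w, ‖w‖ ^ 2 * g w ≤ |M| := hen.trans (le_abs_self M)
      rw [inv_pow, inv_mul_le_iff₀ (by positivity)]
      nlinarith
    have h2 : volume.real S * lam ≤ 1 / 4 := by
      calc volume.real S * lam ≤ 8 * δ * R ^ 2 * lam := by gcongr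
        _ = 1 / 4 := by
          rw [hδ]
          have : R ≠ 0 := by positivity
          field_simp
          norm_num
    have h3 : lam ^ (1 - p) * ∫ w, g w ^ p ≤ 1 / 4 := by
      rw [hlamp, inv_mul_le_iff₀ (by positivity)]
      linarith [hLp.trans (le_abs_self K)]
    rw [e]
    linarith
  rw [hQ]
  refine le_trans ?_ ((integral_mono (hlowi.const_mul a) hQi hpt))
  rw [integral_const_mul]
  refine le_trans (le_of_eq ?_) (mul_le_mul_of_nonneg_left hlowint ha0)
  rw [Real.rpow_neg hbv.le, ha, show (3 : ℝ) = ((3 : ℕ) : ℝ) by norm_num, Real.rpow_natCast]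
  have : R ≠ 0 := by positivity
  field_simp

end coercivity

/-! ### Sobolev inequality on the whole space -/

section sobolev

lemma sobolev_compact {u : Vel → ℝ} (hu : ContDiff ℝ 1 u) (hc : HasCompactSupport u) :
    ∫ v, u v ^ 6 ≤ (SNormLESNormFDerivOfEqConst ℝ (volume : Measure Vel) 2 : ℝ) ^ 6
      * (∫ v, ‖fderiv ℝ u v‖ ^ 2) ^ 3 := by
  set S := SNormLESNormFDerivOfEqConst ℝ (volume : Measure Vel) 2 with hS
  have h := eLpNorm_le_eLpNorm_fderiv_of_eq (volume : Measure Vel) (p := 2) (p' := 6) hu hc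
    (by norm_num) (by simp) (by simp; norm_num)
  have hm1 : MemLp u 6 volume := hu.continuous.memLp_of_hasCompactSupport hc
  have hm2 : MemLp (fderiv ℝ u) 2 volume :=
    (hu.continuous_fderiv (by norm_num)).memLp_of_hasCompactSupport (hc.fderiv ℝ)
  have e1 := hm1.eLpNorm_eq_integral_rpow_norm (by norm_num) (by norm_num)
  have e2 := hm2.eLpNorm_eq_integral_rpow_norm (by norm_num) (by norm_num)
  have h' : eLpNorm u 6 volume ≤ S * eLpNorm (fderiv ℝ u) 2 volume := h
  rw [e1, e2, ← ENNReal.ofReal_coe_nnreal, ← ENNReal.ofReal_mul (by positivity),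
    ENNReal.ofReal_le_ofReal_iff (by positivity)] at h'
  simp only [ENNReal.toReal_ofNat] at h'
  have i1 : ∫ v, ‖u v‖ ^ (6 : ℝ) = ∫ v, u v ^ 6 := by
    refine integral_congr_ae (ae_of_all _ fun v => ?_)
    simp only
    rw [show (6 : ℝ) = ((6 : ℕ) : ℝ) by norm_num, Real.rpow_natCast, Real.norm_eq_abs,
      Even.pow_abs (by decide)]
  have i2 : ∫ v, ‖fderiv ℝ u v‖ ^ (2 : ℝ) = ∫ v, ‖fderiv ℝ u v‖ ^ 2 := by
    simp only [Real.rpow_two]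
  rw [i1, i2] at h'
  have hX : 0 ≤ ∫ v, u v ^ 6 := integral_nonneg fun v => by positivity
  have hY : 0 ≤ ∫ v, ‖fderiv ℝ u v‖ ^ 2 := integral_nonneg fun v => by positivity
  have h6 := pow_le_pow_left₀ (by positivity) h' 6
  rw [mul_pow] at h6
  have r1 : ((∫ v, u v ^ 6) ^ (6 : ℝ)⁻¹) ^ 6 = ∫ v, u v ^ 6 := by
    rw [← Real.rpow_natCast, ← Real.rpow_mul hX]
    norm_num
  have r2 : ((∫ v, ‖fderiv ℝ u v‖ ^ 2) ^ (2 : ℝ)⁻¹) ^ 6 = (∫ v, ‖fderiv ℝ u v‖ ^ 2) ^ 3 := by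
    rw [← Real.rpow_natCast, ← Real.rpow_mul hY, ← Real.rpow_natCast]
    norm_num
  rwa [r1, r2] at h6

/-- The Sobolev inequality `H¹ ⊂ L⁶` without compact support. -/
lemma exists_sobolev : ∃ C : ℝ, 0 ≤ C ∧ ∀ u : Vel → ℝ, ContDiff ℝ 1 u →
    Integrable (fun v => u v ^ 2) → Integrable (fun v => ‖fderiv ℝ u v‖ ^ 2) →
    Integrable (fun v => u v ^ 6) →
    ∫ v, u v ^ 6 ≤ C * ((∫ v, ‖fderiv ℝ u v‖ ^ 2) + ∫ v, u v ^ 2) ^ 3 := by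
  set χ : ContDiffBump (0 : Vel) := ⟨1, 2, one_pos, one_lt_two⟩ with hχ
  have hχc : ContDiff ℝ 1 χ := χ.contDiff
  obtain ⟨B, hB⟩ := (hχc.continuous_fderiv (by norm_num)).bounded_above_of_compact_support
    (χ.hasCompactSupport.fderiv ℝ)
  have hB0 : 0 ≤ B := (norm_nonneg _).trans (hB 0)
  set S := SNormLESNormFDerivOfEqConst ℝ (volume : Measure Vel) 2 with hS
  refine ⟨(S : ℝ) ^ 6 * (2 + 2 * B ^ 2) ^ 3, by positivity, fun u hu h2 hd h6 => ?_⟩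
  -- The cutoffs χ(v/(n+1)) tend to 1 and have gradients bounded by B uniformly in n. The L² term on
  -- the right of the inequality pays for these gradients.
  set a : ℕ → ℝ := fun n => 1 / ((n : ℝ) + 1) with ha
  have ha0 : ∀ n, 0 < a n := fun n => by simp only [ha]; positivity
  have ha1 : ∀ n, a n ≤ 1 := fun n => by
    simp only [ha]
    rw [div_le_one (by positivity)]
    linarith [(Nat.cast_nonneg n : (0 : ℝ) ≤ n)]
  set w : ℕ → Vel → ℝ := fun n v => χ (a n • v) * u v with hw
  have hχn : ∀ n, ContDiff ℝ 1 fun v : Vel => χ (a n • v) := fun n =>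
    hχc.comp (contDiff_const_smul (a n))
  have hwc : ∀ n, ContDiff ℝ 1 (w n) := fun n => (hχn n).mul hu
  have hws : ∀ n, HasCompactSupport (w n) := fun n =>
    (χ.hasCompactSupport.comp_smul (ha0 n).ne').mul_right
  have hχ1 : ∀ x, |χ x| ≤ 1 := fun x => by
    rw [abs_of_nonneg χ.nonneg]; exact χ.le_one
  have hχd : ∀ n v, ‖fderiv ℝ (fun v : Vel => χ (a n • v)) v‖ ≤ B := by
    intro n v
    have h1 : HasFDerivAt (fun v : Vel => χ (a n • v))
        ((fderiv ℝ χ (a n • v)).comp (a n • ContinuousLinearMap.id ℝ Vel)) v :=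
      ((hχc.differentiable (by norm_num)) (a n • v)).hasFDerivAt.comp v
        ((hasFDerivAt_id v).const_smul (a n))
    rw [h1.fderiv]
    refine (ContinuousLinearMap.opNorm_comp_le _ _).trans ?_
    rw [norm_smul, Real.norm_of_nonneg (ha0 n).le]
    calc ‖fderiv ℝ χ (a n • v)‖ * (a n * ‖ContinuousLinearMap.id ℝ Vel‖)
        ≤ B * (1 * 1) := by
          have := ha0 n
          gcongr
          · exact hB _
          · exact ha1 n
          · exact ContinuousLinearMap.norm_id_le
      _ = B := by ring
  have hwd : ∀ n v, ‖fderiv ℝ (w n) v‖ ^ 2 ≤ 2 * ‖fderiv ℝ u v‖ ^ 2 + 2 * B ^ 2 * u v ^ 2 := by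
    intro n v
    have h1 : ‖fderiv ℝ (w n) v‖ ≤ ‖fderiv ℝ u v‖ + B * |u v| := by
      rw [hw, fderiv_fun_mul ((hχn n).differentiable (by norm_num) v)
        (hu.differentiable (by norm_num) v)]
      refine (norm_add_le _ _).trans ?_
      rw [norm_smul, norm_smul, Real.norm_eq_abs, Real.norm_eq_abs, mul_comm |u v|]
      exact add_le_add (mul_le_of_le_one_left (norm_nonneg _) (hχ1 _))
        (mul_le_mul_of_nonneg_right (hχd n v) (abs_nonneg _))
    calc ‖fderiv ℝ (w n) v‖ ^ 2 ≤ (‖fderiv ℝ u v‖ + B * |u v|) ^ 2 := by gcongr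
      _ ≤ 2 * ‖fderiv ℝ u v‖ ^ 2 + 2 * (B * |u v|) ^ 2 := by
          nlinarith [sq_nonneg (‖fderiv ℝ u v‖ - B * |u v|)]
      _ = _ := by rw [mul_pow, sq_abs]; ring
  have hbound : ∀ n, ∫ v, w n v ^ 6
      ≤ (S : ℝ) ^ 6 * (2 + 2 * B ^ 2) ^ 3 * ((∫ v, ‖fderiv ℝ u v‖ ^ 2) + ∫ v, u v ^ 2) ^ 3 := by
    intro n
    refine (sobolev_compact (hwc n) (hws n)).trans ?_
    rw [mul_assoc, ← mul_pow]
    refine mul_le_mul_of_nonneg_left (pow_le_pow_left₀ (integral_nonneg fun v => by positivity)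
      ?_ 3) (by positivity)
    have hii := (hd.const_mul 2).add (h2.const_mul (2 * B ^ 2))
    refine (integral_mono_of_nonneg (ae_of_all _ fun v => by positivity) hii
      (ae_of_all _ (hwd n))).trans ?_
    rw [integral_add' (hd.const_mul 2) (h2.const_mul (2 * B ^ 2)), integral_const_mul,
      integral_const_mul]
    have i1 : 0 ≤ ∫ v, ‖fderiv ℝ u v‖ ^ 2 := integral_nonneg fun v => by positivity
    have i2 : 0 ≤ ∫ v, u v ^ 2 := integral_nonneg fun v => by positivity
    nlinarith [mul_nonneg (sq_nonneg B) i1]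
  have hlim : Tendsto (fun n => ∫ v, w n v ^ 6) atTop (𝓝 (∫ v, u v ^ 6)) := by
    refine tendsto_integral_of_dominated_convergence (fun v => u v ^ 6)
      (fun n => ((hwc n).continuous.pow 6).aestronglyMeasurable) h6
      (fun n => ae_of_all _ fun v => ?_) (ae_of_all _ fun v => ?_)
    · rw [Real.norm_of_nonneg (by positivity), hw, mul_pow]
      refine mul_le_of_le_one_left (by positivity) ?_
      exact pow_le_one₀ χ.nonneg χ.le_one
    · have h0 : Tendsto (fun n => a n • v) atTop (𝓝 0) := by
        simpa [ha] using (tendsto_one_div_add_atTop_nhds_zero_nat (𝕜 := ℝ)).smul_const v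
      have h1 := (hχc.continuous.tendsto 0).comp h0
      rw [χ.one_of_mem_closedBall (by simp [χ.rIn_pos.le])] at h1
      simpa using (h1.mul_const (u v)).pow 6
  exact le_of_tendsto hlim (Eventually.of_forall hbound)

end sobolev

/-! ### Absorbing the drift into the dissipation -/

section interpolation

/-- Hölder's inequality for three nonnegative functions. -/
lemma integral_rpow_mul_rpow_mul_rpow_le {a b c : Vel → ℝ} (ha : ∀ v, 0 ≤ a v)
    (hb : ∀ v, 0 ≤ b v) (hc : ∀ v, 0 ≤ c v) (ia : Integrable a) (ib : Integrable b)
    (ic : Integrable c) {s t r : ℝ} (hs : 0 ≤ s) (ht : 0 ≤ t) (hr : 0 ≤ r) (hsum : s + t + r = 1) :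
    ∫ v, a v ^ s * b v ^ t * c v ^ r ≤ (∫ v, a v) ^ s * (∫ v, b v) ^ t * (∫ v, c v) ^ r := by
  have h := ENNReal.lintegral_prod_norm_pow_le (μ := (volume : Measure Vel))
    (Finset.univ : Finset (Fin 3))
    (f := ![fun v => ENNReal.ofReal (a v), fun v => ENNReal.ofReal (b v),
      fun v => ENNReal.ofReal (c v)]) (p := ![s, t, r])
    (by
      intro i _
      fin_cases i
      · exact ia.1.aemeasurable.ennreal_ofReal
      · exact ib.1.aemeasurable.ennreal_ofReal
      · exact ic.1.aemeasurable.ennreal_ofReal)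
    (by simp [Fin.sum_univ_three, hsum])
    (by intro i _; fin_cases i <;> simpa)
  simp only [Fin.prod_univ_three, Matrix.cons_val_zero, Matrix.cons_val_one, Matrix.cons_val]
    at h
  rw [← ofReal_integral_eq_lintegral_ofReal ia (ae_of_all _ ha),
    ← ofReal_integral_eq_lintegral_ofReal ib (ae_of_all _ hb),
    ← ofReal_integral_eq_lintegral_ofReal ic (ae_of_all _ hc)] at h
  have ja : 0 ≤ ∫ v, a v := integral_nonneg ha
  have jb : 0 ≤ ∫ v, b v := integral_nonneg hb
  have jc : 0 ≤ ∫ v, c v := integral_nonneg hc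
  rw [ENNReal.ofReal_rpow_of_nonneg ja hs, ENNReal.ofReal_rpow_of_nonneg jb ht,
    ENNReal.ofReal_rpow_of_nonneg jc hr, ← ENNReal.ofReal_mul (by positivity),
    ← ENNReal.ofReal_mul (by positivity)] at h
  have e : ∀ v, ENNReal.ofReal (a v) ^ s * ENNReal.ofReal (b v) ^ t * ENNReal.ofReal (c v) ^ r
      = ENNReal.ofReal (a v ^ s * b v ^ t * c v ^ r) := fun v => by
    rw [ENNReal.ofReal_rpow_of_nonneg (ha v) hs, ENNReal.ofReal_rpow_of_nonneg (hb v) ht,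
      ENNReal.ofReal_rpow_of_nonneg (hc v) hr,
      ← ENNReal.ofReal_mul (Real.rpow_nonneg (ha v) s),
      ← ENNReal.ofReal_mul (mul_nonneg (Real.rpow_nonneg (ha v) s) (Real.rpow_nonneg (hb v) t))]
  simp only [e] at h
  have hmeas : AEStronglyMeasurable (fun v => a v ^ s * b v ^ t * c v ^ r) volume :=
    (((ia.1.aemeasurable.pow_const s).mul (ib.1.aemeasurable.pow_const t)).mul
      (ic.1.aemeasurable.pow_const r)).aestronglyMeasurable
  have hnn : ∀ v, 0 ≤ a v ^ s * b v ^ t * c v ^ r := fun v =>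
    mul_nonneg (mul_nonneg (Real.rpow_nonneg (ha v) s) (Real.rpow_nonneg (hb v) t))
      (Real.rpow_nonneg (hc v) r)
  rw [integral_eq_lintegral_of_nonneg_ae (ae_of_all _ hnn) hmeas]
  exact ENNReal.toReal_le_of_le_ofReal (by positivity) h

/-- The threshold T is the point where Z^{a-1} = η: beyond it the power lies below ηZ, and before it
below T^a. -/
lemma exists_rpow_le_mul_add {a η : ℝ} (ha0 : 0 < a) (ha : a < 1) (hη : 0 < η) :
    ∃ C : ℝ, 0 ≤ C ∧ ∀ Z : ℝ, 0 ≤ Z → Z ^ a ≤ η * Z + C := by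
  set T := η ^ (1 / (a - 1)) with hT
  have hT0 : 0 < T := by positivity
  refine ⟨T ^ a, by positivity, fun Z hZ => ?_⟩
  rcases le_total Z T with h | h
  · have := Real.rpow_le_rpow hZ h ha0.le
    nlinarith
  · have hZ0 : 0 < Z := hT0.trans_le h
    have h1 : Z ^ (a - 1) ≤ T ^ (a - 1) :=
      Real.rpow_le_rpow_of_nonpos hT0 h (by linarith)
    have h2 : T ^ (a - 1) = η := by
      rw [hT, ← Real.rpow_mul hη.le, one_div_mul_cancel (by linarith), Real.rpow_one]
    have h3 : Z ^ a = Z ^ (a - 1) * Z := by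
      rw [← Real.rpow_add_one hZ0.ne']; ring_nf
    have hTa : 0 ≤ T ^ a := by positivity
    rw [h3]
    nlinarith

/-- The weighted Sobolev inequality for `⟨v⟩^{-3/2} g^{p/2}`. -/
lemma exists_weighted_sobolev {p : ℝ} (hp : 3 / 2 < p) : ∃ C : ℝ, 0 ≤ C ∧
    ∀ g : 𝓢(Vel, ℝ), (∀ v, 0 ≤ g v) →
      Integrable (fun v => bracket v ^ (-9 : ℝ) * g v ^ (3 * p)) ∧
      ∫ v, bracket v ^ (-9 : ℝ) * g v ^ (3 * p)
        ≤ C * (2 * (∫ v, dissipation p g v) + 6 * ∫ v, g v ^ p) ^ 3 := by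
  obtain ⟨C, hC, hS⟩ := exists_sobolev
  refine ⟨C, hC, fun g h0 => ?_⟩
  obtain ⟨L, hL⟩ := schwartz_nonnegC11 g h0
  have hbp : ∀ (v : Vel) (s : ℝ), 0 < bracket v ^ s := fun v s =>
    Real.rpow_pos_of_pos (bracket_pos v) s
  have hq : 1 / 2 < p / 2 := by linarith
  set h : Vel → ℝ := fun v => g v ^ (p / 2) with hh
  set β : Vel → ℝ := fun v => bracket v ^ (-(3 / 2) : ℝ) with hβ
  set u : Vel → ℝ := fun v => β v * h v with hu
  have hβd : ∀ v, HasFDerivAt β ((-(3 / 2) * bracket v ^ (-(3 / 2) - 2 : ℝ)) • innerSL ℝ v) v :=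
    bracket_rpow_hasFDerivAt (-(3 / 2))
  have hβc : ContDiff ℝ 1 β := by
    refine contDiff_one_iff_fderiv.mpr ⟨fun v => (hβd v).differentiableAt, ?_⟩
    rw [funext fun v => (hβd v).fderiv]
    exact ((bracket_rpow_continuous _).const_mul _).smul (innerSL ℝ).continuous
  have hhc : ContDiff ℝ 1 h := hL.contDiff_rpow hq
  have huc : ContDiff ℝ 1 u := hβc.mul hhc
  have hh2 : ∀ v, h v ^ 2 = g v ^ p := fun v => by
    rw [hh, ← Real.rpow_natCast, ← Real.rpow_mul (h0 v)]
    congr 1; push_cast; ring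
  have hβ2 : ∀ v, β v ^ 2 = bracket v ^ (-3 : ℝ) := fun v => by
    rw [hβ, ← Real.rpow_natCast, ← Real.rpow_mul (bracket_pos v).le]
    congr 1; push_cast; ring
  have hβ1 : ∀ v, bracket v ^ (-3 : ℝ) ≤ 1 := fun v =>
    Real.rpow_le_one_of_one_le_of_nonpos (one_le_bracket v) (by norm_num)
  have hβn : ∀ v, ‖fderiv ℝ β v‖ ≤ 3 / 2 := by
    intro v
    rw [(hβd v).fderiv, norm_smul, innerSL_apply_norm, Real.norm_eq_abs, abs_mul,
      abs_of_pos (hbp v _)]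
    have h1 : bracket v ^ (-(3 / 2) - 2 : ℝ) * ‖v‖ ≤ 1 := by
      calc bracket v ^ (-(3 / 2) - 2 : ℝ) * ‖v‖
          ≤ bracket v ^ (-(3 / 2) - 2 : ℝ) * bracket v :=
            mul_le_mul_of_nonneg_left (norm_le_bracket v) (hbp v _).le
        _ = bracket v ^ (-(3 / 2) - 2 + 1 : ℝ) := (Real.rpow_add_one (bracket_pos v).ne' _).symm
        _ ≤ 1 := Real.rpow_le_one_of_one_le_of_nonpos (one_le_bracket v) (by norm_num)
    rw [show |(-(3 / 2) : ℝ)| = 3 / 2 by rw [abs_neg, abs_of_pos (by norm_num)], mul_assoc]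
    linarith
  have hu2 : ∀ v, u v ^ 2 ≤ g v ^ p := fun v => by
    rw [hu, mul_pow, hh2, hβ2]
    exact mul_le_of_le_one_left (Real.rpow_nonneg (h0 v) p) (hβ1 v)
  -- The weight β has gradient at most 3/2, whence 9/2 = 2(3/2)². Adding ∫ u² ≤ ∫ g^p gives 11/2,
  -- rounded up to the 6 of the statement.
  have hud : ∀ v, ‖fderiv ℝ u v‖ ^ 2 ≤ 2 * dissipation p g v + 9 / 2 * g v ^ p := by
    intro v
    have hhv : 0 ≤ h v := Real.rpow_nonneg (h0 v) _
    have h1 : ‖fderiv ℝ u v‖ ≤ β v * ‖fderiv ℝ h v‖ + 3 / 2 * h v := by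
      rw [hu, fderiv_fun_mul (hβd v).differentiableAt (hhc.differentiable (by norm_num) v)]
      refine (norm_add_le _ _).trans ?_
      rw [norm_smul, norm_smul, Real.norm_of_nonneg (hbp v _).le, Real.norm_of_nonneg hhv,
        mul_comm (h v)]
      exact add_le_add le_rfl (mul_le_mul_of_nonneg_right (hβn v) hhv)
    calc ‖fderiv ℝ u v‖ ^ 2 ≤ (β v * ‖fderiv ℝ h v‖ + 3 / 2 * h v) ^ 2 := by gcongr
      _ ≤ 2 * (β v ^ 2 * ‖fderiv ℝ h v‖ ^ 2) + 9 / 2 * h v ^ 2 := by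
          nlinarith [sq_nonneg (β v * ‖fderiv ℝ h v‖ - 3 / 2 * h v)]
      _ = _ := by rw [hβ2, hh2, dissipation, norm_gradient]
  have hu6 : ∀ v, u v ^ 6 = bracket v ^ (-9 : ℝ) * g v ^ (3 * p) := fun v => by
    rw [hu, mul_pow, show β v ^ 6 = (β v ^ 2) ^ 3 by ring, show h v ^ 6 = (h v ^ 2) ^ 3 by ring,
      hβ2, hh2, ← Real.rpow_natCast, ← Real.rpow_natCast, ← Real.rpow_mul (bracket_pos v).le,
      ← Real.rpow_mul (h0 v)]
    congr 2
    · norm_num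
    · push_cast; ring
  have hgp := integrable_rpow h0 (by linarith : 0 < p)
  have hDi := integrable_dissipation h0 hp
  have i6 : Integrable fun v => bracket v ^ (-9 : ℝ) * g v ^ (3 * p) :=
    ((bracket_rpow_poly _).mul_rapid ((schwartz_rapid g).rpow h0 (by linarith))).integrable
      ((bracket_rpow_continuous _).mul (g.continuous.rpow_const
        fun _ => Or.inr (by linarith))).aestronglyMeasurable
  have i2 : Integrable fun v => u v ^ 2 :=
    hgp.mono' (huc.continuous.pow 2).aestronglyMeasurable (ae_of_all _ fun v => by
      rw [Real.norm_of_nonneg (by positivity)]; exact hu2 v)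
  have idd := (hDi.const_mul 2).add (hgp.const_mul (9 / 2))
  have id' : Integrable fun v => ‖fderiv ℝ u v‖ ^ 2 :=
    idd.mono' ((huc.continuous_fderiv (by norm_num)).norm.pow 2).aestronglyMeasurable
      (ae_of_all _ fun v => by
        rw [Real.norm_of_nonneg (by positivity)]; exact hud v)
  refine ⟨i6, ?_⟩
  have hmain := hS u huc i2 id' (i6.congr (ae_of_all _ fun v => (hu6 v).symm))
  simp only [hu6] at hmain
  refine hmain.trans (mul_le_mul_of_nonneg_left (pow_le_pow_left₀ (add_nonneg
    (integral_nonneg fun v => by positivity) (integral_nonneg fun v => by positivity)) ?_ 3) hC)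
  have m1 := integral_mono id' idd hud
  have m2 := integral_mono i2 hgp hu2
  rw [integral_add' (hDi.const_mul 2) (hgp.const_mul (9 / 2)), integral_const_mul,
    integral_const_mul] at m1
  have m3 : 0 ≤ ∫ v, g v ^ p := integral_nonneg fun v => Real.rpow_nonneg (h0 v) p
  linarith

/-- `∫ g^{p+1}` is absorbed by the dissipation. -/
lemma exists_interpolation {p m : ℝ} (hp : 3 / 2 < p) (hm : 9 / 2 * ((p - 1) / (p - 3 / 2)) < m)
    {M K η : ℝ} (hM : 0 ≤ M) (hK : 0 ≤ K) (hη : 0 < η) : ∃ C : ℝ, 0 ≤ C ∧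
    ∀ g : 𝓢(Vel, ℝ), (∀ v, 0 ≤ g v) → ∫ v, bracket v ^ m * g v ≤ M → ∫ v, g v ^ p ≤ K →
      ∫ v, g v ^ (p + 1) ≤ η * (∫ v, dissipation p g v) + C := by
  have hm1 : 9 * (p - 1) < m * (2 * p - 3) := by
    rw [← mul_div_assoc, div_lt_iff₀ (by linarith)] at hm
    linarith
  have hm0 : 0 < m := by
    by_contra hneg
    push Not at hneg
    nlinarith
  -- The exponents solve s + t + r = 1, 3ps + t + pr = p + 1 (power of g) and -9s + mt = 0 (power of
  -- the bracket). The dissipation will enter with power 3s, and 3s < 1 means 9(p-1) < m(2p-3),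
  -- which is the hypothesis on m.
  set d := 2 * p * m - 9 * (p - 1) with hd
  have hd3 : 3 * m < d := by rw [hd]; linarith
  have hd0 : 0 < d := by linarith
  set s := m / d with hs
  set t := 9 / d with ht
  set r := 1 - s - t with hr
  have hs0 : 0 < s := by positivity
  have ht0 : 0 < t := by positivity
  have hs3 : 3 * s < 1 := by
    rw [hs, ← mul_div_assoc, div_lt_one hd0]; exact hd3
  have hr0 : 0 ≤ r := by
    have : s + t ≤ 1 := by
      rw [hs, ht, ← add_div, div_le_one hd0, hd]
      nlinarith
    linarith
  have hpow1 : 3 * p * s + t + p * r = p + 1 := by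
    rw [hr, hs, ht]
    field_simp
    rw [hd]
    ring
  have hpow2 : -9 * s + m * t = 0 := by
    rw [hs, ht]; ring
  obtain ⟨C, hC, hS⟩ := exists_weighted_sobolev hp
  set A := C ^ s * M ^ t * K ^ r with hA
  have hA0 : 0 ≤ A := by positivity
  -- With this choice the dissipation ends up with coefficient ηA/(A+1) ≤ η; the added 1 covers A =
  -- 0.
  obtain ⟨D, hD, hY⟩ := exists_rpow_le_mul_add (a := 3 * s) (η := η / (2 * (A + 1)))
    (by positivity) hs3 (by positivity)
  refine ⟨A * (η / (2 * (A + 1)) * (6 * K) + D), by positivity, fun g h0 hgM hgK => ?_⟩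
  obtain ⟨i6, h6⟩ := hS g h0
  have hbp : ∀ (v : Vel) (s : ℝ), 0 < bracket v ^ s := fun v s =>
    Real.rpow_pos_of_pos (bracket_pos v) s
  have iE : Integrable fun v => bracket v ^ m * g v :=
    ((bracket_rpow_poly _).mul_rapid (schwartz_rapid g)).integrable
      ((bracket_rpow_continuous _).mul g.continuous).aestronglyMeasurable
  have iY := integrable_rpow h0 (by linarith : 0 < p)
  have n6 : ∀ v, 0 ≤ bracket v ^ (-9 : ℝ) * g v ^ (3 * p) := fun v =>
    mul_nonneg (hbp v _).le (Real.rpow_nonneg (h0 v) _)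
  have nE : ∀ v, 0 ≤ bracket v ^ m * g v := fun v => mul_nonneg (hbp v _).le (h0 v)
  have nY : ∀ v, 0 ≤ g v ^ p := fun v => Real.rpow_nonneg (h0 v) _
  have hH := integral_rpow_mul_rpow_mul_rpow_le n6 nE nY i6 iE iY hs0.le ht0.le hr0
    (by rw [hr]; ring)
  have hpt : ∀ v, (bracket v ^ (-9 : ℝ) * g v ^ (3 * p)) ^ s * (bracket v ^ m * g v) ^ t
      * (g v ^ p) ^ r = g v ^ (p + 1) := by
    intro v
    have hb := bracket_pos v
    rcases (h0 v).eq_or_lt' with h | h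
    · rw [h, Real.zero_rpow (by linarith : 3 * p ≠ 0), Real.zero_rpow (by linarith : p + 1 ≠ 0),
        mul_zero, Real.zero_rpow hs0.ne', zero_mul, zero_mul]
    · rw [Real.mul_rpow (hbp v _).le (Real.rpow_nonneg h.le _), Real.mul_rpow (hbp v _).le h.le,
        ← Real.rpow_mul hb.le, ← Real.rpow_mul hb.le, ← Real.rpow_mul h.le, ← Real.rpow_mul h.le]
      calc bracket v ^ (-9 * s) * g v ^ (3 * p * s) * (bracket v ^ (m * t) * g v ^ t)
            * g v ^ (p * r)
          = (bracket v ^ (-9 * s) * bracket v ^ (m * t))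
            * (g v ^ (3 * p * s) * g v ^ t * g v ^ (p * r)) := by ring
        _ = g v ^ (p + 1) := by
          rw [← Real.rpow_add hb, ← Real.rpow_add h, ← Real.rpow_add h, hpow1, hpow2,
            Real.rpow_zero, one_mul]
  simp only [hpt] at hH
  set X := ∫ v, bracket v ^ (-9 : ℝ) * g v ^ (3 * p) with hX
  set Δ := ∫ v, dissipation p g v with hΔ
  set Y := ∫ v, g v ^ p with hYdef
  have hX0 : 0 ≤ X := integral_nonneg n6
  have hΔ0 : 0 ≤ Δ := integral_nonneg (dissipation_nonneg p g)
  have hY0 : 0 ≤ Y := integral_nonneg nY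
  have hE0 : 0 ≤ ∫ v, bracket v ^ m * g v := integral_nonneg nE
  have hXs : X ^ s ≤ C ^ s * (2 * Δ + 6 * K) ^ (3 * s) := by
    calc X ^ s ≤ (C * (2 * Δ + 6 * K) ^ 3) ^ s := by
          refine Real.rpow_le_rpow hX0 (h6.trans ?_) hs0.le
          gcongr
      _ = _ := by
          have hZ : 0 ≤ 2 * Δ + 6 * K := by positivity
          rw [Real.mul_rpow hC (pow_nonneg hZ 3), ← Real.rpow_natCast, ← Real.rpow_mul hZ]
          norm_num
  calc ∫ v, g v ^ (p + 1) ≤ X ^ s * (∫ v, bracket v ^ m * g v) ^ t * Y ^ r := hH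
    _ ≤ (C ^ s * (2 * Δ + 6 * K) ^ (3 * s)) * M ^ t * K ^ r := by
        gcongr
    _ = A * (2 * Δ + 6 * K) ^ (3 * s) := by rw [hA]; ring
    _ ≤ A * (η / (2 * (A + 1)) * (2 * Δ + 6 * K) + D) := by
        gcongr
        exact hY _ (by positivity)
    _ = A / (A + 1) * (η * Δ) + A * (η / (2 * (A + 1)) * (6 * K) + D) := by
        field_simp
        ring
    _ ≤ η * Δ + A * (η / (2 * (A + 1)) * (6 * K) + D) := by
        refine add_le_add (mul_le_of_le_one_left (by positivity) ?_) le_rfl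
        rw [div_le_one (by positivity)]
        linarith

end interpolation

/-! ### Time derivatives of moments and L^p norms -/

section evolution

variable {T : ℝ} {f : ℝ → Vel → ℝ}

lemma abs_pd_le (g : 𝓢(Vel, ℝ)) (i : Fin 3) (v : Vel) :
    |pd i g v| ≤ ‖iteratedFDeriv ℝ 1 g v‖ := by
  rw [pd_apply, norm_iteratedFDeriv_one]
  exact abs_partialDeriv_le i g v

lemma abs_pd_pd_le (g : 𝓢(Vel, ℝ)) (i j : Fin 3) (v : Vel) :
    |pd i (pd j g) v| ≤ ‖iteratedFDeriv ℝ 2 g v‖ := by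
  have h : pd i (pd j g) v
      = iteratedFDeriv ℝ 2 g v ![EuclideanSpace.single i 1, EuclideanSpace.single j 1] := by
    rw [← SchwartzMap.iteratedLineDerivOp_eq_iteratedFDeriv]
    simp [pd, LineDeriv.iteratedLineDerivOp_succ_left]
  rw [h, ← Real.norm_eq_abs]
  refine (ContinuousMultilinearMap.le_opNorm _ _).trans_eq ?_
  simp [Fin.prod_univ_two]

namespace IsSchwartzSolution

lemma contDiff (hf : IsSchwartzSolution T f) {t : ℝ} (ht : t ∈ Ioo 0 T) : ContDiff ℝ ∞ (f t) := by
  rw [← contDiffOn_univ]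
  have h : ContDiffOn ℝ ∞ (fun v : Vel => (t, v)) univ := by fun_prop
  exact hf.smooth.comp h fun v _ => ⟨ht, mem_univ v⟩

/-- The solution at an interior time, as a Schwartz function. -/
def slice (hf : IsSchwartzSolution T f) {t : ℝ} (ht : t ∈ Ioo 0 T) : 𝓢(Vel, ℝ) where
  toFun := f t
  smooth' := hf.contDiff ht
  decay' k n := let ⟨C, hC⟩ := hf.decay k n; ⟨C, fun v => hC t ht v⟩

lemma coe_slice (hf : IsSchwartzSolution T f) {t : ℝ} (ht : t ∈ Ioo 0 T) :
    (hf.slice ht : Vel → ℝ) = f t := rfl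

lemma slice_nonneg (hf : IsSchwartzSolution T f) {t : ℝ} (ht : t ∈ Ioo 0 T) (v : Vel) :
    0 ≤ hf.slice ht v := hf.nonneg t (Ioo_subset_Icc_self ht) v

lemma exists_iteratedFDeriv_bound (hf : IsSchwartzSolution T f) (k n : ℕ) :
    ∃ C, 0 ≤ C ∧ ∀ t ∈ Ioo 0 T, ∀ v,
      ‖iteratedFDeriv ℝ n (f t) v‖ ≤ C * ((1 + ‖v‖) ^ k)⁻¹ := by
  obtain ⟨C, hC⟩ := hf.decay k n
  obtain ⟨D, hD⟩ := hf.decay 0 n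
  refine ⟨2 ^ (k - 1) * (|D| + |C|), by positivity, fun t ht v => ?_⟩
  have hp := one_add_norm_pos v
  rw [← div_eq_mul_inv, le_div_iff₀ (by positivity), mul_comm]
  have h1 := add_pow_le zero_le_one (norm_nonneg v) k
  have h2 := (hC t ht v).trans (le_abs_self C)
  have h3 := (hD t ht v).trans (le_abs_self D)
  rw [pow_zero, one_mul] at h3
  rw [one_pow] at h1
  calc (1 + ‖v‖) ^ k * ‖iteratedFDeriv ℝ n (f t) v‖
      ≤ 2 ^ (k - 1) * (1 + ‖v‖ ^ k) * ‖iteratedFDeriv ℝ n (f t) v‖ := by gcongr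
    _ = 2 ^ (k - 1) * (‖iteratedFDeriv ℝ n (f t) v‖
          + ‖v‖ ^ k * ‖iteratedFDeriv ℝ n (f t) v‖) := by ring
    _ ≤ _ := by gcongr

lemma continuousOn_time (hf : IsSchwartzSolution T f) (v : Vel) :
    ContinuousOn (fun t => f t v) (Icc 0 T) :=
  hf.continuousOn.comp (f := fun t : ℝ => (t, v)) (by fun_prop) fun _ ht => ⟨ht, mem_univ v⟩

lemma continuous_velocity (hf : IsSchwartzSolution T f) {t : ℝ} (ht : t ∈ Icc 0 T) :
    Continuous (f t) := by
  rw [← continuousOn_univ]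
  exact hf.continuousOn.comp (f := fun v : Vel => (t, v)) (by fun_prop) fun v _ => ⟨ht, mem_univ v⟩

/-- Decay is assumed on the open time interval only; continuity in time carries the bound to both
endpoints, so that the initial datum is reached. -/
lemma exists_bound (hf : IsSchwartzSolution T f) (hT : 0 < T) (k : ℕ) :
    ∃ C, 0 ≤ C ∧ ∀ t ∈ Icc 0 T, ∀ v, |f t v| ≤ C * ((1 + ‖v‖) ^ k)⁻¹ := by
  obtain ⟨C, hC, h⟩ := hf.exists_iteratedFDeriv_bound k 0
  refine ⟨C, hC, fun t ht v => ?_⟩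
  have hcl : closure (Ioo 0 T) = Icc 0 T := closure_Ioo hT.ne
  refine le_on_closure (s := Ioo 0 T) (f := fun t => |f t v|)
    (g := fun _ => C * ((1 + ‖v‖) ^ k)⁻¹) (fun s hs => ?_) ?_ continuousOn_const (hcl ▸ ht)
  · simpa using h s hs v
  · rw [hcl]
    exact (hf.continuousOn_time v).abs

lemma rapid (hf : IsSchwartzSolution T f) (hT : 0 < T) {t : ℝ} (ht : t ∈ Icc 0 T) :
    Rapid (f t) := fun k =>
  let ⟨C, hC, h⟩ := hf.exists_bound hT k
  ⟨C, hC, h t ht⟩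

lemma exists_collision_bound (hf : IsSchwartzSolution T f) {k : ℕ} (hk : 4 ≤ k) :
    ∃ C, 0 ≤ C ∧ ∀ t ∈ Ioo 0 T, ∀ v, |collision (f t) v| ≤ C * ((1 + ‖v‖) ^ k)⁻¹ := by
  obtain ⟨C0, hC0, h0⟩ := hf.exists_iteratedFDeriv_bound k 0
  obtain ⟨C1, hC1, h1⟩ := hf.exists_iteratedFDeriv_bound k 1
  obtain ⟨C2, hC2, h2⟩ := hf.exists_iteratedFDeriv_bound k 2
  have hB := potBound_nonneg
  refine ⟨24 * (C0 + C1 + C2) ^ 2 * potBound, by positivity, fun t ht v => ?_⟩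
  refine abs_collision_le (hf.slice ht) hk (fun v => ?_) (fun i v => ?_) (fun i j v => ?_) v
  · have := h0 t ht v
    rw [norm_iteratedFDeriv_zero, Real.norm_eq_abs] at this
    refine this.trans ?_
    gcongr
    linarith
  · refine (abs_pd_le _ i v).trans ((h1 t ht v).trans ?_)
    gcongr
    linarith
  · refine (abs_pd_pd_le _ i j v).trans ((h2 t ht v).trans ?_)
    gcongr
    linarith

/-- Evolution of a weighted integral of a solution. -/
lemma hasDerivAt_integral_mul (hf : IsSchwartzSolution T f) (hT : 0 < T) {W : Vel → ℝ}
    (hW : Continuous W) (hWp : Poly W) {t : ℝ} (ht : t ∈ Ioo 0 T) :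
    HasDerivAt (fun s => ∫ v, W v * f s v) (∫ v, W v * collision (f t) v) t := by
  obtain ⟨n, C, hC, hWb⟩ := hWp
  obtain ⟨D, hD, hcb⟩ := hf.exists_collision_bound (k := n + 4) (by omega)
  refine (hasDerivAt_integral_of_dominated_loc_of_deriv_le (μ := volume) (s := Ioo 0 T)
    (F := fun s v => W v * f s v) (F' := fun s v => W v * collision (f s) v) (x₀ := t)
    (bound := fun v => C * D * ((1 + ‖v‖) ^ 4)⁻¹)
    (Ioo_mem_nhds ht.1 ht.2) ?_ ?_ ?_ ?_ (integrable_weight.const_mul _) ?_).2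
  · filter_upwards [Ioo_mem_nhds ht.1 ht.2] with s hs
    exact (hW.mul (hf.continuous_velocity (Ioo_subset_Icc_self hs))).aestronglyMeasurable
  · have ht' := Ioo_subset_Icc_self ht
    exact (Poly.mul_rapid ⟨n, C, hC, hWb⟩ (hf.rapid hT ht')).integrable
      (hW.mul (hf.continuous_velocity ht')).aestronglyMeasurable
  · exact (hW.measurable.mul (measurable_collision _)).aestronglyMeasurable
  · refine ae_of_all _ fun v s hs => ?_
    have hp := one_add_norm_pos v
    rw [Real.norm_eq_abs, abs_mul]
    calc |W v| * |collision (f s) v|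
        ≤ (C * (1 + ‖v‖) ^ n) * (D * ((1 + ‖v‖) ^ (n + 4))⁻¹) :=
          mul_le_mul (hWb v) (hcb s hs v) (abs_nonneg _) (by positivity)
      _ = _ := by rw [pow_add]; field_simp
  · exact ae_of_all _ fun v s hs => (hf.equation s hs v).const_mul (W v)

lemma continuousOn_integral_mul (hf : IsSchwartzSolution T f) (hT : 0 < T) {W : Vel → ℝ}
    (hW : Continuous W) (hWp : Poly W) :
    ContinuousOn (fun s => ∫ v, W v * f s v) (Icc 0 T) := by
  obtain ⟨n, C, hC, hWb⟩ := hWp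
  obtain ⟨D, hD, hcb⟩ := hf.exists_bound hT (n + 4)
  refine continuousOn_of_dominated (bound := fun v => C * D * ((1 + ‖v‖) ^ 4)⁻¹) ?_ ?_
    (integrable_weight.const_mul _) ?_
  · exact fun s hs => (hW.mul (hf.continuous_velocity hs)).aestronglyMeasurable
  · refine fun s hs => ae_of_all _ fun v => ?_
    have hp := one_add_norm_pos v
    rw [Real.norm_eq_abs, abs_mul]
    calc |W v| * |f s v| ≤ (C * (1 + ‖v‖) ^ n) * (D * ((1 + ‖v‖) ^ (n + 4))⁻¹) :=
          mul_le_mul (hWb v) (hcb s hs v) (abs_nonneg _) (by positivity)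
      _ = _ := by rw [pow_add]; field_simp
  · exact ae_of_all _ fun v => continuousOn_const.mul (hf.continuousOn_time v)

/-- Evolution of the `Lᵖ` norm of a solution. -/
lemma hasDerivAt_integral_rpow (hf : IsSchwartzSolution T f) (hT : 0 < T) {p : ℝ} (hp : 1 < p)
    {t : ℝ} (ht : t ∈ Ioo 0 T) :
    HasDerivAt (fun s => ∫ v, f s v ^ p) (∫ v, p * f t v ^ (p - 1) * collision (f t) v) t := by
  obtain ⟨C, hC, hb⟩ := hf.exists_bound hT 0
  obtain ⟨D, hD, hcb⟩ := hf.exists_collision_bound (k := 4) le_rfl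
  have hp0 : 0 < p := by linarith
  refine (hasDerivAt_integral_of_dominated_loc_of_deriv_le (μ := volume) (s := Ioo 0 T)
    (F := fun s v => f s v ^ p) (F' := fun s v => p * f s v ^ (p - 1) * collision (f s) v)
    (x₀ := t) (bound := fun v => p * C ^ (p - 1) * D * ((1 + ‖v‖) ^ 4)⁻¹)
    (Ioo_mem_nhds ht.1 ht.2) ?_ ?_ ?_ ?_ (integrable_weight.const_mul _) ?_).2
  · filter_upwards [Ioo_mem_nhds ht.1 ht.2] with s hs
    exact ((hf.continuous_velocity (Ioo_subset_Icc_self hs)).rpow_const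
      fun _ => Or.inr hp0.le).aestronglyMeasurable
  · exact integrable_rpow (g := hf.slice ht) (hf.slice_nonneg ht) hp0
  · exact ((((hf.continuous_velocity (Ioo_subset_Icc_self ht)).rpow_const
      fun _ => Or.inr (by linarith)).measurable.const_mul p).mul
      (measurable_collision _)).aestronglyMeasurable
  · refine ae_of_all _ fun v s hs => ?_
    have h0 := hf.nonneg s (Ioo_subset_Icc_self hs) v
    have h1 := hb s (Ioo_subset_Icc_self hs) v
    rw [pow_zero, inv_one, mul_one, abs_of_nonneg h0] at h1
    rw [Real.norm_eq_abs, abs_mul, abs_of_nonneg (mul_nonneg hp0.le (Real.rpow_nonneg h0 _)),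
      mul_assoc _ D]
    refine mul_le_mul ?_ (hcb s hs v) (abs_nonneg _) (by positivity)
    exact mul_le_mul_of_nonneg_left (Real.rpow_le_rpow h0 h1 (by linarith)) hp0.le
  · refine ae_of_all _ fun v s hs => ?_
    -- The alternative 1 ≤ p is used instead of f ≠ 0, so zeros of the solution cause no trouble.
    have := (hf.equation s hs v).rpow_const (p := p) (Or.inr hp.le)
    convert! this using 1
    ring

lemma continuousOn_integral_rpow (hf : IsSchwartzSolution T f) (hT : 0 < T) {p : ℝ} (hp : 1 < p) :
    ContinuousOn (fun s => ∫ v, f s v ^ p) (Icc 0 T) := by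
  obtain ⟨C, hC, hb⟩ := hf.exists_bound hT 4
  have hp0 : 0 < p := by linarith
  refine continuousOn_of_dominated (bound := fun v => C ^ p * ((1 + ‖v‖) ^ 4)⁻¹) ?_ ?_
    (integrable_weight.const_mul _) ?_
  · exact fun s hs => ((hf.continuous_velocity hs).rpow_const
      fun _ => Or.inr hp0.le).aestronglyMeasurable
  · refine fun s hs => ae_of_all _ fun v => ?_
    have h0 := hf.nonneg s hs v
    have h1 := hb s hs v
    rw [abs_of_nonneg h0] at h1
    rw [Real.norm_of_nonneg (Real.rpow_nonneg h0 p)]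
    have hw : ((1 + ‖v‖) ^ 4)⁻¹ ≤ 1 := inv_le_one_of_one_le₀ (one_le_pow₀ (by simp))
    calc f s v ^ p ≤ (C * ((1 + ‖v‖) ^ 4)⁻¹) ^ p := Real.rpow_le_rpow h0 h1 hp0.le
      _ = C ^ p * (((1 + ‖v‖) ^ 4)⁻¹) ^ p := Real.mul_rpow hC (by positivity)
      _ ≤ C ^ p * ((1 + ‖v‖) ^ 4)⁻¹ := by
          refine mul_le_mul_of_nonneg_left ?_ (by positivity)
          exact Real.rpow_le_self_of_le_one (by positivity) hw hp.le
  · exact ae_of_all _ fun v => (hf.continuousOn_time v).rpow_const fun _ _ => Or.inr hp0.le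

end IsSchwartzSolution

end evolution

/-! ### Differential inequalities and the continuity argument -/

section ode

lemma sub_le_of_hasDerivAt_le {Y Y' : ℝ → ℝ} {t C : ℝ} (ht : 0 ≤ t)
    (hc : ContinuousOn Y (Icc 0 t)) (hd : ∀ s ∈ Ioo 0 t, HasDerivAt Y (Y' s) s)
    (hb : ∀ s ∈ Ioo 0 t, Y' s ≤ C) : Y t ≤ Y 0 + C * t := by
  have := (convex_Icc (0 : ℝ) t).image_sub_le_mul_sub_of_deriv_le hc
    (fun s hs => by
      rw [interior_Icc] at hs
      exact (hd s hs).differentiableAt.differentiableWithinAt)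
    (C := C) (fun s hs => by
      rw [interior_Icc] at hs
      rw [(hd s hs).deriv]
      exact hb s hs) 0 (left_mem_Icc.mpr ht) t (right_mem_Icc.mpr ht) ht
  linarith

/-- The mass has zero derivative at interior times, and continuity at the endpoints connects it to
its initial value; the growth bound is applied to the mass and to its negative. -/
lemma IsSchwartzSolution.integral_eq {T : ℝ} {f : ℝ → Vel → ℝ} (hf : IsSchwartzSolution T f)
    (hT : 0 < T) {t : ℝ} (ht : t ∈ Icc 0 T) : ∫ v, f t v = ∫ v, f 0 v := by
  have hpoly : Poly fun _ : Vel => (1 : ℝ) := .of_bound (C := 1) (by simp)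
  have hc := (hf.continuousOn_integral_mul hT continuous_const hpoly).mono
    (Icc_subset_Icc_right ht.2)
  have hd : ∀ s ∈ Ioo 0 t, HasDerivAt (fun s => ∫ v, 1 * f s v) 0 s := by
    intro s hs
    have hs' : s ∈ Ioo 0 T := ⟨hs.1, hs.2.trans_le ht.2⟩
    have h := hf.hasDerivAt_integral_mul hT continuous_const hpoly hs'
    have h0 := integral_collision_eq_zero (hf.slice hs')
    rw [hf.coe_slice] at h0
    simp only [one_mul, h0] at h ⊢
    exact h
  have h1 := sub_le_of_hasDerivAt_le (C := 0) ht.1 hc hd fun _ _ => le_rfl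
  have h2 := sub_le_of_hasDerivAt_le (C := 0) ht.1 hc.neg (fun s hs => (hd s hs).neg)
    fun _ _ => by simp
  simp only [one_mul, Pi.neg_apply, zero_mul, add_zero] at h1 h2
  linarith

/-- Continuity argument for two quantities whose growth is controlled as long as they are
bounded. -/
lemma le_of_bootstrap {Y Y' E E' : ℝ → ℝ} {τ K M C : ℝ} (hYc : ContinuousOn Y (Icc 0 τ))
    (hEc : ContinuousOn E (Icc 0 τ)) (hYd : ∀ s ∈ Ioo 0 τ, HasDerivAt Y (Y' s) s)
    (hEd : ∀ s ∈ Ioo 0 τ, HasDerivAt E (E' s) s) (hY0 : Y 0 ≤ K) (hE0 : E 0 ≤ M)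
    (hb : ∀ s ∈ Ioo 0 τ, Y s ≤ K + 1 → E s ≤ M + 1 → Y' s ≤ C ∧ E' s ≤ C)
    (hC : 0 ≤ C) (hCτ : C * τ ≤ 1 / 2) :
    ∀ t ∈ Icc 0 τ, Y t ≤ K + 1 ∧ E t ≤ M + 1 := by
  set φ : ℝ → ℝ := fun t => max (Y t - K) (E t - M) with hφ
  have hφc : ContinuousOn φ (Icc 0 τ) :=
    (hYc.sub continuousOn_const).sup (hEc.sub continuousOn_const)
  suffices h : ∀ t ∈ Icc 0 τ, φ t < 1 by
    intro t ht
    have h1 := max_lt_iff.mp (h t ht)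
    exact ⟨by linarith [h1.1], by linarith [h1.2]⟩
  by_contra hcon
  push Not at hcon
  obtain ⟨t₁, ht₁, h1⟩ := hcon
  have hcl : IsClosed (Icc 0 τ ∩ φ ⁻¹' Ici 1) := hφc.preimage_isClosed_of_isClosed isClosed_Icc
    isClosed_Ici
  -- Compactness yields a first time t₀ at which φ reaches 1. The bounds hold before t₀, so
  -- integrating the derivative bound gives φ(t₀) ≤ Cτ ≤ 1/2, a contradiction.
  have hcpt : IsCompact (Icc 0 τ ∩ φ ⁻¹' Ici 1) :=
    isCompact_Icc.of_isClosed_subset hcl inter_subset_left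
  obtain ⟨t₀, ⟨ht₀, h₀⟩, hmin⟩ := hcpt.exists_isLeast ⟨t₁, ht₁, h1⟩
  have hlt : ∀ s ∈ Ioo 0 t₀, s ∈ Ioo 0 τ ∧ Y s ≤ K + 1 ∧ E s ≤ M + 1 := by
    intro s hs
    have hsτ : s ∈ Ioo 0 τ := ⟨hs.1, hs.2.trans_le ht₀.2⟩
    have : φ s < 1 := by
      by_contra hge
      push Not at hge
      exact absurd (hmin ⟨Ioo_subset_Icc_self hsτ, hge⟩) (not_le.mpr hs.2)
    have h2 := max_lt_iff.mp this
    exact ⟨hsτ, by linarith [h2.1], by linarith [h2.2]⟩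
  have hsub : Icc 0 t₀ ⊆ Icc 0 τ := Icc_subset_Icc_right ht₀.2
  have hYt := sub_le_of_hasDerivAt_le ht₀.1 (hYc.mono hsub) (fun s hs => hYd s (hlt s hs).1)
    fun s hs => (hb s (hlt s hs).1 (hlt s hs).2.1 (hlt s hs).2.2).1
  have hEt := sub_le_of_hasDerivAt_le ht₀.1 (hEc.mono hsub) (fun s hs => hEd s (hlt s hs).1)
    fun s hs => (hb s (hlt s hs).1 (hlt s hs).2.1 (hlt s hs).2.2).2
  have hCt : C * t₀ ≤ 1 / 2 := (mul_le_mul_of_nonneg_left ht₀.2 hC).trans hCτ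
  have hφ1 : 1 ≤ φ t₀ := h₀
  have hφ2 : φ t₀ ≤ 1 / 2 := max_le (by linarith) (by linarith)
  linarith

/-- If `Y' ≤ C - κ D` with `D ≥ 0`, then `D` is integrable in time with the expected bound. -/
lemma lintegral_le_of_hasDerivAt {Y Y' D : ℝ → ℝ} {τ C κ : ℝ} (hτ : 0 ≤ τ) (hκ : 0 < κ)
    (hYc : ContinuousOn Y (Icc 0 τ)) (hYd : ∀ s ∈ Ioo 0 τ, HasDerivAt Y (Y' s) s)
    (hD : ∀ s ∈ Ioo 0 τ, 0 ≤ D s) (hb : ∀ s ∈ Ioo 0 τ, Y' s ≤ C - κ * D s) (hYτ : 0 ≤ Y τ) :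
    ∫⁻ t in Ioo 0 τ, ENNReal.ofReal (D t) ≤ ENNReal.ofReal ((Y 0 + C * τ) / κ) := by
  -- G is continuous with derivative at least D ≥ 0, so this derivative is integrable up to the
  -- endpoints. Comparing lower integrals with it requires no measurability of D in time.
  set G : ℝ → ℝ := fun t => (C * t - Y t) / κ with hG
  have hGc : ContinuousOn G (Icc 0 τ) :=
    ((continuousOn_const.mul continuousOn_id).sub hYc).div_const κ
  have hGd : ∀ s ∈ Ioo 0 τ, HasDerivAt G ((C - Y' s) / κ) s := fun s hs => by
    simpa using! (((hasDerivAt_id s).const_mul C).sub (hYd s hs)).div_const κ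
  have hDle : ∀ s ∈ Ioo 0 τ, D s ≤ (C - Y' s) / κ := fun s hs => by
    rw [le_div_iff₀ hκ]
    linarith [hb s hs]
  have hnn : ∀ s ∈ Ioo 0 τ, 0 ≤ (C - Y' s) / κ := fun s hs => (hD s hs).trans (hDle s hs)
  have hInt : IntegrableOn (fun s => (C - Y' s) / κ) (Ioc 0 τ) :=
    intervalIntegral.integrableOn_deriv_of_nonneg hGc hGd hnn
  have hFTC : ∫ s in (0 : ℝ)..τ, (C - Y' s) / κ = G τ - G 0 :=
    intervalIntegral.integral_eq_sub_of_hasDerivAt_of_le hτ hGc hGd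
      ((intervalIntegrable_iff_integrableOn_Ioc_of_le hτ).mpr hInt)
  calc ∫⁻ t in Ioo 0 τ, ENNReal.ofReal (D t)
      ≤ ∫⁻ t in Ioo 0 τ, ENNReal.ofReal ((C - Y' t) / κ) :=
        setLIntegral_mono' measurableSet_Ioo fun t ht => ENNReal.ofReal_le_ofReal (hDle t ht)
    _ = ENNReal.ofReal (∫ t in Ioo 0 τ, (C - Y' t) / κ) := by
        rw [ofReal_integral_eq_lintegral_ofReal (hInt.mono_set Ioo_subset_Ioc_self)]
        exact (ae_restrict_iff' measurableSet_Ioo).mpr (ae_of_all _ hnn)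
    _ ≤ ENNReal.ofReal ((Y 0 + C * τ) / κ) := by
        refine ENNReal.ofReal_le_ofReal ?_
        rw [← integral_Ioc_eq_integral_Ioo, ← intervalIntegral.integral_of_le hτ, hFTC]
        simp only [hG, mul_zero, zero_sub]
        rw [← sub_div]
        gcongr
        linarith

end ode

/-! ### The a priori estimate at a fixed time and the conclusion -/

section main

lemma eLpNorm_rpow_eq {g : Vel → ℝ} (h0 : ∀ v, 0 ≤ g v) {p : ℝ} (hp : 0 < p)
    (hi : Integrable fun v => g v ^ p) :
    eLpNorm g (ENNReal.ofReal p) volume ^ p = ENNReal.ofReal (∫ v, g v ^ p) := by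
  rw [eLpNorm_eq_lintegral_rpow_enorm_toReal (by simpa using hp) ENNReal.ofReal_ne_top,
    ENNReal.toReal_ofReal hp.le, ← ENNReal.rpow_mul, one_div_mul_cancel hp.ne', ENNReal.rpow_one,
    ofReal_integral_eq_lintegral_ofReal hi (ae_of_all _ fun v => Real.rpow_nonneg (h0 v) p)]
  refine lintegral_congr fun v => ?_
  rw [Real.enorm_of_nonneg (h0 v), ENNReal.ofReal_rpow_of_nonneg (h0 v) hp.le]

/-- A priori estimate at a fixed time: as long as the `Lᵖ` norm and the moment are bounded, the
former dissipates up to a constant and the latter grows at most linearly. -/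
lemma exists_apriori {p m : ℝ} (hp : 3 / 2 < p) (hm : 9 / 2 * ((p - 1) / (p - 3 / 2)) < m)
    {M K : ℝ} (hM : 0 ≤ M) (hK : 0 ≤ K) : ∃ κ C : ℝ, 0 < κ ∧ 0 ≤ C ∧
    ∀ g : 𝓢(Vel, ℝ), (∀ v, 0 ≤ g v) → ∫ v, g v = 1 → ∫ v, bracket v ^ m * g v ≤ M →
      ∫ v, g v ^ p ≤ K →
      ∫ v, p * g v ^ (p - 1) * collision g v ≤ C - κ * ∫ v, dissipation p g v ∧
      ∫ v, bracket v ^ m * collision g v ≤ C := by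
  have hm2 : 2 ≤ m := by
    have h1 : 1 ≤ (p - 1) / (p - 3 / 2) := by
      rw [one_le_div (by linarith)]; linarith
    linarith
  obtain ⟨c, hc, hcoer⟩ := exists_coercivity (by linarith : 1 < p) M K
  have hdr := driftConst_nonneg
  -- Chosen so that (p-1)·driftConst·η ≤ κ, where κ is half of the coercive coefficient 4(p-1)c/p.
  -- The drift uses one half of the dissipation and the other half is kept.
  set η := 2 * c / (p * (driftConst + 1)) with hη
  have hp0 : 0 < p := by linarith
  have hp1 : 0 < p - 1 := by linarith
  have hη0 : 0 < η := by positivity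
  obtain ⟨C₁, hC₁, hInt⟩ := exists_interpolation hp hm hM hK hη0
  set κ := 2 * (p - 1) / p * c with hκ
  set B := 1 + K + ∫ z, nearPow (p / (p - 1)) z with hB
  have hB0 : 0 ≤ B := by
    have : 0 ≤ ∫ z, nearPow (p / (p - 1)) z := integral_nonneg (nearPow_nonneg _)
    positivity
  refine ⟨κ, (p - 1) * (driftConst * C₁) + 21 * (m ^ 2 * B * M), by positivity, by positivity,
    fun g h0 hmass hE hY => ⟨?_, ?_⟩⟩
  · have hen : ∫ v, ‖v‖ ^ 2 * g v ≤ M := by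
      refine le_trans (integral_mono_of_nonneg (ae_of_all _ fun v =>
        mul_nonneg (by positivity) (h0 v)) (((bracket_rpow_poly m).mul_rapid
          (schwartz_rapid g)).integrable ((bracket_rpow_continuous _).mul
            g.continuous).aestronglyMeasurable) (ae_of_all _ fun v => ?_)) hE
      refine mul_le_mul_of_nonneg_right ?_ (h0 v)
      calc ‖v‖ ^ 2 ≤ bracket v ^ 2 := by
            have := norm_le_bracket v
            gcongr
        _ = bracket v ^ (2 : ℝ) := (Real.rpow_two _).symm
        _ ≤ bracket v ^ m := Real.rpow_le_rpow_of_exponent_le (one_le_bracket v) hm2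
    have h1 := integral_rpow_mul_collision_le h0 hp (hcoer g h0 hmass hen hY)
    have h2 := hInt g h0 hE hY
    have hD : 0 ≤ ∫ v, dissipation p g v := integral_nonneg (dissipation_nonneg p g)
    have h3 : (p - 1) * (driftConst * ∫ v, g v ^ (p + 1))
        ≤ (p - 1) * (driftConst * (η * (∫ v, dissipation p g v) + C₁)) := by gcongr
    have h4 : (p - 1) * (driftConst * η) ≤ κ := by
      rw [hη, hκ]
      have : driftConst / (driftConst + 1) ≤ 1 := by
        rw [div_le_one (by positivity)]; linarith
      calc (p - 1) * (driftConst * (2 * c / (p * (driftConst + 1))))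
          = 2 * (p - 1) / p * c * (driftConst / (driftConst + 1)) := by field_simp
        _ ≤ 2 * (p - 1) / p * c * 1 := by gcongr
        _ = _ := mul_one _
    have h5 := mul_le_mul_of_nonneg_right h4 hD
    have h6 : 4 * (p - 1) / p * c = 2 * κ := by rw [hκ]; ring
    rw [h6] at h1
    have h7 : 0 ≤ 21 * (m ^ 2 * B * M) := by positivity
    linarith
  · have hBb : ∀ v, conv (fun z => ‖z‖⁻¹) g v ≤ B := fun v =>
      (conv_inv_norm_le hp h0 v).trans (by rw [hmass, hB]; gcongr)
    have h1 := (le_abs_self _).trans (abs_integral_bracket_mul_collision_le hm2 h0 hBb)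
    have h2 : 21 * (m ^ 2 * B * ∫ v, bracket v ^ m * g v) ≤ 21 * (m ^ 2 * B * M) := by gcongr
    have h3 : 0 ≤ (p - 1) * (driftConst * C₁) := by positivity
    linarith

end main

end

end Landau

open Landau

theorem proposition3p1 (p m M N : ℝ) (hp : 3 / 2 < p)
    (hm : 9 / 2 * ((p - 1) / (p - 3 / 2)) < m) (hM : 0 < M) :
    ∃ T₀ : ℝ, 0 < T₀ ∧ ∃ C : ℝ, ∀ (T : ℝ) (f : ℝ → Landau.Vel → ℝ), 0 < T →
      Landau.IsSchwartzSolution T f →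
      Landau.IsNormalized (f 0) →
      (∫⁻ v, ENNReal.ofReal (Landau.bracket v ^ m * f 0 v)) +
          (∫⁻ v, ENNReal.ofReal (f 0 v * |Real.log (f 0 v)|)) ≤ ENNReal.ofReal M →
      eLpNorm (f 0) (ENNReal.ofReal p) volume ≤ ENNReal.ofReal N →
      (⨆ t ∈ Ioo 0 (min T T₀), eLpNorm (f t) (ENNReal.ofReal p) volume ^ p) +
          (∫⁻ t in Ioo 0 (min T T₀), ∫⁻ v, ENNReal.ofReal
            (Landau.bracket v ^ (-3 : ℝ) * ‖gradient (fun w => f t w ^ (p / 2)) v‖ ^ 2))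
        ≤ ENNReal.ofReal C := by
  -- `ENNReal.ofReal` truncates negative numbers to zero, so the hypothesis on the norm is really a
  -- bound by max N 0.
  set K : ℝ := (max N 0) ^ p with hK
  have hN0 : 0 ≤ max N 0 := le_max_right _ _
  have hK0 : 0 ≤ K := by positivity
  have hp0 : 0 < p := by linarith
  -- The a priori estimate is taken with one unit of room above both initial bounds, which is the
  -- room used by the continuity argument.
  obtain ⟨κ, C, hκ, hC, hap⟩ := exists_apriori hp hm (by linarith : 0 ≤ M + 1)
    (by linarith : 0 ≤ K + 1)
  -- This time makes C·τ ≤ 1/2 even when C = 0. The first summand of the constant bounds the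
  -- supremum; the second is (Y(0) + Cτ)/κ from integrating the dissipation.
  refine ⟨1 / (2 * (C + 1)), by positivity, (K + 1) + (K + 1 / 2) / κ, ?_⟩
  intro T f hT hf hnorm hmom hLp
  set τ := min T (1 / (2 * (C + 1))) with hτ
  have hτ0 : 0 < τ := lt_min hT (by positivity)
  have hτT : τ ≤ T := min_le_left _ _
  have hCτ : C * τ ≤ 1 / 2 := by
    calc C * τ ≤ C * (1 / (2 * (C + 1))) := mul_le_mul_of_nonneg_left (min_le_right _ _) hC
      _ ≤ 1 / 2 := by
        rw [mul_one_div, div_le_div_iff₀ (by positivity) (by norm_num)]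
        linarith
  have h0T : (0 : ℝ) ∈ Icc 0 T := left_mem_Icc.mpr hT.le
  have hsub : Icc 0 τ ⊆ Icc 0 T := Icc_subset_Icc_right hτT
  have hsub' : Ioo 0 τ ⊆ Ioo 0 T := Ioo_subset_Ioo_right hτT
  have hYi : ∀ t ∈ Icc 0 T, Integrable fun v => f t v ^ p := fun t ht =>
    ((hf.rapid hT ht).rpow (hf.nonneg t ht) hp0).integrable
      ((hf.continuous_velocity ht).rpow_const fun _ => Or.inr hp0.le).aestronglyMeasurable
  have hY0 : ∫ v, f 0 v ^ p ≤ K := by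
    have h1 := ENNReal.rpow_le_rpow hLp hp0.le
    rw [eLpNorm_rpow_eq (hf.nonneg 0 h0T) hp0 (hYi 0 h0T),
      show ENNReal.ofReal N = ENNReal.ofReal (max N 0) by
        simp [ENNReal.ofReal, ← NNReal.coe_inj, Real.coe_toNNReal'],
      ENNReal.ofReal_rpow_of_nonneg hN0 hp0.le] at h1
    exact (ENNReal.ofReal_le_ofReal_iff hK0).mp h1
  have hE0 : ∫ v, bracket v ^ m * f 0 v ≤ M := by
    have hnn : ∀ v, 0 ≤ bracket v ^ m * f 0 v := fun v =>
      mul_nonneg (Real.rpow_nonneg (bracket_pos v).le m) (hf.nonneg 0 h0T v)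
    rw [integral_eq_lintegral_of_nonneg_ae (ae_of_all _ hnn)
      ((bracket_rpow_continuous m).mul (hf.continuous_velocity h0T)).aestronglyMeasurable]
    exact ENNReal.toReal_le_of_le_ofReal hM.le (le_self_add.trans hmom)
  have hYc := (hf.continuousOn_integral_rpow hT (by linarith : 1 < p)).mono hsub
  have hEc := (hf.continuousOn_integral_mul hT (bracket_rpow_continuous m)
    (bracket_rpow_poly m)).mono hsub
  have hYd : ∀ s ∈ Ioo 0 τ, HasDerivAt (fun s => ∫ v, f s v ^ p)
      (∫ v, p * f s v ^ (p - 1) * collision (f s) v) s := fun s hs =>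
    hf.hasDerivAt_integral_rpow hT (by linarith) (hsub' hs)
  have hEd : ∀ s ∈ Ioo 0 τ, HasDerivAt (fun s => ∫ v, bracket v ^ m * f s v)
      (∫ v, bracket v ^ m * collision (f s) v) s := fun s hs =>
    hf.hasDerivAt_integral_mul hT (bracket_rpow_continuous m) (bracket_rpow_poly m) (hsub' hs)
  have hmass : ∀ s ∈ Ioo 0 τ, ∫ v, f s v = 1 := fun s hs => by
    rw [hf.integral_eq hT (Ioo_subset_Icc_self (hsub' hs)), hnorm.1]
  have hstep : ∀ s ∈ Ioo 0 τ, ∫ v, f s v ^ p ≤ K + 1 → ∫ v, bracket v ^ m * f s v ≤ M + 1 →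
      ∫ v, p * f s v ^ (p - 1) * collision (f s) v ≤ C - κ * ∫ v, dissipation p (f s) v ∧
      ∫ v, bracket v ^ m * collision (f s) v ≤ C := fun s hs hY hE =>
    hap (hf.slice (hsub' hs)) (hf.slice_nonneg (hsub' hs)) (hmass s hs) hE hY
  have hD0 : ∀ s, 0 ≤ ∫ v, dissipation p (f s) v := fun s =>
    integral_nonneg (dissipation_nonneg p (f s))
  have hbd := le_of_bootstrap hYc hEc hYd hEd hY0 hE0 (C := C)
    (fun s hs hY hE => ⟨(hstep s hs hY hE).1.trans
      (by nlinarith [mul_nonneg hκ.le (hD0 s)]), (hstep s hs hY hE).2⟩) hC hCτ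
  have hsup : (⨆ t ∈ Ioo 0 τ, eLpNorm (f t) (ENNReal.ofReal p) volume ^ p)
      ≤ ENNReal.ofReal (K + 1) := by
    refine iSup₂_le fun t ht => ?_
    have ht' := Ioo_subset_Icc_self ht
    rw [eLpNorm_rpow_eq (hf.nonneg t (hsub ht')) hp0 (hYi t (hsub ht'))]
    exact ENNReal.ofReal_le_ofReal (hbd t ht').1
  have hdis : (∫⁻ t in Ioo 0 τ, ∫⁻ v, ENNReal.ofReal
      (bracket v ^ (-3 : ℝ) * ‖gradient (fun w => f t w ^ (p / 2)) v‖ ^ 2))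
      ≤ ENNReal.ofReal ((K + 1 / 2) / κ) := by
    have h1 := lintegral_le_of_hasDerivAt hτ0.le hκ hYc hYd (fun s _ => hD0 s)
      (fun s hs => (hstep s hs (hbd s (Ioo_subset_Icc_self hs)).1
        (hbd s (Ioo_subset_Icc_self hs)).2).1)
      (integral_nonneg fun v => Real.rpow_nonneg
        (hf.nonneg τ (hsub (right_mem_Icc.mpr hτ0.le)) v) p)
    refine le_trans (le_of_eq (setLIntegral_congr_fun measurableSet_Ioo fun t ht => ?_))
      (h1.trans (ENNReal.ofReal_le_ofReal (by gcongr)))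
    exact (ofReal_integral_eq_lintegral_ofReal
      (integrable_dissipation (g := hf.slice (hsub' ht)) (hf.slice_nonneg (hsub' ht)) hp)
      (ae_of_all _ (dissipation_nonneg p (f t)))).symm
  rw [ENNReal.ofReal_add (by positivity) (by positivity)]
  exact add_le_add hsup hdis
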